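/- Let $K$ be a field of characteristic zero (for instance $K=\mathbb{R}$) and $n\ge 0$. For an antisymmetric matrix $\theta\in K^{n\times n}$ let $A_\theta$ be the unital dg-algebra whose elements are the polynomials $a=a_0(x)+a_i(x)\xi^i$ in $x^1,\dots,x^n,\xi^1,\dots,\xi^n$ at most linear in the $\xi$'s, with $\deg x^i=0$, $\deg\xi^i=1$, $dx^i=\xi^i$, $d\xi^i=0$ and the product $$f\ast_\theta g=\mu\sum_{k\ge 0}\frac1{k!}\Big(\tfrac12\theta^{ij}\tfrac{\partial}{\partial x^i}\otimes\tfrac{\partial}{\partial x^j}\Big)^k f\otimes g ,$$ where $\mu$ multiplies polynomials and discards terms quadratic in $\xi$ (so $[x^i,x^j]=\theta^{ij}$, $x^i\xi^j=\xi^jx^i$, $\xi^i\xi^j=0$). Write $\bar a=\deg a-1$. Then $A_\theta$ is an $A_\infty$-algebra with $m_1(a)=da$, $m_2(a,b)=(-1)^{\bar a}a\ast_\theta b$ and $m_l=0$ for $l>2$. *Homotopy.* A series $\phi=\phi^0(p)+\phi^i(p)\zeta_i$, with formal power series $\phi^0,\phi^i$ in $p_1,\dots,p_n$ and $\deg p_i=0$,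 $\deg\zeta_i=-1$, acts by $\sigma(\phi)(a)=\phi^0(\partial)a_0+\phi^j(\partial)a_j$. Every $l$-linear map from $A_\theta$ to $A_{\theta'}$ is $\Sigma(\Phi)$ for a unique $\Phi$ in the completion of $A_{\theta'}\otimes B^{\otimes l}$, where $B$ is the space of such series and $\Sigma(a\otimes\phi_1\otimes\cdots\otimes\phi_l)(a_1,\dots,a_l)=a\,\sigma(\phi_1)(a_1)\cdots\sigma(\phi_l)(a_l)$ (ordinary product of polynomials). Put $$h\phi=\zeta_i\int_0^1\frac{\partial\phi^0}{\partial p_i}(tp)\,dt,\qquad \pi\phi=\phi^0(0)+\phi^i(p)\zeta_i-\zeta_j\frac{\partial}{\partial p_j}\int_0^1p_i\phi^i(tp)\,dt,$$ $$h_l(a\otimes\phi_1\otimes\cdots\otimes\phi_l)=\sum_{i=1}^l(-1)^{\sum_{j<i}(\deg\phi_j+1)}\,a\otimes\phi_1\otimes\cdots\otimes\phi_{i-1}\otimes h\phi_i\otimes\pi\phi_{i+1}\otimes\cdots\otimes\pi\phi_l ,$$ and $h^\Sigma_l=\Sigma h_l\Sigma^{-1}$. *Recurrence.* For a sequence of $l$-linear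 maps $f_l$ ($l\ge1$) from $A_\theta$ to $A_{\theta'}$ let $$\Psi_l(a_1,\dots,a_l)=\sum_{i=1}^{l-1}(-1)^{\bar a_1+\cdots+\bar a_i}\big(f_{l-1}(a_1,\dots,a_i\ast_\theta a_{i+1},\dots,a_l)-f_i(a_1,\dots,a_i)\ast_{\theta'}f_{l-i}(a_{i+1},\dots,a_l)\big),$$ and let $f''_l,\Psi''_l$ and $f'_l,\Psi'_l$ be the components of $f_l,\Psi_l$ with values in degree $0$ and degree $1$. Put $\Theta''_l=-\Psi''_l$ and $\Theta'_l=d f''_l-\Psi'_l$. The recurrence is $$f''_l=h^\Sigma_l\Theta''_l\quad(l\ge2),\qquad f'_l=h^\Sigma_l\Theta'_l\quad(l\ge1),\qquad f''_1(a)=a_0 .$$ **Theorem.** Let $\theta,\theta'$ be antisymmetric. 1. The recurrence has exactly one solution $f=(f_l)_{l\ge1}$. It has $f_1=\mathrm{id}$, and for $l\ge2$ every $f_l$ is normal, i.e. vanishes when one of its arguments is $1$. 2. $f$ is an $A_\infty$-morphism $A_\theta\to A_{\theta'}$; it is a quasi-isomorphism, and it is an isomorphism of $A_\infty$-algebras: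 there is an $A_\infty$-morphism $A_{\theta'}\to A_\theta$ which is a two-sided inverse of $f$. 3. Let $f=f^{\theta}$ be the solution for the pair $A_0,A_\theta$. For a gauge potential $\mathcal A=(\mathcal A_i)$ and a gauge parameter $\lambda$ with polynomial components, identify $\mathcal A$ with $\mathcal A_i\xi^i$ and set, as formal series in the degree in $\mathcal A$, $$\hat{\mathcal A}(\mathcal A)=\sum_{l\ge1}f'_l(\mathcal A,\dots,\mathcal A),\qquad\hat\lambda(\lambda,\mathcal A)=\sum_{s,u\ge0}f''_{s+u+1}(\underbrace{\mathcal A,\dots,\mathcal A}_{s},\lambda,\underbrace{\mathcal A,\dots,\mathcal A}_{u}).$$ These form a Seiberg–Witten map, exactly in $\theta$: for every antisymmetric $\theta$, with $\delta_\lambda\mathcal A_i=\partial_i\lambda$ and $\hat\lambda_r=\hat\lambda(\lambda_r,\mathcal A)$, $$\delta_\lambda\hat{\mathcal A}_i=\partial_i\hat\lambda+[\hat{\mathcal A}_i,\hat\lambda]_{\ast_\theta},\qquad \delta_{\lambda_2}\hat\lambda_1-\delta_{\lambda_1}\hat\lambda_2=[\hat\lambda_1,\hat\lambda_2]_{\ast_\theta}-\hat\lambda([\lambda_1,\lambda_2],\mathcal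 A)$$ hold in each degree in $\mathcal A$ (the commutator $[\lambda_1,\lambda_2]$, taken in $A_0$, is zero), and $\hat{\mathcal A}=\mathcal A+O(\theta)$, $\hat\lambda=\lambda+O(\theta)$: for given $\mathcal A$ and $\lambda$, in each degree in $\mathcal A$ the terms $O(\theta)$ are polynomials in the entries of $\theta$ without constant term. -/

import Mathlib

open scoped TensorProduct

noncomputable section

namespace SeibergWitten

/-! ## A-infinity algebras and their morphisms

Graded spaces are given by a family of submodules `𝒜 : ℤ → Submodule K V`.  The bar degree of
`a ∈ 𝒜 d` is `d - 1`, i.e. its degree in the shifted space `V[1]`.  Arguments of multilinear maps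
are numbered from `0` and are read off from an infinite sequence `a : ℕ → V`, of which a cochain of
arity `l` only sees `a 0, …, a (l - 1)`. -/

/-- Sequences of multilinear maps `f_0, f_1, f_2, …`, `f_l` having `l` arguments; the cochains of
`Hom (B(V), W[1])` are those with `f_0 = 0`. -/
abbrev Cochain (K V W : Type*) [CommSemiring K] [AddCommMonoid V] [AddCommMonoid W]
    [Module K V] [Module K W] : Type _ :=
  (l : ℕ) → MultilinearMap K (fun _ : Fin l => V) W

section AInfinity

variable {K V W X : Type*} [Field K] [AddCommGroup V] [AddCommGroup W] [AddCommGroup X]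
  [Module K V] [Module K W] [Module K X]

/-- `f_l (a_0, …, a_{l-1})`. -/
def ev (f : Cochain K V W) (l : ℕ) (a : ℕ → V) : W := f l (fun j => a j)

/-- The Koszul sign `(-1)^{ā_0 + ⋯ + ā_{i-1}}`, where `d j` is the (unshifted) degree of `a_j`. -/
def koszul (d : ℕ → ℤ) (i : ℕ) : ℤˣ := Int.negOnePow (∑ j ∈ Finset.range i, (d j - 1))

/-- `f` is homogeneous of degree `k` as an element of `Hom (B(V), W[1])`. -/
def HasDegree (𝒜 : ℤ → Submodule K V) (ℬ : ℤ → Submodule K W) (k : ℤ) (f : Cochain K V W) : Prop :=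
  ∀ (l : ℕ) (d : ℕ → ℤ) (a : ℕ → V), (∀ j < l, a j ∈ 𝒜 (d j)) →
    ev f l a ∈ ℬ (∑ j ∈ Finset.range l, (d j - 1) + k + 1)

/-- The sequence `a_0, …, a_{i-1}, y, a_{i+l}, a_{i+l+1}, …`
in which the `l ≥ 1` entries starting at position `i` have been replaced by `y`. -/
def contract (i l : ℕ) (y : V) (a : ℕ → V) : ℕ → V := fun j =>
  if j < i then a j else if j = i then y else a (j + l - 1)

/-- `(f ∘ m̂)(a_0, …, a_{N-1})` for homogeneous arguments `a_j` of degrees `d_j`, where `m̂` is the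
coderivation of the bar coalgebra defined by a cochain `m` of degree one:
`∑ ± f (a_0, …, a_{i-1}, m_l (a_i, …, a_{i+l-1}), a_{i+l}, …, a_{N-1})`. -/
def compCoder (f : Cochain K V W) (m : Cochain K V V) (N : ℕ) (d : ℕ → ℤ) (a : ℕ → V) : W :=
  ∑ l ∈ Finset.Icc 1 N, ∑ i ∈ Finset.range (N + 1 - l),
    koszul d i • ev f (N + 1 - l) (contract i l (ev m l (fun j => a (i + j))) a)

/-- `(g ∘ F)(a_0, …, a_{N-1})`, where `F` is the morphism of bar coalgebras defined by a cochain `f`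
of degree zero: the sum of `g_k (f_{i_1}(a_0, …), …, f_{i_k}(…, a_{N-1}))` over all
`i_1 + ⋯ + i_k = N` with `i_1, …, i_k ≥ 1`. -/
def compCohom (g : Cochain K W X) (f : Cochain K V W) (N : ℕ) (a : ℕ → V) : X :=
  ∑ c : Composition N,
    g c.length (fun r => f (c.blocksFun r) (fun j => a (c.embedding r j)))

/-- `m` is an A-infinity structure on the graded vector space `(V, 𝒜)`: an element of degree one of
`Hom (B(V), V[1])` whose coderivation `m̂` satisfies `m̂ m̂ = 0`. -/
structure IsAInfinityAlgebra (𝒜 : ℤ → Submodule K V) (m : Cochain K V V) : Prop where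
  internal : DirectSum.IsInternal 𝒜
  zero : m 0 = 0
  degree : HasDegree 𝒜 𝒜 1 m
  relation : ∀ (N : ℕ) (d : ℕ → ℤ) (a : ℕ → V), (∀ j < N, a j ∈ 𝒜 (d j)) →
    compCoder m m N d a = 0

/-- `f` is a morphism of A-infinity algebras `(V, 𝒜, m) → (W, ℬ, m')`: an element of degree zero of
`Hom (B(V), W[1])` with `m'_1(f) + m'_2(f,f) + m'_3(f,f,f) + ⋯ = f ∘ m̂`. -/
structure IsAInfinityMorphism (𝒜 : ℤ → Submodule K V) (m : Cochain K V V)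
    (ℬ : ℤ → Submodule K W) (m' : Cochain K W W) (f : Cochain K V W) : Prop where
  zero : f 0 = 0
  degree : HasDegree 𝒜 ℬ 0 f
  relation : ∀ (N : ℕ) (d : ℕ → ℤ) (a : ℕ → V), (∀ j < N, a j ∈ 𝒜 (d j)) →
    compCohom m' f N a = compCoder f m N d a

/-- The components of the identity morphism. -/
def idCochain (N : ℕ) (a : ℕ → V) : V := if N = 1 then a 0 else 0

/-- `f` is an isomorphism of A-infinity algebras: a morphism with a two-sided inverse with respect
to the composition of morphisms of bar coalgebras. -/
def IsAInfinityIso (𝒜 : ℤ → Submodule K V) (m : Cochain K V V)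
    (ℬ : ℤ → Submodule K W) (m' : Cochain K W W) (f : Cochain K V W) : Prop :=
  IsAInfinityMorphism 𝒜 m ℬ m' f ∧
    ∃ g : Cochain K W V, IsAInfinityMorphism ℬ m' 𝒜 m g ∧
      (∀ (N : ℕ) (a : ℕ → V), compCohom g f N a = idCochain N a) ∧
      (∀ (N : ℕ) (b : ℕ → W), compCohom f g N b = idCochain N b)

/-- `f` is a quasi-isomorphism of A-infinity algebras: a morphism such that `f_1` induces a
bijection from the cohomology of `m_1` to the cohomology of `m'_1`. -/
def IsAInfinityQuasiIso (𝒜 : ℤ → Submodule K V) (m : Cochain K V V)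
    (ℬ : ℤ → Submodule K W) (m' : Cochain K W W) (f : Cochain K V W) : Prop :=
  IsAInfinityMorphism 𝒜 m ℬ m' f ∧
    (∀ a : V, m 1 (fun _ => a) = 0 → (∃ b : W, f 1 (fun _ => a) = m' 1 (fun _ => b)) →
      ∃ c : V, a = m 1 (fun _ => c)) ∧
    (∀ b : W, m' 1 (fun _ => b) = 0 →
      ∃ a : V, m 1 (fun _ => a) = 0 ∧ ∃ c : W, b = f 1 (fun _ => a) + m' 1 (fun _ => c))

end AInfinity

/-! ## The dg-algebras `A_θ` -/

section WeylMoyal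

variable {K : Type*} [Field K] {n : ℕ}

/-- The bidifferential operator `½ θ^{ij} ∂_i ⊗ ∂_j` on pairs of polynomials. -/
def bidiff (θ : Matrix (Fin n) (Fin n) K) :
    Module.End K (MvPolynomial (Fin n) K ⊗[K] MvPolynomial (Fin n) K) :=
  ∑ i, ∑ j, ((1 / 2 : K) * θ i j) •
    TensorProduct.map (MvPolynomial.pderiv i).toLinearMap (MvPolynomial.pderiv j).toLinearMap

/-- The `k`-th term `μ ((1/k!) (½ θ^{ij} ∂_i ⊗ ∂_j)^k u)` of the Weyl-Moyal product. -/
def moyalTerm (θ : Matrix (Fin n) (Fin n) K) (k : ℕ) :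
    MvPolynomial (Fin n) K ⊗[K] MvPolynomial (Fin n) K →ₗ[K] MvPolynomial (Fin n) K :=
  (k.factorial : K)⁻¹ • (LinearMap.mul' K (MvPolynomial (Fin n) K) ∘ₗ (bidiff θ ^ k))

theorem bidiff_pow_monomial (θ : Matrix (Fin n) (Fin n) K) (k : ℕ) :
    ∀ (α : Fin n →₀ ℕ) (c : K) (g : MvPolynomial (Fin n) K), α.degree < k →
      (bidiff θ ^ k) (MvPolynomial.monomial α c ⊗ₜ[K] g) = 0 := by
  induction k with
  | zero => intro α c g h; omega
  | succ k ih =>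
    intro α c g h
    rw [pow_succ, Module.End.mul_apply, bidiff]
    simp only [LinearMap.sum_apply, map_sum, LinearMap.smul_apply, map_smul,
      TensorProduct.map_tmul, Derivation.coeFn_coe, MvPolynomial.pderiv_monomial]
    refine Finset.sum_eq_zero fun i _ => Finset.sum_eq_zero fun j _ => ?_
    rw [← bidiff]
    by_cases hi : α i = 0
    · simp [hi]
    · rw [ih, smul_zero]
      have h1 : Finsupp.single i 1 ≤ α := by
        rw [Finsupp.single_le_iff]; omega
      have h2 := congrArg Finsupp.degree (tsub_add_cancel_of_le h1)
      rw [map_add, Finsupp.degree_single] at h2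
      omega

/-- The series defining the Weyl-Moyal product of polynomials is a finite sum. -/
theorem moyalTerm_finite (θ : Matrix (Fin n) (Fin n) K)
    (u : MvPolynomial (Fin n) K ⊗[K] MvPolynomial (Fin n) K) :
    (Function.support fun k => moyalTerm θ k u).Finite := by
  suffices h : ∃ N, ∀ k, N ≤ k → (bidiff θ ^ k) u = 0 by
    obtain ⟨N, hN⟩ := h
    refine (Set.finite_lt_nat N).subset fun k hk => ?_
    by_contra hk'
    exact hk (by simp [moyalTerm, hN k (not_lt.mp hk')])
  induction u using TensorProduct.induction_on with
  | zero => exact ⟨0, by simp⟩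
  | tmul f g =>
    induction f using MvPolynomial.induction_on' with
    | monomial α c =>
      exact ⟨α.degree + 1, fun k hk => bidiff_pow_monomial θ k α c g (by omega)⟩
    | add p q hp hq =>
      obtain ⟨N, hN⟩ := hp
      obtain ⟨M, hM⟩ := hq
      exact ⟨max N M, fun k hk => by
        rw [TensorProduct.add_tmul, map_add, hN k (le_trans (le_max_left _ _) hk),
          hM k (le_trans (le_max_right _ _) hk), add_zero]⟩
  | add x y hx hy =>
    obtain ⟨N, hN⟩ := hx
    obtain ⟨M, hM⟩ := hy
    exact ⟨max N M, fun k hk => by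
      rw [map_add, hN k (le_trans (le_max_left _ _) hk),
        hM k (le_trans (le_max_right _ _) hk), add_zero]⟩

/-- The Weyl-Moyal product
`f ⋆_θ g = μ ∑_k (1/k!) (½ θ^{ij} ∂_i ⊗ ∂_j)^k (f ⊗ g)`, as a linear map on `f ⊗ g`. -/
def moyalMap (θ : Matrix (Fin n) (Fin n) K) :
    MvPolynomial (Fin n) K ⊗[K] MvPolynomial (Fin n) K →ₗ[K] MvPolynomial (Fin n) K where
  toFun u := ∑ᶠ k : ℕ, moyalTerm θ k u
  map_add' u v := by
    simp only [map_add]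
    exact finsum_add_distrib (moyalTerm_finite θ u) (moyalTerm_finite θ v)
  map_smul' c u := by
    simp only [map_smul, RingHom.id_apply]
    exact (smul_finsum' c (moyalTerm_finite θ u)).symm

/-- The Weyl-Moyal product of two polynomials. -/
def moyal (θ : Matrix (Fin n) (Fin n) K) (f g : MvPolynomial (Fin n) K) : MvPolynomial (Fin n) K :=
  moyalMap θ (f ⊗ₜ[K] g)

variable (K n) in
/-- The graded vector space underlying `A_θ` for every `θ`: the pair `(a_0, (a_i)_i)` stands for the
polynomial `a_0(x) + ∑ a_i(x) ξ^i`. -/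
abbrev WeylSpace : Type _ := MvPolynomial (Fin n) K × (Fin n → MvPolynomial (Fin n) K)

/-- The unit of `A_θ`. -/
def unit : WeylSpace K n := (1, 0)

/-- The product of `A_θ`; products `ξ^i ξ^j` vanish. -/
def starMul (θ : Matrix (Fin n) (Fin n) K) :
    WeylSpace K n →ₗ[K] WeylSpace K n →ₗ[K] WeylSpace K n :=
  LinearMap.mk₂ K
    (fun a b => (moyal θ a.1 b.1, fun i => moyal θ a.1 (b.2 i) + moyal θ (a.2 i) b.1))
    (by
      intro a b c
      ext1
      · simp [moyal, TensorProduct.add_tmul]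
      · funext i
        simp only [moyal, Prod.fst_add, Prod.snd_add, Pi.add_apply, TensorProduct.add_tmul, map_add]
        ring)
    (by
      intro c a b
      ext1
      · simp [moyal, ← TensorProduct.smul_tmul']
      · funext i
        simp [moyal, ← TensorProduct.smul_tmul', smul_add])
    (by
      intro a b c
      ext1
      · simp [moyal, TensorProduct.tmul_add]
      · funext i
        simp only [moyal, Prod.fst_add, Prod.snd_add, Pi.add_apply, TensorProduct.tmul_add, map_add]
        ring)
    (by
      intro c a b
      ext1
      · simp [moyal, TensorProduct.tmul_smul]
      · funext i
        simp [moyal, TensorProduct.tmul_smul, smul_add])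

/-- The gradient `λ ↦ (∂_i λ)_i`. -/
def grad (f : MvPolynomial (Fin n) K) : Fin n → MvPolynomial (Fin n) K :=
  fun i => MvPolynomial.pderiv i f

/-- The differential `d x^i = ξ^i`, `d ξ^i = 0`. -/
def diff : WeylSpace K n →ₗ[K] WeylSpace K n where
  toFun a := (0, grad a.1)
  map_add' a b := by ext1 <;> [simp; (funext i; simp [grad])]
  map_smul' c a := by ext1 <;> [simp; (funext i; simp [grad])]

variable (K n) in
/-- The grading `deg x^i = 0`, `deg ξ^i = 1`. -/
def grading (k : ℤ) : Submodule K (WeylSpace K n) where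
  carrier := {a | (k ≠ 0 → a.1 = 0) ∧ (k ≠ 1 → a.2 = 0)}
  zero_mem' := by simp
  add_mem' := by
    rintro a b ⟨h1, h2⟩ ⟨h3, h4⟩
    exact ⟨fun h => by simp [h1 h, h3 h], fun h => by simp [h2 h, h4 h]⟩
  smul_mem' := by
    rintro c a ⟨h1, h2⟩
    exact ⟨fun h => by simp [h1 h], fun h => by simp [h2 h]⟩

/-- The component of degree zero. -/
def part0 (a : WeylSpace K n) : WeylSpace K n := (a.1, 0)

/-- The component of degree one. -/
def part1 (a : WeylSpace K n) : WeylSpace K n := (0, a.2)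

/-- The linear map `a ↦ (-1)^{ā} a`, where `ā = deg a - 1`. -/
def barParity : WeylSpace K n →ₗ[K] WeylSpace K n where
  toFun a := (-a.1, a.2)
  map_add' a b := by ext1 <;> simp [add_comm]
  map_smul' c a := by ext1 <;> simp

/-- `A_θ` as an A-infinity algebra: `m_1 (a) = d a`, `m_2 (a, b) = (-1)^{ā} a b`, and `m_l = 0` for
all other `l`. -/
def structureMaps (θ : Matrix (Fin n) (Fin n) K) : Cochain K (WeylSpace K n) (WeylSpace K n)
  | 1 =>
    { toFun := fun a => diff (a 0)
      map_update_add' := by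
        intro _ a i x y
        obtain rfl : i = 0 := Subsingleton.elim _ _
        simp
      map_update_smul' := by
        intro _ a i c x
        obtain rfl : i = 0 := Subsingleton.elim _ _
        simp }
  | 2 =>
    { toFun := fun a => starMul θ (barParity (a 0)) (a 1)
      map_update_add' := by
        intro inst a i x y
        obtain rfl := Subsingleton.elim inst (instDecidableEqFin 2)
        fin_cases i <;> simp
      map_update_smul' := by
        intro inst a i c x
        obtain rfl := Subsingleton.elim inst (instDecidableEqFin 2)
        fin_cases i <;> simp }
  | _ => 0

/-- A cochain of arity `l` is normal if it vanishes whenever one of its arguments is the unit. -/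
def IsNormal {l : ℕ} (f : MultilinearMap K (fun _ : Fin l => WeylSpace K n) (WeylSpace K n)) :
    Prop :=
  ∀ a : Fin l → WeylSpace K n, (∃ i, a i = unit) → f a = 0

/-- The cochain
`Ψ_l [f_1, …, f_{l-1}] (a_0, …, a_{l-1}) =
∑_i (-1)^{ā_0 + ⋯ + ā_i} f_{l-1} (a_0, …, a_i ⋆_θ a_{i+1}, …, a_{l-1})
- ∑_i (-1)^{ā_0 + ⋯ + ā_{i-1}} f_i (a_0, …, a_{i-1}) ⋆_{θ'} f_{l-i} (a_i, …, a_{l-1})`. -/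
def Psi (θ θ' : Matrix (Fin n) (Fin n) K) (f : Cochain K (WeylSpace K n) (WeylSpace K n))
    (l : ℕ) (a : ℕ → WeylSpace K n) : WeylSpace K n :=
  ∑ i ∈ Finset.range (l - 1),
      ev f (l - 1) (fun j =>
        if j < i then barParity (a j)
        else if j = i then starMul θ (barParity (a i)) (a (i + 1))
        else a (j + 1))
    - ∑ i ∈ Finset.Icc 1 (l - 1),
      starMul θ' (ev f i (fun j => barParity (a j))) (ev f (l - i) (fun j => a (i + j)))

/-! ## Symbols and the homotopy operator -/

variable (n) in
/-- Labels of the monomials in `p_1, …, p_n, ζ_1, …, ζ_n` of degree at most one in the `ζ`'s: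
`(α, none)` stands for `p^α` and `(α, some i)` for `p^α ζ_i`. -/
abbrev Slot : Type := (Fin n →₀ ℕ) × Option (Fin n)

variable (n) in
/-- Formal series `φ = φ^0(p) + ∑ φ^i(p) ζ_i` with coefficients in `M`. For `M = K` these form the
complex `B` dual to `A_θ`. -/
abbrev Series (M : Type*) : Type _ := Slot n → M

variable (K n) in
/-- The completed tensor product `A_θ ⊗ B^{⊗ l}`: formal series in `l` sets of variables `p, ζ` with
coefficients in `A_θ`. -/
abbrev Symbol (l : ℕ) : Type _ := (Fin l → Slot n) → WeylSpace K n

section Series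

variable {M : Type*} [AddCommGroup M] [Module K M]

/-- `∂F/∂p_i` for a formal power series `F` in the `p`'s. -/
def psDeriv (i : Fin n) (F : (Fin n →₀ ℕ) → M) : (Fin n →₀ ℕ) → M :=
  fun α => (α i + 1) • F (α + Finsupp.single i 1)

variable (K) in
/-- `∫_0^1 F(t p) dt` for a formal power series `F` in the `p`'s: `t^k` integrates to
`1/(k+1)`. -/
def psIntegral (F : (Fin n →₀ ℕ) → M) : (Fin n →₀ ℕ) → M :=
  fun α => ((α.degree : K) + 1)⁻¹ • F α

/-- `p_i F(p)` for a formal power series `F` in the `p`'s. -/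
def psMul (i : Fin n) (F : (Fin n →₀ ℕ) → M) : (Fin n →₀ ℕ) → M :=
  fun α => if α i = 0 then 0 else F (α - Finsupp.single i 1)

variable (K n M) in
/-- `φ ↦ (-1)^{deg φ + 1} φ`, where `deg p_i = 0` and `deg ζ_i = -1`. -/
def seriesParity : Module.End K (Series n M) where
  toFun φ s := match s with
    | (α, none) => -φ (α, none)
    | (α, some i) => φ (α, some i)
  map_add' φ ψ := by
    funext ⟨α, s⟩
    cases s <;> simp [add_comm]
  map_smul' c φ := by
    funext ⟨α, s⟩
    cases s <;> simp

variable (K n M) in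
/-- `h φ = ζ_i ∫_0^1 (∂φ^0/∂p_i)(t p) dt`. -/
def homotopy : Module.End K (Series n M) where
  toFun φ s := match s with
    | (_, none) => 0
    | (α, some i) => psIntegral K (psDeriv i (fun β => φ (β, none))) α
  map_add' φ ψ := by
    funext ⟨α, s⟩
    cases s <;> simp [psIntegral, psDeriv]
  map_smul' c φ := by
    funext ⟨α, s⟩
    cases s
    · simp
    · simp only [psIntegral, psDeriv, Pi.smul_apply, RingHom.id_apply]
      rw [smul_comm _ c, smul_comm _ c]

variable (K n M) in
/-- `π φ = φ^0(0) + φ^i(p) ζ_i - ζ_j ∂/∂p_j ∫_0^1 p_i φ^i(t p) dt`. -/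
def projection : Module.End K (Series n M) where
  toFun φ s := match s with
    | (α, none) => if α = 0 then φ (0, none) else 0
    | (α, some j) => φ (α, some j) -
        psDeriv j (∑ i, psMul i (psIntegral K (fun β => φ (β, some i)))) α
  map_add' φ ψ := by
    funext ⟨α, s⟩
    cases s with
    | none => by_cases h : α = 0 <;> simp [h]
    | some j =>
      have h : ∀ i : Fin n, psMul i (psIntegral K (fun β => (φ + ψ) (β, some i))) =
          psMul i (psIntegral K (fun β => φ (β, some i))) +
            psMul i (psIntegral K (fun β => ψ (β, some i))) := by
        intro i
        funext β
        by_cases hβ : β i = 0 <;> simp [psMul, psIntegral, hβ]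
      simp only [h, Finset.sum_add_distrib]
      simp only [psDeriv, Pi.add_apply, smul_add]
      abel
  map_smul' c φ := by
    funext ⟨α, s⟩
    cases s with
    | none => by_cases h : α = 0 <;> simp [h]
    | some j =>
      have h : ∀ i : Fin n, psMul i (psIntegral K (fun β => (c • φ) (β, some i))) =
          c • psMul i (psIntegral K (fun β => φ (β, some i))) := by
        intro i
        funext β
        by_cases hβ : β i = 0
        · simp [psMul, hβ]
        · simp only [psMul, psIntegral, hβ, Pi.smul_apply, if_false]
          rw [smul_comm]
      simp only [h, ← Finset.smul_sum]
      simp only [psDeriv, Pi.smul_apply, RingHom.id_apply, smul_sub]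
      rw [smul_comm _ c]

end Series

/-- The action of an operator on series in the `i`-th tensor factor `B` of `A_θ ⊗ B^{⊗ l}`. -/
def onSlot {l : ℕ} (i : Fin l) (T : Module.End K (Series n (WeylSpace K n))) :
    Module.End K (Symbol K n l) where
  toFun Φ s := T (fun t => Φ (Function.update s i t)) (s i)
  map_add' Φ Φ' := by
    funext s
    exact congrFun (T.map_add (fun t => Φ (Function.update s i t))
      (fun t => Φ' (Function.update s i t))) (s i)
  map_smul' c Φ := by
    funext s
    exact congrFun (T.map_smul c (fun t => Φ (Function.update s i t))) (s i)

variable (K n) in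
/-- The homotopy operator of `A_θ ⊗ B^{⊗ l}`:
`h_l (a ⊗ φ_1 ⊗ ⋯ ⊗ φ_l) = ∑_i ± a ⊗ φ_1 ⊗ ⋯ ⊗ φ_{i-1} ⊗ h φ_i ⊗ π φ_{i+1} ⊗ ⋯ ⊗ π φ_l`,
with the Koszul sign `±` produced by moving `h` past `φ_1, …, φ_{i-1}`, the degree of `φ_j` being
counted as `deg φ_j + 1`. -/
def homotopyTensor (l : ℕ) : Module.End K (Symbol K n l) :=
  ∑ i : Fin l, (List.ofFn fun j : Fin l =>
    onSlot j (if j < i then seriesParity K n (WeylSpace K n)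
      else if j = i then homotopy K n (WeylSpace K n)
      else projection K n (WeylSpace K n))).prod

/-- The partial derivative `∂^α`. -/
def iterDeriv (α : Fin n →₀ ℕ) : Module.End K (MvPolynomial (Fin n) K) :=
  (List.ofFn fun i : Fin n =>
    ((MvPolynomial.pderiv i).toLinearMap : Module.End K (MvPolynomial (Fin n) K)) ^ α i).prod

/-- The operator `σ(p^α)` or `σ(p^α ζ_i)` : `A_θ → (A_θ)_0`, which takes `a` to `∂^α a_0` or
`∂^α a_i`. -/
def sigma : Slot n → WeylSpace K n → MvPolynomial (Fin n) K
  | (α, none), a => iterDeriv α a.1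
  | (α, some i), a => iterDeriv α (a.2 i)

/-- `g = Σ(Φ)`, i.e. the operator `g (a_0, …, a_{l-1})` has the symbol `Φ`.
For given polynomials `a_j` the sum has finitely many non-zero terms. -/
def IsOperatorOf {l : ℕ} (Φ : Symbol K n l) (g : (ℕ → WeylSpace K n) → WeylSpace K n) : Prop :=
  ∀ a : ℕ → WeylSpace K n,
    g a = ∑ᶠ s : Fin l → Slot n, (∏ k : Fin l, sigma (s k) (a k)) • Φ s

/-- `f = h^Σ_l g` for operators `f`, `g` of arity `l`, where `h^Σ_l = Σ h_l Σ⁻¹`. -/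
def IsHomotopyImage (l : ℕ) (g f : (ℕ → WeylSpace K n) → WeylSpace K n) : Prop :=
  ∃ Φ : Symbol K n l, IsOperatorOf Φ g ∧ IsOperatorOf (homotopyTensor K n l Φ) f

/-- The recurrence relations for the component maps, with `f'_l` and `f''_l` the components of `f_l`
with values in degrees one and zero:
`f''_l = h^Σ_l Θ''_l` for `l ≥ 2` and `f'_l = h^Σ_l Θ'_l` for `l ≥ 1`, with the initial value
`f''_1 = id` on `(A_θ)_0`. Here `Θ''_l = -Ψ''_l` and `Θ'_l = d f''_l - Ψ'_l`, with `Ψ'_l` and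
`Ψ''_l` the components of `Ψ_l` with values in degrees one and zero. -/
structure SatisfiesRecurrence (θ θ' : Matrix (Fin n) (Fin n) K)
    (f : Cochain K (WeylSpace K n) (WeylSpace K n)) : Prop where
  zero : f 0 = 0
  initial : ∀ a : ℕ → WeylSpace K n, part0 (ev f 1 a) = part0 (a 0)
  degree_zero : ∀ l, 2 ≤ l →
    IsHomotopyImage l (fun a => -part0 (Psi θ θ' f l a)) (fun a => part0 (ev f l a))
  degree_one : ∀ l, 1 ≤ l →
    IsHomotopyImage l (fun a => diff (part0 (ev f l a)) - part1 (Psi θ θ' f l a))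
      (fun a => part1 (ev f l a))

/-! ## Seiberg-Witten maps -/

/-- `D` is the derivative at `t = 0` of the polynomial curve `t ↦ Q (x + t v)`. -/
def HasDirDeriv {E F : Type*} [AddCommGroup E] [Module K E] [AddCommGroup F] [Module K F]
    (Q : E → F) (x v : E) (D : F) : Prop :=
  ∃ (N : ℕ) (c : ℕ → F), ∀ t : K,
    Q (x + t • v) = Q x + t • D + ∑ k ∈ Finset.range N, t ^ (k + 2) • c k

/-- A pair of formal series
`Â(𝒜) = ∑_l Â_l(𝒜)`, `λ̂(λ, 𝒜) = ∑_l λ̂_l(λ, 𝒜)` in a gauge potential `𝒜 = (𝒜_i)_i`, with `Â_l`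
homogeneous of degree `l` in `𝒜`, and `λ̂_l` linear in `λ` and homogeneous of degree `l - 1` in `𝒜`,
satisfies the Seiberg-Witten equations for the Weyl-Moyal product `⋆_θ`:
`δ_λ [Â(𝒜)] = ∂ λ̂ + [Â, λ̂]_⋆` and
`δ_{λ₂} λ̂₁ - δ_{λ₁} λ̂₂ = [λ̂₁, λ̂₂]_⋆ - λ̂([λ₁, λ₂], 𝒜)`, where `δ_λ 𝒜_i = ∂_i λ`, `λ̂ᵢ` is
`λ̂(λᵢ, 𝒜)`, and `[λ₁, λ₂]` is the commutator of the (Abelian) gauge algebra of `𝒜`. -/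
structure SatisfiesSeibergWitten (θ : Matrix (Fin n) (Fin n) K)
    (Ahat : ℕ → (Fin n → MvPolynomial (Fin n) K) → (Fin n → MvPolynomial (Fin n) K))
    (lhat : ℕ → MvPolynomial (Fin n) K → (Fin n → MvPolynomial (Fin n) K) →
      MvPolynomial (Fin n) K) : Prop where
  Ahat_zero : ∀ 𝒜, Ahat 0 𝒜 = 0
  lhat_zero : ∀ lam 𝒜, lhat 0 lam 𝒜 = 0
  Ahat_homogeneous : ∀ l (t : K) 𝒜, Ahat l (t • 𝒜) = t ^ l • Ahat l 𝒜
  lhat_homogeneous : ∀ l lam (t : K) 𝒜, lhat (l + 1) lam (t • 𝒜) = t ^ l • lhat (l + 1) lam 𝒜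
  lhat_linear : ∀ l 𝒜, IsLinearMap K (fun lam => lhat l lam 𝒜)
  gauge : ∀ l lam 𝒜, HasDirDeriv (K := K) (Ahat l) 𝒜 (grad lam) (fun i =>
    MvPolynomial.pderiv i (lhat l lam 𝒜) + ∑ r ∈ Finset.HasAntidiagonal.antidiagonal l,
      (moyal θ (Ahat r.1 𝒜 i) (lhat r.2 lam 𝒜) - moyal θ (lhat r.2 lam 𝒜) (Ahat r.1 𝒜 i)))
  consistency : ∀ l lam₁ lam₂ 𝒜, ∃ D₁ D₂ : MvPolynomial (Fin n) K,
    HasDirDeriv (K := K) (lhat (l + 1) lam₁) 𝒜 (grad lam₂) D₁ ∧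
    HasDirDeriv (K := K) (lhat (l + 1) lam₂) 𝒜 (grad lam₁) D₂ ∧
    D₁ - D₂ = ∑ r ∈ Finset.HasAntidiagonal.antidiagonal (l + 1),
        (moyal θ (lhat r.1 lam₁ 𝒜) (lhat r.2 lam₂ 𝒜)
          - moyal θ (lhat r.2 lam₂ 𝒜) (lhat r.1 lam₁ 𝒜))
      - lhat l (moyal 0 lam₁ lam₂ - moyal 0 lam₂ lam₁) 𝒜

/-- `Q = O(θ)`: for antisymmetric `θ`, `Q` is a polynomial in the entries of `θ` without constant
term. -/
def IsBigOTheta {F : Type*} [AddCommGroup F] [Module K F]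
    (Q : Matrix (Fin n) (Fin n) K → F) : Prop :=
  ∃ (S : Finset ((Fin n × Fin n) →₀ ℕ)) (c : ((Fin n × Fin n) →₀ ℕ) → F), 0 ∉ S ∧
    ∀ θ : Matrix (Fin n) (Fin n) K, θ.transpose = -θ →
      Q θ = ∑ k ∈ S, (k.prod fun ij e => θ ij.1 ij.2 ^ e) • c k

/-- A Seiberg-Witten map: solutions `Â`, `λ̂` of the Seiberg-Witten equations for all antisymmetric
`θ` with `Â = 𝒜 + O(θ)` and `λ̂ = λ + O(θ)`. -/
structure IsSeibergWittenMap
    (Ahat : Matrix (Fin n) (Fin n) K → ℕ →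
      (Fin n → MvPolynomial (Fin n) K) → (Fin n → MvPolynomial (Fin n) K))
    (lhat : Matrix (Fin n) (Fin n) K → ℕ →
      MvPolynomial (Fin n) K → (Fin n → MvPolynomial (Fin n) K) → MvPolynomial (Fin n) K) :
    Prop where
  equations : ∀ θ : Matrix (Fin n) (Fin n) K, θ.transpose = -θ →
    SatisfiesSeibergWitten θ (Ahat θ) (lhat θ)
  Ahat_initial : ∀ l 𝒜, IsBigOTheta (fun θ => Ahat θ l 𝒜 - if l = 1 then 𝒜 else 0)
  lhat_initial : ∀ l lam 𝒜, IsBigOTheta (fun θ => lhat θ l lam 𝒜 - if l = 1 then lam else 0)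

/-- The term `f'_l (𝒜, …, 𝒜)` of the value of `f'` on the chain `∑_l 𝒜^{⊗ l}`,
`𝒜 = 𝒜_i ξ^i`. -/
def potentialOf (f : Cochain K (WeylSpace K n) (WeylSpace K n)) (l : ℕ)
    (𝒜 : Fin n → MvPolynomial (Fin n) K) : Fin n → MvPolynomial (Fin n) K :=
  (f l (fun _ => (0, 𝒜))).2

/-- The term `∑_s f''_l (𝒜, …, 𝒜, λ, 𝒜, …, 𝒜)` (with `λ` in position `s`) of the value of `f''`
on the chain `∑_{s,u} 𝒜^{⊗ s} ⊗ λ ⊗ 𝒜^{⊗ u}`. -/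
def parameterOf (f : Cochain K (WeylSpace K n) (WeylSpace K n)) (l : ℕ)
    (lam : MvPolynomial (Fin n) K) (𝒜 : Fin n → MvPolynomial (Fin n) K) : MvPolynomial (Fin n) K :=
  ∑ s : Fin l, (f l (Function.update (fun _ => (0, 𝒜)) s (lam, 0))).1

end WeylMoyal

end SeibergWitten

end

open scoped TensorProduct

noncomputable section

namespace SeibergWitten

/-! ### The Moyal product: Leibniz rule, multiplication by coordinates, associativity. -/

section Moyal

variable {K : Type*} [Field K] {n : ℕ}

/-! A sequence of multilinear maps is handled as a single function on words, whose restriction to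
words of length `l` is `f_l`. On such functions act `delta` and `mulCoder`, precomposition with the
coderivations of `m_1` and `m_2`, with sum `bar`; deconcatenation of words gives the product `cup`.
The morphism equation says that `defect f` vanishes, and in arity `l` this is `δ f_l - d f_l + Ψ_l =
0`, where `Ψ_l` involves lower arities only. Split by the degree of the values it becomes `δ f''_l =
-Ψ''_l` and `δ f'_l = d f''_l - Ψ'_l`. So a morphism is obtained by inverting `δ` arity by arity,
and the recurrence does exactly this with a homotopy.

The sources are closed: `bar² = 0`, which rests on associativity of the Moyal product, yields a
Bianchi identity (`bar_defect`). If the defect vanishes in lower arities, it gives `δ Ψ_l = -d Ψ_l`,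
and both right-hand sides are killed by `δ`.

The homotopy inverts `δ` on these sources: integration along rays gives `h d + d h = 1 - π` on the
algebra, and the tensor trick gives `δ h + h δ = 1 - π ⊗ ⋯ ⊗ π` on cochains (`delta_htpy`). The
element `π a` is a one-form plus a constant. A normal cochain does not see constants, and on
one-forms alone the sources vanish for degree reasons, so the last term drops out. Normality is
preserved by the recurrence (`psi_eq_zero_of_unit`, `UnitFree.opHtpy`).

The homotopy of the recurrence acts on symbols. By Taylor's formula the operator with symbol `G` is
`G`, acting in the variable `y`, applied to the arguments `a (y + x)`; this is `shift 1`, with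
inverse `shift (-1)`. When `p^α` is paired with `x^α / α!`, the operators `h` and `π` on `B` are
dual to the Poincaré homotopy and its projection, hence `h^Σ` is the conjugate `opHtpy` of `htpy` by
a translation. Translations commute with `d`, so `opHtpy` inverts `δ` as well (`delta_opHtpy`).
Uniqueness for the recurrence follows from uniqueness of symbols.

Since `f_1 = id`, the map is trivially a quasi-isomorphism, and the coalgebra map is inverted by
recursion on word length; the inverse is a morphism because coalgebra maps of morphisms commute with
`bar` (`bar_comp`).

The Seiberg–Witten equations are the morphism equation on words `𝒜 ⋯ 𝒜` with one or two gauge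
parameters inserted at all positions. One-forms are closed and square to zero, and the `m_2`-terms
of the commutative source cancel or are symmetric. Each value is polynomial in `θ` since all sums
are finite, and for `θ = 0` the recurrence returns the identity, which gives the initial condition.
-/

theorem exists_bidiff_pow_eq_zero
    (u : MvPolynomial (Fin n) K ⊗[K] MvPolynomial (Fin n) K) :
    ∃ N, ∀ (θ : Matrix (Fin n) (Fin n) K) (k : ℕ), N ≤ k → (bidiff θ ^ k) u = 0 := by
  induction u using TensorProduct.induction_on with
  | zero => exact ⟨0, by simp⟩
  | tmul f g =>
    induction f using MvPolynomial.induction_on' with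
    | monomial α c =>
      -- Each power of `bidiff θ` differentiates the left factor once, so the bound is uniform in
      -- `θ`; `moyalMap_mem_polyFamily` relies on this uniformity.
      exact ⟨α.degree + 1, fun θ k hk => bidiff_pow_monomial θ k α c g (by omega)⟩
    | add p q hp hq =>
      obtain ⟨N, hN⟩ := hp
      obtain ⟨M, hM⟩ := hq
      exact ⟨max N M, fun θ k hk => by
        rw [TensorProduct.add_tmul, map_add, hN θ k (le_trans (le_max_left _ _) hk),
          hM θ k (le_trans (le_max_right _ _) hk), add_zero]⟩
  | add x y hx hy =>
    obtain ⟨N, hN⟩ := hx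
    obtain ⟨M, hM⟩ := hy
    exact ⟨max N M, fun θ k hk => by
      rw [map_add, hN θ k (le_trans (le_max_left _ _) hk),
        hM θ k (le_trans (le_max_right _ _) hk), add_zero]⟩

theorem moyalMap_eq_sum (θ : Matrix (Fin n) (Fin n) K)
    (u : MvPolynomial (Fin n) K ⊗[K] MvPolynomial (Fin n) K) (N : ℕ)
    (hN : ∀ k, N ≤ k → (bidiff θ ^ k) u = 0) :
    moyalMap θ u = ∑ k ∈ Finset.range N, moyalTerm θ k u := by
  refine finsum_eq_sum_of_support_subset _ fun k hk => ?_
  simp only [Finset.coe_range, Set.mem_Iio]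
  by_contra hk'
  exact hk (by simp [moyalTerm, hN k (not_lt.mp hk')])

/-- An operator commuting with the bidifferential operator passes through the Moyal product. -/
theorem moyalMap_of_commute (θ : Matrix (Fin n) (Fin n) K)
    (Y : Module.End K (MvPolynomial (Fin n) K ⊗[K] MvPolynomial (Fin n) K))
    (D : Module.End K (MvPolynomial (Fin n) K)) (hY : Commute (bidiff θ) Y)
    (hD : ∀ u, LinearMap.mul' K (MvPolynomial (Fin n) K) (Y u) =
      D (LinearMap.mul' K (MvPolynomial (Fin n) K) u))
    (u : MvPolynomial (Fin n) K ⊗[K] MvPolynomial (Fin n) K) :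
    moyalMap θ (Y u) = D (moyalMap θ u) := by
  obtain ⟨N, hN⟩ := exists_bidiff_pow_eq_zero u
  have hc : ∀ k, (bidiff θ ^ k) (Y u) = Y ((bidiff θ ^ k) u) := fun k =>
    LinearMap.congr_fun (hY.pow_left k).eq u
  rw [moyalMap_eq_sum θ u N (hN θ), moyalMap_eq_sum θ (Y u) N
    (fun k hk => by rw [hc, hN θ k hk, map_zero]), map_sum]
  refine Finset.sum_congr rfl fun k _ => ?_
  simp only [moyalTerm, LinearMap.smul_apply, LinearMap.comp_apply, map_smul, hc, hD]

theorem pderiv_comm (i j : Fin n) (f : MvPolynomial (Fin n) K) :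
    MvPolynomial.pderiv i (MvPolynomial.pderiv j f) =
      MvPolynomial.pderiv j (MvPolynomial.pderiv i f) := by
  ext m
  simp only [MvPolynomial.coeff_pderiv, Finsupp.add_apply, Finsupp.single_apply]
  rw [add_right_comm]
  by_cases h : i = j
  · subst h; rfl
  · simp only [if_neg h, if_neg (Ne.symm h)]
    push_cast
    ring

/-- The derivation of a tensor product of polynomial rings given by `∂_i`. -/
def pderivTensor (i : Fin n) :
    Module.End K (MvPolynomial (Fin n) K ⊗[K] MvPolynomial (Fin n) K) :=
  TensorProduct.map (MvPolynomial.pderiv i).toLinearMap LinearMap.id +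
    TensorProduct.map LinearMap.id (MvPolynomial.pderiv i).toLinearMap

theorem bidiff_tmul (θ : Matrix (Fin n) (Fin n) K) (f g : MvPolynomial (Fin n) K) :
    bidiff θ (f ⊗ₜ[K] g) = ∑ i, ∑ j, ((1 / 2 : K) * θ i j) •
      (MvPolynomial.pderiv i f ⊗ₜ[K] MvPolynomial.pderiv j g) := by
  simp only [bidiff, LinearMap.sum_apply, LinearMap.smul_apply, TensorProduct.map_tmul,
    Derivation.coeFn_coe]

theorem commute_tensorMap {A B C D : Module.End K (MvPolynomial (Fin n) K)} (h : Commute A C)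
    (h' : Commute B D) : Commute (TensorProduct.map A B) (TensorProduct.map C D) := by
  rw [Commute, SemiconjBy, ← TensorProduct.map_mul, ← TensorProduct.map_mul, h.eq, h'.eq]

theorem commute_pderiv (i j : Fin n) :
    Commute (MvPolynomial.pderiv (R := K) i).toLinearMap (MvPolynomial.pderiv j).toLinearMap :=
  LinearMap.ext fun f => pderiv_comm i j f

theorem commute_bidiff_pderivTensor (θ : Matrix (Fin n) (Fin n) K) (i : Fin n) :
    Commute (bidiff θ) (pderivTensor i) :=
  Commute.sum_left _ _ _ fun a _ => Commute.sum_left _ _ _ fun b _ => Commute.smul_left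
    (Commute.add_right (commute_tensorMap (commute_pderiv a i) (Commute.one_right _))
      (commute_tensorMap (Commute.one_right _) (commute_pderiv b i))) _

theorem pderiv_moyal (θ : Matrix (Fin n) (Fin n) K) (i : Fin n) (f g : MvPolynomial (Fin n) K) :
    MvPolynomial.pderiv i (moyal θ f g) =
      moyal θ (MvPolynomial.pderiv i f) g + moyal θ f (MvPolynomial.pderiv i g) := by
  have h := moyalMap_of_commute θ (pderivTensor i) (MvPolynomial.pderiv i).toLinearMap
    (commute_bidiff_pderivTensor θ i) (fun u => by
      induction u using TensorProduct.induction_on with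
      | zero => simp
      | tmul f g => simp [pderivTensor]; ring
      | add x y hx hy => rw [map_add, map_add, map_add, map_add, hx, hy]) (f ⊗ₜ[K] g)
  simp only [pderivTensor, LinearMap.add_apply, TensorProduct.map_tmul, LinearMap.id_apply,
    Derivation.coeFn_coe, map_add] at h
  exact h.symm

/-- `½ θ^{ij} ⊗ ∂_j`, the commutator of the bidifferential operator with `x^i ⊗ 1`. -/
def halfContract (θ : Matrix (Fin n) (Fin n) K) (i : Fin n) :
    Module.End K (MvPolynomial (Fin n) K ⊗[K] MvPolynomial (Fin n) K) :=
  ∑ j, ((1 / 2 : K) * θ i j) • TensorProduct.map LinearMap.id (MvPolynomial.pderiv j).toLinearMap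

/-- Multiplication by `x^i ⊗ 1`. -/
def mulXLeft (i : Fin n) :
    Module.End K (MvPolynomial (Fin n) K ⊗[K] MvPolynomial (Fin n) K) :=
  TensorProduct.map (LinearMap.mulLeft K (MvPolynomial.X i)) LinearMap.id

theorem commute_bidiff_halfContract (θ : Matrix (Fin n) (Fin n) K) (i : Fin n) :
    Commute (bidiff θ) (halfContract θ i) :=
  Commute.sum_left _ _ _ fun _ _ => Commute.sum_left _ _ _ fun b _ => Commute.smul_left
    (Commute.sum_right _ _ _ fun j _ => Commute.smul_right
      (commute_tensorMap (Commute.one_right _) (commute_pderiv b j)) _) _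

/-- Leibniz rule in the left tensor factor: only `∂_i` acts on the extra factor `x^i`, and it leaves
`½ θ^{ij} 1 ⊗ ∂_j`. -/
theorem bidiff_mul_mulXLeft (θ : Matrix (Fin n) (Fin n) K) (i : Fin n) :
    bidiff θ * mulXLeft i = mulXLeft i * bidiff θ + halfContract θ i := by
  refine TensorProduct.ext' fun f g => ?_
  simp only [Module.End.mul_apply, LinearMap.add_apply, halfContract, LinearMap.sum_apply,
    LinearMap.smul_apply, mulXLeft, LinearMap.mulLeft_apply,
    TensorProduct.map_tmul,
    LinearMap.id_apply, Derivation.coeFn_coe, bidiff_tmul, map_sum, map_smul, Derivation.leibniz,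
    MvPolynomial.pderiv_X, smul_eq_mul, TensorProduct.add_tmul, smul_add, Finset.sum_add_distrib]
  congr 1
  rw [Finset.sum_eq_single i]
  · simp
  · intro a _ ha
    simp [Ne.symm ha]
  · simp

/-- The commutator `halfContract θ i` itself commutes with `bidiff θ`, so the commutator with a
power consists of `k + 1` equal terms. -/
theorem bidiff_pow_mul_mulXLeft (θ : Matrix (Fin n) (Fin n) K) (i : Fin n) (k : ℕ) :
    bidiff θ ^ (k + 1) * mulXLeft i =
      mulXLeft i * bidiff θ ^ (k + 1) + ((k : K) + 1) • (bidiff θ ^ k * halfContract θ i) := by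
  induction k with
  | zero => simp [bidiff_mul_mulXLeft]
  | succ k ih =>
    have h := ((commute_bidiff_halfContract θ i).pow_left (k + 1)).eq
    rw [pow_succ' _ (k + 1), mul_assoc, ih, mul_add, ← mul_assoc, bidiff_mul_mulXLeft, add_mul,
      mul_assoc (mulXLeft i), mul_smul_comm, ← mul_assoc _ _ (halfContract θ i), ← pow_succ' _ k,
      ← h]
    push_cast
    module

/-- The factor `k + 1` from `bidiff_pow_mul_mulXLeft` turns `1/(k+1)!` into `1/k!`, so the
commutator terms, shifted by one index, sum to a Moyal product again. -/
theorem moyalMap_mulXLeft [CharZero K] (θ : Matrix (Fin n) (Fin n) K) (i : Fin n)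
    (u : MvPolynomial (Fin n) K ⊗[K] MvPolynomial (Fin n) K) :
    moyalMap θ (mulXLeft i u) =
      MvPolynomial.X i * moyalMap θ u + moyalMap θ (halfContract θ i u) := by
  obtain ⟨N, hN⟩ := exists_bidiff_pow_eq_zero u
  have hm : ∀ v, LinearMap.mul' K (MvPolynomial (Fin n) K) (mulXLeft i v) =
      MvPolynomial.X i * LinearMap.mul' K (MvPolynomial (Fin n) K) v := fun v => by
    induction v using TensorProduct.induction_on with
    | zero => simp
    | tmul f g => simp [mulXLeft, mul_assoc]
    | add x y hx hy => rw [map_add, map_add, map_add, hx, hy, mul_add]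
  have hY : ∀ k, (bidiff θ ^ k) (halfContract θ i u) = halfContract θ i ((bidiff θ ^ k) u) :=
    fun k => LinearMap.congr_fun ((commute_bidiff_halfContract θ i).pow_left k).eq u
  have hX : ∀ k : ℕ, (bidiff θ ^ (k + 1)) (mulXLeft i u) = mulXLeft i ((bidiff θ ^ (k + 1)) u) +
      ((k : K) + 1) • (bidiff θ ^ k) (halfContract θ i u) :=
    fun k => LinearMap.congr_fun (bidiff_pow_mul_mulXLeft θ i k) u
  rw [moyalMap_eq_sum θ u (N + 1) (fun k hk => hN θ k (by omega)),
    moyalMap_eq_sum θ (halfContract θ i u) N (fun k hk => by rw [hY, hN θ k hk, map_zero]),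
    moyalMap_eq_sum θ (mulXLeft i u) (N + 1) (fun k hk => by
      obtain ⟨k, rfl⟩ : ∃ m, k = m + 1 := ⟨k - 1, by omega⟩
      rw [hX, hY, hN θ k (by omega), hN θ (k + 1) (by omega)]; simp),
    Finset.mul_sum, Finset.sum_range_succ', Finset.sum_range_succ', add_right_comm,
    ← Finset.sum_add_distrib]
  congr 1
  · refine Finset.sum_congr rfl fun k _ => ?_
    simp only [moyalTerm, LinearMap.smul_apply, LinearMap.comp_apply, hX, map_add, hm, map_smul,
      smul_add, mul_smul_comm]
    congr 1
    rw [smul_smul]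
    congr 1
    have h1 : ((k : K) + 1) ≠ 0 := by exact_mod_cast Nat.succ_ne_zero k
    rw [Nat.factorial_succ]
    push_cast
    field_simp
  · simp [moyalTerm, hm]

theorem moyal_add_left (θ : Matrix (Fin n) (Fin n) K) (f f' g : MvPolynomial (Fin n) K) :
    moyal θ (f + f') g = moyal θ f g + moyal θ f' g := by
  simp [moyal, TensorProduct.add_tmul]

theorem moyal_add_right (θ : Matrix (Fin n) (Fin n) K) (f g g' : MvPolynomial (Fin n) K) :
    moyal θ f (g + g') = moyal θ f g + moyal θ f g' := by
  simp [moyal, TensorProduct.tmul_add]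

theorem moyal_smul_left (θ : Matrix (Fin n) (Fin n) K) (c : K) (f g : MvPolynomial (Fin n) K) :
    moyal θ (c • f) g = c • moyal θ f g := by
  simp [moyal, ← TensorProduct.smul_tmul']

theorem moyal_smul_right (θ : Matrix (Fin n) (Fin n) K) (c : K) (f g : MvPolynomial (Fin n) K) :
    moyal θ f (c • g) = c • moyal θ f g := by
  simp [moyal]

theorem moyal_sum_left {ι : Type*} (θ : Matrix (Fin n) (Fin n) K) (s : Finset ι)
    (f : ι → MvPolynomial (Fin n) K) (g : MvPolynomial (Fin n) K) :
    moyal θ (∑ i ∈ s, f i) g = ∑ i ∈ s, moyal θ (f i) g := by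
  simp [moyal, TensorProduct.sum_tmul]

@[simp] theorem moyal_zero_left (θ : Matrix (Fin n) (Fin n) K) (g : MvPolynomial (Fin n) K) :
    moyal θ 0 g = 0 := by
  simp [moyal]

@[simp] theorem moyal_zero_right (θ : Matrix (Fin n) (Fin n) K) (f : MvPolynomial (Fin n) K) :
    moyal θ f 0 = 0 := by
  simp [moyal]

@[simp] theorem moyal_neg_left (θ : Matrix (Fin n) (Fin n) K) (f g : MvPolynomial (Fin n) K) :
    moyal θ (-f) g = -moyal θ f g := by
  simp [moyal, TensorProduct.neg_tmul]

@[simp] theorem moyal_neg_right (θ : Matrix (Fin n) (Fin n) K) (f g : MvPolynomial (Fin n) K) :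
    moyal θ f (-g) = -moyal θ f g := by
  simp [moyal, TensorProduct.tmul_neg]

@[simp] theorem moyal_one_left (θ : Matrix (Fin n) (Fin n) K) (g : MvPolynomial (Fin n) K) :
    moyal θ 1 g = g := by
  rw [moyal, moyalMap_eq_sum θ _ 1]
  · simp [moyalTerm]
  · intro k hk
    exact bidiff_pow_monomial θ k 0 1 g (by rw [map_zero]; omega)

@[simp] theorem moyal_one_right (θ : Matrix (Fin n) (Fin n) K) (f : MvPolynomial (Fin n) K) :
    moyal θ f 1 = f := by
  rw [moyal, moyalMap_eq_sum θ _ 1]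
  · simp [moyalTerm]
  · intro k hk
    obtain ⟨k, rfl⟩ : ∃ m, k = m + 1 := ⟨k - 1, by omega⟩
    rw [pow_succ, Module.End.mul_apply, bidiff_tmul]
    simp

theorem moyal_zero (f g : MvPolynomial (Fin n) K) : moyal 0 f g = f * g := by
  rw [moyal, moyalMap_eq_sum 0 _ 1]
  · simp [moyalTerm]
  · intro k hk
    obtain ⟨k, rfl⟩ : ∃ m, k = m + 1 := ⟨k - 1, by omega⟩
    rw [pow_succ, Module.End.mul_apply, bidiff_tmul]
    simp

variable [CharZero K]

theorem moyal_X_mul_left (θ : Matrix (Fin n) (Fin n) K) (i : Fin n)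
    (f g : MvPolynomial (Fin n) K) :
    moyal θ (MvPolynomial.X i * f) g = MvPolynomial.X i * moyal θ f g +
      ∑ j, ((1 / 2 : K) * θ i j) • moyal θ f (MvPolynomial.pderiv j g) := by
  have h := moyalMap_mulXLeft θ i (f ⊗ₜ[K] g)
  simpa [mulXLeft, halfContract, moyal] using h

theorem moyal_X (θ : Matrix (Fin n) (Fin n) K) (i : Fin n) (g : MvPolynomial (Fin n) K) :
    moyal θ (MvPolynomial.X i) g = MvPolynomial.X i * g +
      ∑ j, ((1 / 2 : K) * θ i j) • MvPolynomial.pderiv j g := by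
  simpa using moyal_X_mul_left θ i 1 g

/-- Associativity when the first factor is a coordinate: both sides expand to first order in the
explicit `θ`, and the derivative of `f ⋆ g` on the right is distributed by `pderiv_moyal`. -/
theorem moyal_moyal_X (θ : Matrix (Fin n) (Fin n) K) (i : Fin n) (f g : MvPolynomial (Fin n) K) :
    moyal θ (moyal θ (MvPolynomial.X i) f) g = moyal θ (MvPolynomial.X i) (moyal θ f g) := by
  simp only [moyal_X, moyal_add_left, moyal_X_mul_left, moyal_sum_left, moyal_smul_left,
    pderiv_moyal, smul_add, Finset.sum_add_distrib]
  abel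

/-- The Moyal product is associative. -/
theorem moyal_assoc (θ : Matrix (Fin n) (Fin n) K) (f g h : MvPolynomial (Fin n) K) :
    moyal θ (moyal θ f g) h = moyal θ f (moyal θ g h) := by
  -- Induction on the degree of a monomial in the first place: `x^α = x^i ⋆ x^β - ½ θ^{ij} ∂_j x^β`,
  -- where `x^β` and its derivatives have smaller degree.
  suffices key : ∀ (N : ℕ) (α : Fin n →₀ ℕ) (c : K), α.degree = N → ∀ g h,
      moyal θ (moyal θ (MvPolynomial.monomial α c) g) h =
        moyal θ (MvPolynomial.monomial α c) (moyal θ g h) by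
    induction f using MvPolynomial.induction_on' with
    | monomial α c => exact key _ α c rfl g h
    | add p q hp hq => simp only [moyal_add_left, hp, hq]
  intro N
  induction N using Nat.strong_induction_on with
  | _ N ih =>
  intro α c hα g h
  by_cases hα0 : α = 0
  · subst hα0
    have : (MvPolynomial.monomial 0 c : MvPolynomial (Fin n) K) = c • 1 := by
      rw [MvPolynomial.smul_eq_C_mul, mul_one]; rfl
    simp [this, moyal_smul_left]
  · obtain ⟨i, hi⟩ : ∃ i, α i ≠ 0 := by
      by_contra! hcon
      exact hα0 (Finsupp.ext hcon)
    have hdeg : ∀ (α : Fin n →₀ ℕ) (i : Fin n), α i ≠ 0 →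
        Finsupp.single i 1 ≤ α ∧ (α - Finsupp.single i 1).degree < α.degree := fun α i hi => by
      have hle : Finsupp.single i 1 ≤ α := by
        rw [Finsupp.single_le_iff]; omega
      have := congrArg Finsupp.degree (tsub_add_cancel_of_le hle)
      rw [map_add, Finsupp.degree_single] at this
      exact ⟨hle, by omega⟩
    obtain ⟨hle, hlt⟩ := hdeg α i hi
    set β := α - Finsupp.single i 1 with hβ
    have h1 : (MvPolynomial.monomial α c : MvPolynomial (Fin n) K) =
        MvPolynomial.X i * MvPolynomial.monomial β c := by
      rw [MvPolynomial.X, MvPolynomial.monomial_mul, one_mul, add_comm, tsub_add_cancel_of_le hle]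
    have h2 : (MvPolynomial.monomial α c : MvPolynomial (Fin n) K) =
        moyal θ (MvPolynomial.X i) (MvPolynomial.monomial β c) +
          -∑ j, ((1 / 2 : K) * θ i j) •
            MvPolynomial.pderiv j (MvPolynomial.monomial β c) := by
      rw [moyal_X, h1, add_neg_cancel_right]
    have h3 : ∀ j g h, moyal θ (moyal θ (MvPolynomial.pderiv j (MvPolynomial.monomial β c)) g) h =
        moyal θ (MvPolynomial.pderiv j (MvPolynomial.monomial β c)) (moyal θ g h) := by
      intro j g h
      rw [MvPolynomial.pderiv_monomial]
      by_cases hj : β j = 0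
      · simp [hj]
      · exact ih _ (by have := (hdeg β j hj).2; omega) _ _ rfl g h
    rw [h2]
    simp only [moyal_add_left, moyal_neg_left, moyal_sum_left, moyal_smul_left, h3]
    rw [moyal_moyal_X, moyal_moyal_X, ih _ (by omega) β c rfl, ← moyal_moyal_X]

end Moyal

/-! ### Multilinear functions on words and deconcatenation products. -/

section Lists

set_option linter.unusedSectionVars false

variable {K : Type*} [Field K] {V W X : Type*} [AddCommGroup V] [Module K V]
  [AddCommGroup W] [Module K W] [AddCommGroup X] [Module K X]

variable (K) in
/-- A function on words which is multilinear in the letters, i.e. a sequence of multilinear maps. -/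
def Multi (F : List V → X) : Prop :=
  ∀ L₁ L₂ : List V, IsLinearMap K fun x => F (L₁ ++ x :: L₂)

/-- `F` with its first argument fixed to `x`. -/
def tailFun (x : V) (F : List V → X) : List V → X := fun L => F (x :: L)

@[simp] theorem tailFun_apply (x : V) (F : List V → X) (L : List V) :
    tailFun x F L = F (x :: L) := rfl

theorem Multi.tailFun {F : List V → X} (hF : Multi K F) (x : V) : Multi K (tailFun x F) :=
  fun L₁ L₂ => hF (x :: L₁) L₂

theorem Multi.cons {F : List V → X} (hF : Multi K F) (L : List V) :
    IsLinearMap K fun x => F (x :: L) := hF [] L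

theorem Multi.tailFun_add {F : List V → X} (hF : Multi K F) (x y : V) :
    SeibergWitten.tailFun (x + y) F = SeibergWitten.tailFun x F + SeibergWitten.tailFun y F :=
  funext fun L => (hF.cons L).map_add x y

theorem Multi.tailFun_smul {F : List V → X} (hF : Multi K F) (c : K) (x : V) :
    SeibergWitten.tailFun (c • x) F = c • SeibergWitten.tailFun x F :=
  funext fun L => (hF.cons L).map_smul c x

theorem Multi.tailFun_neg {F : List V → X} (hF : Multi K F) (x : V) :
    SeibergWitten.tailFun (-x) F = -SeibergWitten.tailFun x F :=
  funext fun L => (hF.cons L).map_neg x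

theorem Multi.tailFun_zero {F : List V → X} (hF : Multi K F) :
    SeibergWitten.tailFun 0 F = 0 :=
  funext fun L => (hF.cons L).map_zero

/-- `x ↦ F (x :: ·)` as a linear map. -/
def Multi.tailLin {F : List V → X} (hF : Multi K F) : V →ₗ[K] (List V → X) where
  toFun x := SeibergWitten.tailFun x F
  map_add' := hF.tailFun_add
  map_smul' := hF.tailFun_smul

theorem Multi.of_cons {F : List V → X} (h₁ : ∀ L, IsLinearMap K fun x => F (x :: L))
    (h₂ : ∀ x, Multi K (SeibergWitten.tailFun x F)) : Multi K F := by
  intro L₁ L₂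
  cases L₁ with
  | nil => exact h₁ L₂
  | cons a L₁ => exact h₂ a L₁ L₂

theorem isLinearMap_add {f g : V → X} (hf : IsLinearMap K f) (hg : IsLinearMap K g) :
    IsLinearMap K fun x => f x + g x :=
  (hf.mk' f + hg.mk' g).isLinear

theorem isLinearMap_sub {f g : V → X} (hf : IsLinearMap K f) (hg : IsLinearMap K g) :
    IsLinearMap K fun x => f x - g x :=
  (hf.mk' f - hg.mk' g).isLinear

theorem isLinearMap_neg {f : V → X} (hf : IsLinearMap K f) :
    IsLinearMap K fun x => -f x :=
  (-hf.mk' f).isLinear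

theorem isLinearMap_zero : IsLinearMap K fun _ : V => (0 : X) :=
  (0 : V →ₗ[K] X).isLinear

theorem isLinearMap_comp {f : W → X} {g : V → W} (hf : IsLinearMap K f) (hg : IsLinearMap K g) :
    IsLinearMap K fun x => f (g x) :=
  (hf.mk' f ∘ₗ hg.mk' g).isLinear

theorem Multi.cons_comp {F : List W → X} (hF : Multi K F) (T : V →ₗ[K] W) (L : List W) :
    IsLinearMap K fun x => F (T x :: L) := by
  have h := isLinearMap_comp (hF.cons L) T.isLinear
  exact h

theorem Multi.add {F G : List V → X} (hF : Multi K F) (hG : Multi K G) : Multi K (F + G) :=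
  fun L₁ L₂ => isLinearMap_add (hF L₁ L₂) (hG L₁ L₂)

theorem Multi.sub {F G : List V → X} (hF : Multi K F) (hG : Multi K G) : Multi K (F - G) :=
  fun L₁ L₂ => isLinearMap_sub (hF L₁ L₂) (hG L₁ L₂)

theorem Multi.neg {F : List V → X} (hF : Multi K F) : Multi K (-F) :=
  fun L₁ L₂ => isLinearMap_neg (hF L₁ L₂)

theorem Multi.zero : Multi K (0 : List V → X) := fun _ _ => isLinearMap_zero

theorem Multi.postcomp {F : List V → W} (hF : Multi K F) (T : W →ₗ[K] X) :
    Multi K fun L => T (F L) :=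
  fun L₁ L₂ => isLinearMap_comp T.isLinear (hF L₁ L₂)

theorem Multi.precomp {F : List W → X} (hF : Multi K F) (T : V →ₗ[K] W) :
    Multi K fun L => F (L.map T) := by
  intro L₁ L₂
  simp only [List.map_append, List.map_cons]
  have h := isLinearMap_comp (hF (L₁.map T) (L₂.map T)) T.isLinear
  exact h

/-- The function on words which is the identity on words of length one and zero elsewhere. -/
def singleFun : List V → V
  | [a] => a
  | _ => 0

theorem multi_singleFun : Multi K (singleFun : List V → V) := by
  intro L₁ L₂
  match L₁, L₂ with
  | [], [] => exact LinearMap.id.isLinear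
  | [], _ :: _ => exact isLinearMap_zero
  | [_], _ => exact isLinearMap_zero
  | _ :: _ :: _, _ => exact isLinearMap_zero

@[simp] theorem singleFun_nil : (singleFun [] : V) = 0 := rfl
@[simp] theorem singleFun_single (a : V) : singleFun [a] = a := rfl
@[simp] theorem singleFun_cons_cons (a b : V) (L : List V) : singleFun (a :: b :: L) = 0 := rfl

/-- `F` restricted to words of length less than `N`. -/
def truncFun (N : ℕ) (F : List V → X) : List V → X := fun L => if L.length < N then F L else 0

theorem Multi.truncFun {F : List V → X} (hF : Multi K F) (N : ℕ) : Multi K (truncFun N F) := by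
  intro L₁ L₂
  by_cases h : L₁.length + (L₂.length + 1) < N
  · simpa [SeibergWitten.truncFun, h] using hF L₁ L₂
  · simpa [SeibergWitten.truncFun, h] using isLinearMap_zero

/-- For functions built up by word length, multilinearity can be checked on truncations; this serves
`comp`, `solution` and `inverse`. -/
theorem multi_of_truncFun {F : List V → X} (h : ∀ N, Multi K (truncFun N F)) : Multi K F := by
  intro L₁ L₂
  have := h (L₁.length + (L₂.length + 1) + 1) L₁ L₂
  simpa [SeibergWitten.truncFun] using this

/-! ### Deconcatenation products -/

/-- `∑ Ξ (u L₁) L₂`, over all decompositions `L = L₁ ++ L₂`. -/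
def conv (Ξ : W → List V → X) : (List V → W) → List V → X
  | u, [] => Ξ (u []) []
  | u, a :: L => Ξ (u []) (a :: L) + conv Ξ (tailFun a u) L

@[simp] theorem conv_nil (Ξ : W → List V → X) (u : List V → W) : conv Ξ u [] = Ξ (u []) [] := rfl

theorem conv_cons (Ξ : W → List V → X) (u : List V → W) (a : V) (L : List V) :
    conv Ξ u (a :: L) = Ξ (u []) (a :: L) + conv Ξ (tailFun a u) L := rfl

theorem tailFun_conv (Ξ : W → List V → X) (u : List V → W) (a : V) :
    tailFun a (conv Ξ u) = tailFun a (Ξ (u [])) + conv Ξ (tailFun a u) := rfl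

theorem conv_add (Ξ : W →ₗ[K] (List V → X)) (u v : List V → W) :
    conv Ξ (u + v) = conv Ξ u + conv Ξ v := by
  funext L
  induction L generalizing u v with
  | nil => simp
  | cons a L ih =>
    have := ih (tailFun a u) (tailFun a v)
    simp only [Pi.add_apply] at this ⊢
    rw [conv_cons, conv_cons, conv_cons,
      show tailFun a (u + v) = tailFun a u + tailFun a v from rfl, this, Pi.add_apply, map_add,
      Pi.add_apply]
    abel

theorem conv_smul (Ξ : W →ₗ[K] (List V → X)) (c : K) (u : List V → W) :
    conv Ξ (c • u) = c • conv Ξ u := by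
  funext L
  induction L generalizing u with
  | nil => simp
  | cons a L ih =>
    have := ih (tailFun a u)
    simp only [Pi.smul_apply] at this ⊢
    rw [conv_cons, conv_cons,
      show tailFun a (c • u) = c • tailFun a u from rfl, this, Pi.smul_apply, map_smul,
      Pi.smul_apply, smul_add]

/-- `conv` as a linear map in its second argument. -/
def convLin (Ξ : W →ₗ[K] (List V → X)) : (List V → W) →ₗ[K] (List V → X) where
  toFun := conv Ξ
  map_add' := conv_add Ξ
  map_smul' := conv_smul Ξ

theorem conv_neg (Ξ : W →ₗ[K] (List V → X)) (u : List V → W) :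
    conv Ξ (-u) = -conv Ξ u := (convLin Ξ).map_neg u

theorem conv_congr {Ξ Ξ' : W → List V → X} {u u' : List V → W} {L : List V}
    (h : ∀ L₁ L₂, L₁ ++ L₂ = L → Ξ (u L₁) L₂ = Ξ' (u' L₁) L₂) : conv Ξ u L = conv Ξ' u' L := by
  induction L generalizing u u' with
  | nil => exact h [] [] rfl
  | cons a L ih =>
    rw [conv_cons, conv_cons, h [] (a :: L) rfl, ih]
    intro L₁ L₂ hL
    exact h (a :: L₁) L₂ (by rw [← hL]; rfl)

theorem conv_eq_zero {Ξ : W → List V → X} {u : List V → W} {L : List V}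
    (h : ∀ L₁ L₂, L₁ ++ L₂ = L → Ξ (u L₁) L₂ = 0) : conv Ξ u L = 0 := by
  induction L generalizing u with
  | nil => exact h [] [] rfl
  | cons a L ih =>
    rw [conv_cons, h [] (a :: L) rfl, ih, add_zero]
    intro L₁ L₂ hL
    exact h (a :: L₁) L₂ (by rw [← hL]; rfl)

theorem postcomp_conv {Y : Type*} [AddCommGroup Y] [Module K Y] (T : X →ₗ[K] Y)
    (Ξ : W → List V → X) (u : List V → W) (L : List V) :
    T (conv Ξ u L) = conv (fun w M => T (Ξ w M)) u L := by
  induction L generalizing u with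
  | nil => rfl
  | cons a L ih => rw [conv_cons, conv_cons, map_add, ih]

theorem conv_postcomp {U : Type*} [AddCommGroup U] (T : U → W) (Ξ : W → List V → X) (u : List V → U) (L : List V) :
    conv Ξ (fun M => T (u M)) L = conv (fun w => Ξ (T w)) u L := by
  induction L generalizing u with
  | nil => rfl
  | cons a L ih => rw [conv_cons, conv_cons, ← ih]; rfl

theorem conv_map {U : Type*} [AddCommGroup U] (T : U → V) (Ξ : W → List V → X) (u : List V → W) (L : List U) :
    conv Ξ u (L.map T) = conv (fun w M => Ξ w (M.map T)) (fun M => u (M.map T)) L := by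
  induction L generalizing u with
  | nil => rfl
  | cons a L ih => rw [List.map_cons, conv_cons, conv_cons, ih]; rfl

theorem Multi.conv {u : List V → W} (hu : Multi K u) {Ξ : W →ₗ[K] (List V → X)}
    (hΞ : ∀ w, Multi K (Ξ w)) : Multi K (conv Ξ u) := by
  intro L₁
  induction L₁ generalizing u with
  | nil =>
    intro L₂
    have h : IsLinearMap K fun x => SeibergWitten.conv Ξ (SeibergWitten.tailFun x u) L₂ :=
      ((LinearMap.proj L₂ ∘ₗ convLin Ξ) ∘ₗ hu.tailLin).isLinear
    exact isLinearMap_add (hΞ (u []) [] L₂) h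
  | cons a L₁ ih =>
    intro L₂
    exact isLinearMap_add (hΞ (u []) (a :: L₁) L₂) (ih (hu.tailFun a) L₂)

/-- Coassociativity of deconcatenation: both sides sum over decompositions into three words. Since
the second slot of `conv` may be any function of a value and a word, this one identity gives both
`cup_assoc` and `comp_comp`. -/
theorem conv_conv {U : Type*} [AddCommGroup U] (f : List V → U) (G : U → List V → W)
    (Ξ : W →ₗ[K] (List V → X)) (L : List V) :
    conv (fun w => conv Ξ (G w)) f L = conv Ξ (conv G f) L := by
  induction L generalizing f with
  | nil => rfl
  | cons a L ih =>
    rw [conv_cons, conv_cons, ih, conv_cons, tailFun_conv, conv_add]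
    simp [add_assoc]

end Lists

/-! ### Signs, Leibniz rule, associativity, and the scalings that encode the grading. -/

section DGA

set_option linter.unusedSectionVars false

variable {K : Type*} [Field K] {n : ℕ}

/-! ### The dg-algebra `A_θ` -/

theorem starMul_apply (θ : Matrix (Fin n) (Fin n) K) (a b : WeylSpace K n) :
    starMul θ a b =
      (moyal θ a.1 b.1, fun i => moyal θ a.1 (b.2 i) + moyal θ (a.2 i) b.1) := rfl

theorem barParity_apply (a : WeylSpace K n) : barParity a = (-a.1, a.2) := rfl

theorem diff_apply (a : WeylSpace K n) : diff a = (0, grad a.1) := rfl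

@[simp] theorem barParity_barParity (a : WeylSpace K n) : barParity (barParity a) = a := by
  simp [barParity_apply]

@[simp] theorem diff_diff (a : WeylSpace K n) : diff (diff a) = 0 := by
  simp [diff_apply]
  rfl

theorem barParity_diff (a : WeylSpace K n) : barParity (diff a) = diff a := by
  simp [diff_apply, barParity_apply]

theorem diff_barParity (a : WeylSpace K n) : diff (barParity a) = -diff a := by
  ext1
  · simp [diff_apply, barParity_apply]
  · funext i; simp [diff_apply, barParity_apply, grad]

/-- The sign in the Leibniz rule is negative because `barParity` carries `(-1)^{deg a - 1}` instead
of `(-1)^{deg a}`. -/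
theorem diff_starMul (θ : Matrix (Fin n) (Fin n) K) (a b : WeylSpace K n) :
    diff (starMul θ a b) = starMul θ (diff a) b - starMul θ (barParity a) (diff b) := by
  ext1
  · simp [diff_apply, barParity_apply, starMul_apply]
  · funext i; simp [diff_apply, barParity_apply, starMul_apply, grad, pderiv_moyal]

theorem barParity_starMul (θ : Matrix (Fin n) (Fin n) K) (a b : WeylSpace K n) :
    barParity (starMul θ a b) = -starMul θ (barParity a) (barParity b) := by
  ext1
  · simp [barParity_apply, starMul_apply]
  · funext i; simp [barParity_apply, starMul_apply]; ring

theorem starMul_assoc [CharZero K] (θ : Matrix (Fin n) (Fin n) K) (a b c : WeylSpace K n) :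
    starMul θ (starMul θ a b) c = starMul θ a (starMul θ b c) := by
  ext1
  · simp [starMul_apply, moyal_assoc]
  · funext i
    simp [starMul_apply, moyal_add_left, moyal_add_right, moyal_assoc]
    ring

@[simp] theorem starMul_unit_left (θ : Matrix (Fin n) (Fin n) K) (a : WeylSpace K n) :
    starMul θ unit a = a := by
  simp [starMul_apply, unit]

@[simp] theorem starMul_unit_right (θ : Matrix (Fin n) (Fin n) K) (a : WeylSpace K n) :
    starMul θ a unit = a := by
  simp [starMul_apply, unit]

@[simp] theorem diff_unit : diff (unit : WeylSpace K n) = 0 := by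
  ext1
  · rfl
  · funext i; simp [diff_apply, unit, grad]

theorem barParity_unit : barParity (unit : WeylSpace K n) = -unit := by
  simp [barParity_apply, unit]

/-- The operator `a ↦ t a_0 + a_i ξ^i`. -/
def scale (t : K) : WeylSpace K n →ₗ[K] WeylSpace K n :=
  (t • LinearMap.id).prodMap LinearMap.id

theorem scale_apply (t : K) (a : WeylSpace K n) : scale t a = (t • a.1, a.2) := rfl

theorem scale_neg_one (a : WeylSpace K n) : scale (-1 : K) a = barParity a := by
  simp [scale_apply, barParity_apply]

theorem scale_barParity (t : K) (a : WeylSpace K n) :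
    scale t (barParity a) = barParity (scale t a) := by
  simp [scale_apply, barParity_apply]

/-- On degree `k` the operator `scale t` is multiplication by `t^{1-k}`, so the exponent is minus
the bar degree. Operations of bar degree one, such as `d` and (in `starMul_scale`) the product,
therefore pick up one factor `t`. -/
theorem diff_scale (t : K) (a : WeylSpace K n) : diff (scale t a) = t • scale t (diff a) := by
  ext1
  · simp [scale_apply, diff_apply]
  · funext i; simp [scale_apply, diff_apply, grad]

theorem starMul_scale (t : K) (θ : Matrix (Fin n) (Fin n) K) (a b : WeylSpace K n) :
    starMul θ (scale t a) (scale t b) = t • scale t (starMul θ a b) := by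
  ext1
  · simp [scale_apply, starMul_apply, moyal_smul_left, moyal_smul_right]
  · funext i; simp [scale_apply, starMul_apply, moyal_smul_left, moyal_smul_right]

end DGA

/-! ### The differentials on cochains induced by `m_1` and `m_2`. -/

section Coderivations

set_option linter.unusedSectionVars false

variable {K : Type*} [Field K] {n : ℕ} {W X : Type*} [AddCommGroup W] [Module K W]
  [AddCommGroup X] [Module K X]

variable (K) in
/-- `F ↦ F (x :: ·)`. -/
def tailOp {V : Type*} (x : V) : (List V → X) →ₗ[K] (List V → X) := LinearMap.funLeft K X (List.cons x)

/-- `(δF)(L)`, where `(δF)(a_0, …) = ∑ ± F (a_0, …, d a_i, …)`. -/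
def deltaAt : List (WeylSpace K n) → (List (WeylSpace K n) → X) →ₗ[K] X
  | [] => 0
  | a :: L => LinearMap.proj (diff a :: L) + deltaAt L ∘ₗ tailOp K (barParity a)

/-- Precomposition with the coderivation defined by `m_1`. -/
def delta : (List (WeylSpace K n) → X) →ₗ[K] (List (WeylSpace K n) → X) := LinearMap.pi deltaAt

/-- `F ↦ (L ↦ F (x ⋆ a_0, a_1, …))`. -/
def contr (θ : Matrix (Fin n) (Fin n) K) (x : WeylSpace K n) :
    (List (WeylSpace K n) → X) →ₗ[K] (List (WeylSpace K n) → X) :=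
  LinearMap.pi fun L => match L with
    | [] => 0
    | y :: L => LinearMap.proj (starMul θ x y :: L)

/-- `(bF)(L)`, where `(bF)(a_0, …) = ∑ ± F (a_0, …, a_i ⋆ a_{i+1}, …)`. -/
def mulCoderAt (θ : Matrix (Fin n) (Fin n) K) :
    List (WeylSpace K n) → (List (WeylSpace K n) → X) →ₗ[K] X
  | [] => 0
  | a :: L => LinearMap.proj L ∘ₗ contr θ (barParity a) + mulCoderAt θ L ∘ₗ tailOp K (barParity a)

/-- Precomposition with the coderivation defined by `m_2`. -/
def mulCoder (θ : Matrix (Fin n) (Fin n) K) :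
    (List (WeylSpace K n) → X) →ₗ[K] (List (WeylSpace K n) → X) := LinearMap.pi (mulCoderAt θ)

/-- Precomposition with the coderivation defined by `m_1 + m_2`. -/
def bar (θ : Matrix (Fin n) (Fin n) K) :
    (List (WeylSpace K n) → X) →ₗ[K] (List (WeylSpace K n) → X) := delta + mulCoder θ

@[simp] theorem delta_nil (F : List (WeylSpace K n) → X) : delta F [] = 0 := rfl

theorem delta_cons (F : List (WeylSpace K n) → X) (a : WeylSpace K n) (L) :
    delta F (a :: L) = F (diff a :: L) + delta (tailFun (barParity a) F) L := rfl

@[simp] theorem contr_nil (θ : Matrix (Fin n) (Fin n) K) (x : WeylSpace K n)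
    (F : List (WeylSpace K n) → X) : contr θ x F [] = 0 := rfl

@[simp] theorem contr_cons (θ : Matrix (Fin n) (Fin n) K) (x y : WeylSpace K n)
    (F : List (WeylSpace K n) → X) (L) : contr θ x F (y :: L) = F (starMul θ x y :: L) := rfl

@[simp] theorem mulCoder_nil (θ : Matrix (Fin n) (Fin n) K) (F : List (WeylSpace K n) → X) :
    mulCoder θ F [] = 0 := rfl

theorem mulCoder_cons (θ : Matrix (Fin n) (Fin n) K) (F : List (WeylSpace K n) → X)
    (a : WeylSpace K n) (L) : mulCoder θ F (a :: L) =
      contr θ (barParity a) F L + mulCoder θ (tailFun (barParity a) F) L := rfl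

theorem bar_apply (θ : Matrix (Fin n) (Fin n) K) (F : List (WeylSpace K n) → X) (L) :
    bar θ F L = delta F L + mulCoder θ F L := rfl

@[simp] theorem bar_nil (θ : Matrix (Fin n) (Fin n) K) (F : List (WeylSpace K n) → X) :
    bar θ F [] = 0 := by simp [bar_apply]

theorem bar_cons (θ : Matrix (Fin n) (Fin n) K) (F : List (WeylSpace K n) → X)
    (a : WeylSpace K n) (L) : bar θ F (a :: L) =
      F (diff a :: L) + contr θ (barParity a) F L + bar θ (tailFun (barParity a) F) L := by
  rw [bar_apply, bar_apply, delta_cons, mulCoder_cons]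
  abel

theorem tailFun_bar (θ : Matrix (Fin n) (Fin n) K) (F : List (WeylSpace K n) → X)
    (a : WeylSpace K n) : tailFun a (bar θ F) =
      tailFun (diff a) F + contr θ (barParity a) F + bar θ (tailFun (barParity a) F) :=
  funext fun L => bar_cons θ F a L

theorem tailFun_contr (θ : Matrix (Fin n) (Fin n) K) (x y : WeylSpace K n)
    (F : List (WeylSpace K n) → X) : tailFun y (contr θ x F) = tailFun (starMul θ x y) F := rfl

theorem Multi.contr {F : List (WeylSpace K n) → X} (hF : Multi K F)
    (θ : Matrix (Fin n) (Fin n) K) (x : WeylSpace K n) : Multi K (contr θ x F) :=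
  Multi.of_cons (fun L => hF.cons_comp (starMul θ x) L)
    (fun y => hF.tailFun (starMul θ x y))

theorem Multi.contr_isLinear {F : List (WeylSpace K n) → X} (hF : Multi K F)
    (θ : Matrix (Fin n) (Fin n) K) (L) : IsLinearMap K fun x => SeibergWitten.contr θ x F L := by
  cases L with
  | nil => exact isLinearMap_zero
  | cons y L => exact hF.cons_comp ((starMul θ).flip y) L

theorem Multi.delta {F : List (WeylSpace K n) → X} (hF : Multi K F) :
    Multi K (delta F) := by
  intro L₁
  induction L₁ generalizing F with
  | nil =>
    intro L₂
    exact isLinearMap_add (hF.cons_comp diff L₂)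
      (deltaAt L₂ ∘ₗ hF.tailLin ∘ₗ barParity).isLinear
  | cons a L₁ ih =>
    intro L₂
    exact isLinearMap_add (hF (diff a :: L₁) L₂) (ih (hF.tailFun _) L₂)

theorem Multi.mulCoder {F : List (WeylSpace K n) → X} (hF : Multi K F)
    (θ : Matrix (Fin n) (Fin n) K) : Multi K (mulCoder θ F) := by
  intro L₁
  induction L₁ generalizing F with
  | nil =>
    intro L₂
    exact isLinearMap_add (isLinearMap_comp (hF.contr_isLinear θ L₂) barParity.isLinear)
      (mulCoderAt θ L₂ ∘ₗ hF.tailLin ∘ₗ barParity).isLinear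
  | cons a L₁ ih =>
    intro L₂
    exact isLinearMap_add (hF.contr θ (barParity a) L₁ L₂) (ih (hF.tailFun _) L₂)

theorem Multi.bar {F : List (WeylSpace K n) → X} (hF : Multi K F)
    (θ : Matrix (Fin n) (Fin n) K) : Multi K (bar θ F) :=
  hF.delta.add (hF.mulCoder θ)

/-- `delta` and `contr` look at words of the same length as their argument, whereas `mulCoder` looks
at words one letter shorter. This triangularity is what makes the recurrence solvable arity by
arity. -/
theorem delta_eq_zero {F : List (WeylSpace K n) → X} {L} (h : ∀ M, M.length = L.length → F M = 0) :
    delta F L = 0 := by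
  induction L generalizing F with
  | nil => rfl
  | cons a L ih =>
    rw [delta_cons, h _ (by simp), ih, add_zero]
    intro M hM
    exact h _ (by simp [hM])

theorem contr_eq_zero {θ : Matrix (Fin n) (Fin n) K} {F : List (WeylSpace K n) → X}
    {x : WeylSpace K n} {L} (h : ∀ M, M.length = L.length → F M = 0) :
    contr θ x F L = 0 := by
  cases L with
  | nil => rfl
  | cons y L => exact h _ (by simp)

theorem mulCoder_eq_zero {θ : Matrix (Fin n) (Fin n) K} {F : List (WeylSpace K n) → X} {L}
    (h : ∀ M, M.length + 1 = L.length → F M = 0) : mulCoder θ F L = 0 := by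
  induction L generalizing F with
  | nil => rfl
  | cons a L ih =>
    rw [mulCoder_cons, contr_eq_zero (fun M hM => h _ (by simp [hM])), ih, add_zero]
    intro M hM
    exact h _ (by simp [hM])

theorem postcomp_delta (T : W →ₗ[K] X) (F : List (WeylSpace K n) → W) (L) :
    T (delta F L) = delta (fun M => T (F M)) L := by
  induction L generalizing F with
  | nil => simp
  | cons a L ih => rw [delta_cons, delta_cons, map_add, ih]; rfl

theorem postcomp_contr (θ : Matrix (Fin n) (Fin n) K) (T : W →ₗ[K] X)
    (F : List (WeylSpace K n) → W) (x : WeylSpace K n) (L) :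
    T (contr θ x F L) = contr θ x (fun M => T (F M)) L := by
  cases L <;> simp

theorem postcomp_mulCoder (θ : Matrix (Fin n) (Fin n) K) (T : W →ₗ[K] X)
    (F : List (WeylSpace K n) → W) (L) :
    T (mulCoder θ F L) = mulCoder θ (fun M => T (F M)) L := by
  induction L generalizing F with
  | nil => simp
  | cons a L ih => rw [mulCoder_cons, mulCoder_cons, map_add, ih, postcomp_contr]; rfl

theorem postcomp_bar (θ : Matrix (Fin n) (Fin n) K) (T : W →ₗ[K] X)
    (F : List (WeylSpace K n) → W) (L) :
    T (bar θ F L) = bar θ (fun M => T (F M)) L := by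
  rw [bar_apply, map_add, postcomp_delta, postcomp_mulCoder, ← bar_apply]

/-- `F ∘ e_t` for the operators `e_t : a ↦ t a_0 + a_i ξ^i` acting on all letters. -/
def scaleArgs (t : K) : (List (WeylSpace K n) → X) →ₗ[K] (List (WeylSpace K n) → X) :=
  LinearMap.funLeft K X (List.map (scale t))

theorem scaleArgs_apply (t : K) (F : List (WeylSpace K n) → X) (L) :
    scaleArgs t F L = F (L.map (scale t)) := rfl

theorem tailFun_scaleArgs (t : K) (F : List (WeylSpace K n) → X) (a : WeylSpace K n) :
    tailFun a (scaleArgs t F) = scaleArgs t (tailFun (scale t a) F) := rfl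

theorem Multi.scaleArgs {F : List (WeylSpace K n) → X} (hF : Multi K F) (t : K) :
    Multi K (scaleArgs t F) := hF.precomp (scale t)

theorem scaleArgs_scaleArgs (t : K) (F : List (WeylSpace K n) → X) (s : K) :
    scaleArgs t (scaleArgs s F) = scaleArgs (s * t) F := by
  funext L
  simp only [scaleArgs_apply, List.map_map]
  congr 1
  refine List.map_congr_left fun a _ => ?_
  simp [scale_apply, smul_smul]

theorem scaleArgs_one (F : List (WeylSpace K n) → X) : scaleArgs (1 : K) F = F := by
  funext L
  have h : ⇑(scale (1 : K) : WeylSpace K n →ₗ[K] WeylSpace K n) = id := by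
    funext a; simp [scale_apply]
  simp [scaleArgs_apply, h]

theorem scaleArgs_delta {F : List (WeylSpace K n) → X} (hF : Multi K F) (t : K) :
    scaleArgs t (delta F) = t • delta (scaleArgs t F) := by
  funext L
  induction L generalizing F with
  | nil => simp [scaleArgs_apply]
  | cons a L ih =>
    have := ih (hF.tailFun (barParity (scale t a)))
    simp only [scaleArgs_apply, Pi.smul_apply, List.map_cons] at this ⊢
    rw [delta_cons, this, delta_cons, diff_scale, (hF.cons _).map_smul, smul_add, tailFun_scaleArgs,
      scale_barParity]
    rfl

theorem scaleArgs_mulCoder {F : List (WeylSpace K n) → X} (hF : Multi K F) (t : K)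
    (θ : Matrix (Fin n) (Fin n) K) :
    scaleArgs t (mulCoder θ F) = t • mulCoder θ (scaleArgs t F) := by
  funext L
  induction L generalizing F with
  | nil => simp [scaleArgs_apply]
  | cons a L ih =>
    have := ih (hF.tailFun (barParity (scale t a)))
    simp only [scaleArgs_apply, Pi.smul_apply, List.map_cons] at this ⊢
    rw [mulCoder_cons, this, mulCoder_cons, smul_add, tailFun_scaleArgs, scale_barParity]
    congr 1
    cases L with
    | nil => simp
    | cons b L =>
      simp only [List.map_cons, contr_cons, scaleArgs_apply]
      rw [← scale_barParity, starMul_scale, (hF.cons _).map_smul]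

theorem scaleArgs_bar {F : List (WeylSpace K n) → X} (hF : Multi K F) (t : K)
    (θ : Matrix (Fin n) (Fin n) K) : scaleArgs t (bar θ F) = t • bar θ (scaleArgs t F) := by
  rw [bar, LinearMap.add_apply, map_add, scaleArgs_delta hF, scaleArgs_mulCoder hF,
    LinearMap.add_apply, smul_add]

/-- The signed coderivations square to zero. -/
theorem bar_bar [CharZero K] {θ : Matrix (Fin n) (Fin n) K} {F : List (WeylSpace K n) → X}
    (hF : Multi K F) (L) : bar θ (bar θ F) L = 0 := by
  induction L generalizing F with
  | nil => simp
  | cons a L ih =>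
    rw [bar_cons, tailFun_bar, map_add, map_add, Pi.add_apply, Pi.add_apply,
      ih (hF.tailFun _), bar_cons, diff_diff, (hF.cons L).map_zero, barParity_barParity,
      barParity_diff, diff_barParity, hF.tailFun_neg, map_neg, Pi.neg_apply]
    -- What is left after `d² = 0` and the induction hypothesis are terms in which the first letter
    -- is multiplied with the next one; they cancel by the Leibniz rule and associativity.
    suffices h : contr θ (diff a) F L + contr θ (barParity a) (bar θ F) L +
        bar θ (contr θ a F) L = 0 by
      refine Eq.trans ?_ h
      abel
    cases L with
    | nil => simp
    | cons b L =>
      simp only [contr_cons, bar_cons, tailFun_contr]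
      rw [barParity_starMul, barParity_barParity, diff_starMul, barParity_barParity,
        diff_barParity, hF.tailFun_neg, map_neg (bar θ), Pi.neg_apply,
        show contr θ (barParity b) (contr θ a F) L = contr θ (starMul θ a (barParity b)) F L by
          cases L <;> simp [starMul_assoc],
        show ∀ x, contr θ (-x) F L = -contr θ x F L from (hF.contr_isLinear θ L).map_neg,
        map_neg, LinearMap.neg_apply, (hF.cons L).map_sub, (hF.cons L).map_neg]
      abel

/-- After a word has been cut in two, the letter produced by the coderivation lies in one of the
pieces, so `bar` is a signed derivation of deconcatenation products. The factor `scaleArgs (-1)` is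
the Koszul sign for passing over the first piece. -/
theorem bar_conv {θ : Matrix (Fin n) (Fin n) K} {u : List (WeylSpace K n) → W}
    {Ξ : W →ₗ[K] (List (WeylSpace K n) → X)} (L) :
    bar θ (conv Ξ u) L = conv Ξ (bar θ u) L + conv (bar θ ∘ₗ Ξ) (scaleArgs (-1 : K) u) L := by
  induction L generalizing u with
  | nil => simp [bar_nil]
  | cons a L ih =>
    have h1 : ∀ x, contr θ x (conv Ξ u) L = contr θ x (Ξ (u [])) L + conv Ξ (contr θ x u) L := by
      intro x
      cases L with
      | nil => simp
      | cons b L => simp [conv_cons, tailFun_contr]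
    rw [bar_cons, conv_cons, conv_cons, conv_cons, h1, tailFun_conv, map_add, Pi.add_apply, ih,
      tailFun_bar, conv_add, conv_add, bar_nil, map_zero, Pi.zero_apply, zero_add,
      tailFun_scaleArgs, scale_neg_one, LinearMap.comp_apply,
      show scaleArgs (-1 : K) u [] = u [] from rfl, bar_cons]
    simp only [Pi.add_apply]
    abel

end Coderivations

/-! ### Composition with morphisms of bar coalgebras. -/

section Comp

set_option linter.unusedSectionVars false

variable {K : Type*} [Field K] {V W X Y : Type*} [AddCommGroup V] [Module K V]
  [AddCommGroup W] [Module K W] [AddCommGroup X] [Module K X] [AddCommGroup Y] [Module K Y]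

/-- Induction on words in which the induction hypothesis is available for all suffixes. -/
theorem suffix_induction {P : List V → Prop} (nil : P [])
    (cons : ∀ a L, (∀ L₁ L₂, L₁ ++ L₂ = L → P L₂) → P (a :: L)) (L : List V) : P L := by
  suffices h : ∀ L L₁ L₂, L₁ ++ L₂ = L → P L₂ from h L [] L rfl
  intro L
  induction L with
  | nil =>
    intro L₁ L₂ h
    obtain ⟨-, rfl⟩ := List.append_eq_nil_iff.mp h
    exact nil
  | cons a L ih =>
    intro L₁ L₂ h
    cases L₁ with
    | nil => rw [show L₂ = a :: L from h]; exact cons a L ih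
    | cons b L₁ => exact ih L₁ L₂ (List.cons.inj h).2

/-- The sum of `φ (u (L₁), f (L₂), …, f (L_k))` over all decompositions `L = L₁ ++ ⋯ ++ L_k` with
non-empty `L₂, …, L_k`. -/
def compAux (f : List V → W) : (List V → W) → (List W → X) → List V → X
  | u, φ, [] => φ [u []]
  | u, φ, a :: L => compAux f (tailFun a f) (tailFun (u []) φ) L + compAux f (tailFun a u) φ L

/-- The sum of `φ (f (L₁), …, f (L_k))` over all decompositions of a word into non-empty words
`L₁, …, L_k`, i.e. the composition of `φ` with the morphism of coalgebras defined by `f`. -/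
def comp (f : List V → W) (φ : List W → X) : List V → X
  | [] => φ []
  | a :: L => compAux f (tailFun a f) φ L

@[simp] theorem comp_nil (f : List V → W) (φ : List W → X) : comp f φ [] = φ [] := rfl

theorem compAux_eq_conv (f : List V → W) (u : List V → W) (φ : List W → X) (L) :
    compAux f u φ L = conv (fun w => comp f (tailFun w φ)) u L := by
  induction L generalizing u φ with
  | nil => rfl
  | cons a L ih => rw [compAux, conv_cons, ih (tailFun a u) φ]; rfl

/-- Splitting off the block that contains the first letter; later inductions go through this form,
and `compAux` only serves to make the recursion structural. -/
theorem comp_cons (f : List V → W) (φ : List W → X) (a : V) (L) :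
    comp f φ (a :: L) = conv (fun w => comp f (tailFun w φ)) (tailFun a f) L :=
  compAux_eq_conv f (tailFun a f) φ L

theorem tailFun_comp (f : List V → W) (φ : List W → X) (a : V) :
    tailFun a (comp f φ) = conv (fun w => comp f (tailFun w φ)) (tailFun a f) :=
  funext fun L => comp_cons f φ a L

theorem conv_add_left {Ξ Ξ' : W → List V → X} (u : List V → W) (L) :
    conv (fun w => Ξ w + Ξ' w) u L = conv Ξ u L + conv Ξ' u L := by
  induction L generalizing u with
  | nil => rfl
  | cons a L ih => rw [conv_cons, conv_cons, conv_cons, ih, Pi.add_apply]; abel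

theorem conv_smul_left (c : K) {Ξ : W → List V → X} (u : List V → W) (L) :
    conv (fun w => c • Ξ w) u L = c • conv Ξ u L := by
  induction L generalizing u with
  | nil => rfl
  | cons a L ih => rw [conv_cons, conv_cons, ih, Pi.smul_apply, smul_add]

theorem comp_add (f : List V → W) (φ ψ : List W → X) : comp f (φ + ψ) = comp f φ + comp f ψ := by
  suffices h : ∀ (L : List V) (φ ψ : List W → X), comp f (φ + ψ) L = comp f φ L + comp f ψ L from
    funext fun L => h L φ ψ
  intro L
  induction L using suffix_induction with
  | nil => intro φ ψ; rfl
  | cons a L ih =>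
    intro φ ψ
    rw [comp_cons, comp_cons, comp_cons, ← conv_add_left]
    refine conv_congr fun L₁ L₂ h => ?_
    exact ih L₁ L₂ h _ _

theorem comp_smul (f : List V → W) (c : K) (φ : List W → X) : comp f (c • φ) = c • comp f φ := by
  suffices h : ∀ (L : List V) (φ : List W → X), comp f (c • φ) L = c • comp f φ L from
    funext fun L => h L φ
  intro L
  induction L using suffix_induction with
  | nil => intro φ; rfl
  | cons a L ih =>
    intro φ
    rw [comp_cons, comp_cons, ← conv_smul_left]
    refine conv_congr fun L₁ L₂ h => ?_
    exact ih L₁ L₂ h _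

variable (K) in
/-- `comp` as a linear map in its second argument. -/
def compLin (f : List V → W) : (List W → X) →ₗ[K] (List V → X) where
  toFun := comp f
  map_add' := comp_add f
  map_smul' := comp_smul f

/-- Only words of length at most `L.length` contribute to `comp f φ L`. -/
theorem comp_eq_zero {f : List V → W} {φ : List W → X} {L}
    (h : ∀ M : List W, M.length ≤ L.length → φ M = 0) : comp f φ L = 0 := by
  suffices key : ∀ (L : List V) (φ : List W → X), (∀ M : List W, M.length ≤ L.length → φ M = 0) → comp f φ L = 0 from key L φ h
  clear h
  intro L
  induction L using suffix_induction with
  | nil => intro φ h; exact h [] le_rfl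
  | cons a L ih =>
    intro φ h
    rw [comp_cons]
    refine conv_eq_zero fun L₁ L₂ h' => ?_
    refine ih L₁ L₂ h' _ fun M hM => h _ ?_
    have hlen := congrArg List.length h'
    simp only [List.length_append, List.length_cons] at hlen ⊢
    omega

theorem comp_zero (f : List V → W) : comp f (0 : List W → X) = 0 :=
  funext fun _ => comp_eq_zero fun _ _ => rfl

/-- `w ↦ comp f (φ (w :: ·))` as a linear map. -/
def compTail (f : List V → W) {φ : List W → X} (hφ : Multi K φ) : W →ₗ[K] (List V → X) :=
  compLin K f ∘ₗ hφ.tailLin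

theorem comp_cons' (f : List V → W) {φ : List W → X} (hφ : Multi K φ) (a : V) (L) :
    comp f φ (a :: L) = conv (compTail f hφ) (tailFun a f) L :=
  comp_cons f φ a L

/-- Restriction of functions to words of length less than `N`. -/
def truncLin (N : ℕ) : (List V → X) →ₗ[K] (List V → X) where
  toFun := truncFun N
  map_add' F G := by
    funext L
    by_cases h : L.length < N <;> simp [truncFun, h]
  map_smul' c F := by
    funext L
    by_cases h : L.length < N <;> simp [truncFun, h]

theorem Multi.comp {f : List V → W} (hf : Multi K f) {φ : List W → X} (hφ : Multi K φ) :
    Multi K (comp f φ) := by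
  refine multi_of_truncFun fun N => ?_
  induction N generalizing φ with
  | zero =>
    have : SeibergWitten.truncFun 0 (SeibergWitten.comp f φ) = 0 := by
      funext L; simp [SeibergWitten.truncFun]
    rw [this]
    exact Multi.zero
  | succ N ih =>
    refine Multi.of_cons (fun L => ?_) (fun a => ?_)
    · by_cases h : L.length < N
      · simp only [SeibergWitten.truncFun, List.length_cons, Nat.add_lt_add_iff_right, h, if_true,
          comp_cons' f hφ]
        exact ((LinearMap.proj L ∘ₗ convLin (compTail f hφ)) ∘ₗ hf.tailLin).isLinear
      · simp only [SeibergWitten.truncFun, List.length_cons, Nat.add_lt_add_iff_right, h, if_false]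
        exact isLinearMap_zero
    -- Once the first letter is fixed, only values of `comp f (tailFun w φ)` on words of length less
    -- than `N` are used, so the induction hypothesis for truncations is enough.
    · have h : SeibergWitten.tailFun a (SeibergWitten.truncFun (N + 1) (SeibergWitten.comp f φ)) =
          SeibergWitten.truncFun N (SeibergWitten.conv (truncLin N ∘ₗ compTail f hφ)
            (SeibergWitten.tailFun a f)) := by
        funext L
        by_cases h : L.length < N
        · simp only [tailFun_apply, SeibergWitten.truncFun, List.length_cons,
            Nat.add_lt_add_iff_right, h, if_true, comp_cons' f hφ]
          refine conv_congr fun L₁ L₂ hL => ?_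
          have hlen := congrArg List.length hL
          rw [List.length_append] at hlen
          have : L₂.length < N := by omega
          simp [truncLin, SeibergWitten.truncFun, this]
        · simp [SeibergWitten.truncFun, h]
      rw [h]
      exact ((hf.tailFun a).conv fun w => ih (hφ.tailFun w)).truncFun N

/-- Compatibility of a coalgebra morphism with the coproduct: to cut a word of blocks is to cut the
original word at a boundary between blocks. -/
theorem comp_conv (f : List V → W) (Ξ : Y →ₗ[K] (List W → X)) (u : List W → Y) (L) :
    comp f (conv Ξ u) L = conv (compLin K f ∘ₗ Ξ) (comp f u) L := by
  suffices h : ∀ (L : List V) (u : List W → Y), comp f (conv Ξ u) L = conv (compLin K f ∘ₗ Ξ) (comp f u) L from h L u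
  intro L
  induction L using suffix_induction with
  | nil => intro u; rfl
  | cons a L ih =>
    intro u
    rw [comp_cons, conv_cons, tailFun_comp, ← conv_conv]
    rw [show (compLin K f ∘ₗ Ξ) (comp f u []) (a :: L) =
      conv (fun w => comp f (tailFun w (Ξ (u [])))) (tailFun a f) L from comp_cons _ _ _ _,
      ← conv_add_left]
    refine conv_congr fun L₁ L₂ h => ?_
    rw [Pi.add_apply, ← ih L₁ L₂ h, tailFun_conv, comp_add, Pi.add_apply]

/-- Blocks of blocks are regrouped: the first block of the outer composition is expanded by
`comp_conv` and reassociated by `conv_conv`. -/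
theorem comp_comp (f : List V → W) (g : List W → X) {φ : List X → Y} (hφ : Multi K φ) :
    comp f (comp g φ) = comp (comp f g) φ := by
  suffices h : ∀ (L : List V) (φ : List X → Y), Multi K φ → comp f (comp g φ) L = comp (comp f g) φ L from
    funext fun L => h L φ hφ
  intro L
  induction L using suffix_induction with
  | nil => intro φ hφ; rfl
  | cons a L ih =>
    intro φ hφ
    rw [comp_cons f (comp g φ), comp_cons (comp f g) φ, tailFun_comp]
    have h : ∀ w, comp f (tailFun w (comp g φ)) =
        conv (compLin K f ∘ₗ compTail g hφ) (comp f (tailFun w g)) := fun w => by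
      rw [tailFun_comp]
      exact funext fun M => comp_conv f (compTail g hφ) (tailFun w g) M
    simp only [h]
    rw [conv_conv]
    refine conv_congr fun L₁ L₂ h => ?_
    exact ih L₁ L₂ h _ (hφ.tailFun _)

theorem comp_singleFun {f : List V → W} (hf : f [] = 0) : comp f singleFun = f := by
  funext L
  cases L with
  | nil => exact hf.symm
  | cons a L =>
    rw [comp_cons]
    suffices h : ∀ u : List V → W, conv (fun w => comp f (tailFun w singleFun)) u L = u L from h _
    intro u
    induction L generalizing u with
    | nil => rfl
    | cons b L ih =>
      rw [conv_cons, ih, comp_cons, conv_eq_zero, zero_add, tailFun_apply]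
      intro L₁ L₂ h
      have : ∀ M, comp f (tailFun (tailFun b f L₁) (tailFun (u []) (singleFun : List W → W))) M
          = comp f (0 : List W → W) M := fun _ => rfl
      rw [this, show comp f (0 : List W → W) = 0 from comp_zero f]
      rfl

theorem singleFun_comp {φ : List V → X} (hφ : Multi K φ) : comp singleFun φ = φ := by
  suffices h : ∀ (L : List V) (φ : List V → X), Multi K φ → comp singleFun φ L = φ L from
    funext fun L => h L φ hφ
  intro L
  induction L with
  | nil => intro φ _; rfl
  | cons a L ih =>
    intro φ hφ
    rw [comp_cons, ← tailFun_apply a φ, ← ih _ (hφ.tailFun a)]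
    cases L with
    | nil => rfl
    | cons b L =>
      rw [conv_cons, conv_eq_zero, add_zero]
      · rfl
      · intro L₁ L₂ _
        rw [show tailFun b (tailFun a singleFun) L₁ = 0 from rfl, hφ.tailFun_zero,
          comp_zero]
        rfl

/-- The words of maximal length in `comp f φ L` have only letters `f [a]`. -/
theorem comp_eq_self {f : List V → V} (hf : ∀ a, f [a] = a) {φ : List V → X} {L}
    (h : ∀ M : List V, M.length < L.length → φ M = 0) : comp f φ L = φ L := by
  induction L generalizing φ with
  | nil => rfl
  | cons a L ih =>
    rw [comp_cons]
    have h0 : comp f (tailFun a φ) L = φ (a :: L) := ih fun M hM => h _ (by simpa using hM)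
    cases L with
    | nil => simp [hf]
    | cons b L =>
      -- A first block with more than one letter leaves too few letters: the resulting words are
      -- shorter than the original one, and `φ` vanishes on them.
      rw [conv_cons, conv_eq_zero, add_zero, tailFun_apply, hf, h0]
      intro L₁ L₂ h'
      have hlen := congrArg List.length h'
      rw [List.length_append] at hlen
      refine comp_eq_zero fun M hM => h _ ?_
      simp only [List.length_cons]
      omega

theorem comp_map {U : Type*} [AddCommGroup U] [Module K U] (f : List V → W) (φ : List W → X)
    (T : U → V) (L : List U) : comp f φ (L.map T) = comp (fun M => f (M.map T)) φ L := by
  suffices h : ∀ (L : List U) (φ : List W → X), comp f φ (L.map T) = comp (fun M => f (M.map T)) φ L from h L φ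
  intro L
  induction L using suffix_induction with
  | nil => intro φ; rfl
  | cons a L ih =>
    intro φ
    rw [List.map_cons, comp_cons, comp_cons, conv_map]
    refine conv_congr fun L₁ L₂ h => ?_
    exact ih L₁ L₂ h _

theorem comp_postcomp {U : Type*} [AddCommGroup U] [Module K U] (f : List V → U) (φ : List W → X)
    (T : U → W) (L : List V) : comp (fun M => T (f M)) φ L = comp f (fun M => φ (M.map T)) L := by
  suffices h : ∀ (L : List V) (φ : List W → X), comp (fun M => T (f M)) φ L = comp f (fun M => φ (M.map T)) L from h L φ
  intro L
  induction L using suffix_induction with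
  | nil => intro φ; rfl
  | cons a L ih =>
    intro φ
    rw [comp_cons, comp_cons]
    have := conv_postcomp T (fun w => comp (fun M => T (f M)) (tailFun w φ)) (tailFun a f) L
    refine this.trans ?_
    refine conv_congr fun L₁ L₂ h => ?_
    exact ih L₁ L₂ h _

theorem postcomp_comp (f : List V → W) (φ : List W → X) (T : X →ₗ[K] Y) (L) :
    T (comp f φ L) = comp f (fun M => T (φ M)) L := by
  suffices h : ∀ (L : List V) (φ : List W → X), T (comp f φ L) = comp f (fun M => T (φ M)) L from h L φ
  intro L
  induction L using suffix_induction with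
  | nil => intro φ; rfl
  | cons a L ih =>
    intro φ
    rw [comp_cons, comp_cons, postcomp_conv]
    refine conv_congr fun L₁ L₂ h => ?_
    exact ih L₁ L₂ h _

end Comp

/-! ### Cup products, the defect of a morphism, and compatibility with `bar`. -/

section Relation

set_option linter.unusedSectionVars false

variable {K : Type*} [Field K] {n : ℕ} {X : Type*} [AddCommGroup X] [Module K X]

/-- `w ↦ (L ↦ w ⋆ G (L))`. -/
def starLin (θ : Matrix (Fin n) (Fin n) K) (G : List (WeylSpace K n) → WeylSpace K n) :
    WeylSpace K n →ₗ[K] (List (WeylSpace K n) → WeylSpace K n) :=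
  LinearMap.pi fun L => (starMul θ).flip (G L)

theorem starLin_apply (θ : Matrix (Fin n) (Fin n) K) (G : List (WeylSpace K n) → WeylSpace K n)
    (w : WeylSpace K n) (L) : starLin θ G w L = starMul θ w (G L) := rfl

/-- The sum of `F (L₁) ⋆ G (L₂)` over all decompositions `L = L₁ ++ L₂`. -/
def cup (θ : Matrix (Fin n) (Fin n) K) (F G : List (WeylSpace K n) → WeylSpace K n) :
    List (WeylSpace K n) → WeylSpace K n := conv (starLin θ G) F

@[simp] theorem cup_nil (θ : Matrix (Fin n) (Fin n) K)
    (F G : List (WeylSpace K n) → WeylSpace K n) : cup θ F G [] = starMul θ (F []) (G []) := rfl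

theorem cup_cons (θ : Matrix (Fin n) (Fin n) K) (F G : List (WeylSpace K n) → WeylSpace K n)
    (a : WeylSpace K n) (L) :
    cup θ F G (a :: L) = starMul θ (F []) (G (a :: L)) + cup θ (tailFun a F) G L := rfl

theorem Multi.starLin {G : List (WeylSpace K n) → WeylSpace K n} (hG : Multi K G)
    (θ : Matrix (Fin n) (Fin n) K) (w : WeylSpace K n) : Multi K (starLin θ G w) :=
  hG.postcomp (starMul θ w)

theorem Multi.cup {F G : List (WeylSpace K n) → WeylSpace K n} (hF : Multi K F) (hG : Multi K G)
    (θ : Matrix (Fin n) (Fin n) K) : Multi K (cup θ F G) :=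
  hF.conv fun w => hG.starLin θ w

theorem cup_add_left (θ : Matrix (Fin n) (Fin n) K)
    (F F' G : List (WeylSpace K n) → WeylSpace K n) :
    cup θ (F + F') G = cup θ F G + cup θ F' G := conv_add _ _ _

theorem cup_neg_left (θ : Matrix (Fin n) (Fin n) K) (F G : List (WeylSpace K n) → WeylSpace K n) :
    cup θ (-F) G = -cup θ F G := conv_neg _ _

theorem cup_add_right (θ : Matrix (Fin n) (Fin n) K)
    (F G G' : List (WeylSpace K n) → WeylSpace K n) :
    cup θ F (G + G') = cup θ F G + cup θ F G' := by
  funext L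
  rw [cup, show (starLin θ (G + G') : WeylSpace K n → _) =
    fun w => starLin θ G w + starLin θ G' w from
      funext fun w => funext fun M => (starMul θ w).map_add _ _]
  exact conv_add_left F L

theorem cup_assoc [CharZero K] (θ : Matrix (Fin n) (Fin n) K)
    (F G H : List (WeylSpace K n) → WeylSpace K n) :
    cup θ (cup θ F G) H = cup θ F (cup θ G H) := by
  funext L
  rw [cup, cup, ← conv_conv]
  refine conv_congr fun L₁ L₂ _ => ?_
  rw [starLin_apply, cup, postcomp_conv, show starLin θ G (F L₁) =
    fun M => starMul θ (F L₁) (G M) from rfl, conv_postcomp]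
  refine conv_congr fun M₁ M₂ _ => ?_
  rw [starLin_apply, starLin_apply, starMul_assoc]

/-- As `G` vanishes on the empty word, `F` is evaluated on proper prefixes only. -/
theorem cup_eq_zero_of_left {θ : Matrix (Fin n) (Fin n) K}
    {F G : List (WeylSpace K n) → WeylSpace K n} (hG : G [] = 0) {L}
    (h : ∀ M, M.length < L.length → F M = 0) : cup θ F G L = 0 := by
  refine conv_eq_zero fun L₁ L₂ hL => ?_
  rw [starLin_apply]
  cases L₂ with
  | nil => rw [hG, map_zero]
  | cons b L₂ =>
    rw [h L₁ (by rw [← hL, List.length_append, List.length_cons]; omega), map_zero,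
      LinearMap.zero_apply]

theorem cup_eq_zero_of_right {θ : Matrix (Fin n) (Fin n) K}
    {F G : List (WeylSpace K n) → WeylSpace K n} (hF : F [] = 0) {L}
    (h : ∀ M, M.length < L.length → G M = 0) : cup θ F G L = 0 := by
  refine conv_eq_zero fun L₁ L₂ hL => ?_
  rw [starLin_apply]
  cases L₁ with
  | nil => rw [hF, map_zero, LinearMap.zero_apply]
  | cons b L₁ =>
    rw [h L₂ (by rw [← hL, List.length_append, List.length_cons]; omega), map_zero]

theorem scaleArgs_cup (θ : Matrix (Fin n) (Fin n) K) (t : K)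
    (F G : List (WeylSpace K n) → WeylSpace K n) :
    scaleArgs t (cup θ F G) = cup θ (scaleArgs t F) (scaleArgs t G) := by
  funext L
  rw [scaleArgs_apply, cup, conv_map]
  rfl

theorem bar_cup (θ θ' : Matrix (Fin n) (Fin n) K)
    (F G : List (WeylSpace K n) → WeylSpace K n) :
    bar θ (cup θ' F G) = cup θ' (bar θ F) G + cup θ' (scaleArgs (-1) F) (bar θ G) := by
  funext L
  rw [cup, bar_conv, Pi.add_apply, cup, cup]
  congr 1
  refine conv_congr fun L₁ L₂ _ => ?_
  rw [starLin_apply, postcomp_bar]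
  rfl

theorem diff_cup (θ : Matrix (Fin n) (Fin n) K) (F G : List (WeylSpace K n) → WeylSpace K n) (L) :
    diff (cup θ F G L) =
      cup θ (fun M => diff (F M)) G L - cup θ (fun M => barParity (F M)) (fun M => diff (G M)) L := by
  induction L generalizing F with
  | nil => simp [diff_starMul]
  | cons a L ih =>
    rw [cup_cons, cup_cons, cup_cons, map_add, ih, diff_starMul]
    simp only [tailFun]
    abel

/-- The amount by which `f` fails to be a morphism. -/
def defect (θ θ' : Matrix (Fin n) (Fin n) K) (f : List (WeylSpace K n) → WeylSpace K n) :
    List (WeylSpace K n) → WeylSpace K n :=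
  bar θ f - (fun L => diff (f L)) - cup θ' (scaleArgs (-1) f) f

/-- `f` has degree zero: it commutes with all `a ↦ t a_0 + a_i ξ^i`, `t ≠ 0`. -/
def ScaleEquivariant (f : List (WeylSpace K n) → WeylSpace K n) : Prop :=
  ∀ t : K, t ≠ 0 → scaleArgs t f = fun L => scale t (f L)

theorem ScaleEquivariant.barParity {f : List (WeylSpace K n) → WeylSpace K n}
    (hf : ScaleEquivariant f) : scaleArgs (-1 : K) f = fun L => barParity (f L) := by
  rw [hf (-1) (by simp)]
  exact funext fun L => scale_neg_one _

/-- A Bianchi identity. Apply `bar` to the definition of the defect `E` and replace each `bar f` by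
`E + d f + f̄ ∪ f`; `bar² = 0`, `d² = 0`, the Leibniz rules and associativity of `cup` remove
everything except the terms linear in `E`. -/
theorem bar_defect [CharZero K] (θ θ' : Matrix (Fin n) (Fin n) K)
    {f : List (WeylSpace K n) → WeylSpace K n} (hf : Multi K f) (he : ScaleEquivariant f) (L) :
    bar θ (defect θ θ' f) L = -diff (defect θ θ' f L) +
      cup θ' (scaleArgs (-1) (defect θ θ' f)) f L - cup θ' f (defect θ θ' f) L := by
  set E := defect θ θ' f with hE
  have hb : bar θ f = E + (fun L => diff (f L)) + cup θ' (scaleArgs (-1) f) f := by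
    rw [hE, defect]; abel
  have hP : scaleArgs (-1 : K) (scaleArgs (-1 : K) f) = f := by
    rw [scaleArgs_scaleArgs]; norm_num [scaleArgs_one]
  have h1 : bar θ E = bar θ (bar θ f) - bar θ (fun L => diff (f L)) -
      bar θ (cup θ' (scaleArgs (-1) f) f) := by
    conv_lhs => rw [hE, defect, map_sub, map_sub]
  have h2 : bar θ (bar θ f) = 0 := funext fun L => bar_bar hf L
  have h3 : bar θ (fun L => diff (f L)) = fun L => diff (E L) +
      diff (cup θ' (scaleArgs (-1) f) f L) := by
    funext L
    rw [← postcomp_bar, hb]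
    simp
  have h4 : bar θ (scaleArgs (-1 : K) f) = -scaleArgs (-1 : K) (bar θ f) := by
    rw [scaleArgs_bar hf]; simp
  have h5 : scaleArgs (-1 : K) (fun L => diff (f L)) = fun L => diff (scaleArgs (-1 : K) f L) := rfl
  have h6 : (fun M => barParity (scaleArgs (-1 : K) f M)) = f := by
    rw [he.barParity]; simp
  rw [h1, h2, h3, bar_cup, h4, hP, hb]
  simp only [map_add, cup_neg_left, cup_add_left, cup_add_right, h5, scaleArgs_cup, hP,
    cup_assoc, Pi.sub_apply, Pi.add_apply, Pi.neg_apply, Pi.zero_apply, diff_cup, h6]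
  abel

/-- If the defect vanishes on shorter words, it anticommutes with the differentials. -/
theorem delta_defect [CharZero K] (θ θ' : Matrix (Fin n) (Fin n) K)
    {f : List (WeylSpace K n) → WeylSpace K n} (hf : Multi K f) (he : ScaleEquivariant f)
    (h0 : f [] = 0) {L} (hL : ∀ M, M.length < L.length → defect θ θ' f M = 0) :
    delta (defect θ θ' f) L = -diff (defect θ θ' f L) := by
  have h := bar_defect θ θ' hf he L
  rw [bar_apply, mulCoder_eq_zero (fun M hM => hL M (by omega)), add_zero,
    cup_eq_zero_of_left h0, cup_eq_zero_of_right h0 hL, add_zero, sub_zero] at h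
  · exact h
  · intro M hM
    exact hL _ (by simpa using hM)

/-- The product with `x` hits the value of `f` on the first block. The right-hand side also allows
this block to be empty, which contributes nothing because `f [] = 0`. -/
theorem contr_comp (θ' : Matrix (Fin n) (Fin n) K) {f : List (WeylSpace K n) → WeylSpace K n}
    (h0 : f [] = 0) {φ : List (WeylSpace K n) → X} (hφ : Multi K φ) (x : WeylSpace K n) (L) :
    comp f (contr θ' x φ) L = conv (compTail f hφ) (starLin θ' f x) L := by
  cases L with
  | nil => simp [starLin_apply, h0]
  | cons b L =>
    rw [conv_cons, starLin_apply, h0, map_zero, map_zero, Pi.zero_apply, zero_add, comp_cons,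
      show tailFun b (starLin θ' f x) = fun M => starMul θ' x (tailFun b f M) from rfl,
      conv_postcomp (starMul θ' x) _ (tailFun b f)]
    rfl

/-- The coalgebra map defined by a morphism commutes with the coderivations. -/
theorem bar_comp {θ θ' : Matrix (Fin n) (Fin n) K}
    {f : List (WeylSpace K n) → WeylSpace K n} (he : ScaleEquivariant f)
    (h0 : f [] = 0) (hd : ∀ L, defect θ θ' f L = 0) {φ : List (WeylSpace K n) → X}
    (hφ : Multi K φ) (L) : bar θ (comp f φ) L = comp f (bar θ' φ) L := by
  induction L using suffix_induction generalizing φ with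
  | nil => simp
  | cons a L ih =>
    -- The morphism equation on words that begin with `a`; the splitting with empty first part drops
    -- out of the cup product.
    have hb : tailFun a (bar θ f) = (fun M => diff (tailFun a f M)) +
        conv (starLin θ' f) (fun M => barParity (tailFun a f M)) := by
      funext M
      have := hd (a :: M)
      rw [defect, Pi.sub_apply, Pi.sub_apply, sub_sub, sub_eq_zero, he.barParity, cup_cons, h0,
        map_zero, map_zero, LinearMap.zero_apply, zero_add] at this
      exact this
    have hc : contr θ (barParity a) (comp f φ) L =
        conv (compTail f hφ) (contr θ (barParity a) f) L := by
      cases L with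
      | nil => simp
      | cons b L =>
        rw [contr_cons, comp_cons' f hφ, conv_cons, contr_nil, map_zero, Pi.zero_apply, zero_add,
          tailFun_contr]
    have hs : scaleArgs (-1 : K) (tailFun (barParity a) f) =
        fun M => barParity (tailFun a f M) := by
      funext M
      have := congrFun he.barParity (a :: M)
      rw [scaleArgs_apply, List.map_cons, scale_neg_one] at this
      exact this
    -- The coderivation acts either within the block that contains `a` or, with a sign, behind it.
    have hl : bar θ (comp f φ) (a :: L) = conv (compTail f hφ) (tailFun a (bar θ f)) L +
        conv (bar θ ∘ₗ compTail f hφ) (fun M => barParity (tailFun a f M)) L := by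
      rw [bar_cons, comp_cons' f hφ, hc, tailFun_comp]
      have := bar_conv (θ := θ) (u := tailFun (barParity a) f) (Ξ := compTail f hφ) L
      rw [hs] at this
      refine (congrArg _ this).trans ?_
      rw [tailFun_bar, conv_add, conv_add, Pi.add_apply, Pi.add_apply]
      abel
    rw [hl, hb, conv_add, Pi.add_apply, conv_postcomp diff _ (tailFun a f), ← conv_conv,
      conv_postcomp barParity _ (tailFun a f), conv_postcomp barParity _ (tailFun a f),
      ← conv_add_left, ← conv_add_left, comp_cons]
    refine conv_congr fun L₁ L₂ h => ?_
    rw [tailFun_bar, comp_add, comp_add, Pi.add_apply, Pi.add_apply, Pi.add_apply, Pi.add_apply,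
      contr_comp θ' h0 hφ, ← ih L₁ L₂ h (hφ.tailFun _)]
    rfl

end Relation

/-! ### The Poincaré homotopy on the algebra and its extension to cochains. -/

section Poincare

set_option linter.unusedSectionVars false

variable {K : Type*} [Field K] {n : ℕ} {X Y : Type*} [AddCommGroup X] [Module K X]
  [AddCommGroup Y] [Module K Y]

/-- `∫_0^1 f(t x) dt`. -/
def rayIntegral : MvPolynomial (Fin n) K →ₗ[K] MvPolynomial (Fin n) K :=
  (MvPolynomial.basisMonomials (Fin n) K).constr K
    fun α => MvPolynomial.monomial α ((α.degree : K) + 1)⁻¹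

theorem rayIntegral_monomial (α : Fin n →₀ ℕ) (c : K) :
    rayIntegral (MvPolynomial.monomial α c) =
      MvPolynomial.monomial α (((α.degree : K) + 1)⁻¹ * c) := by
  have h : (MvPolynomial.monomial α c : MvPolynomial (Fin n) K) =
      c • MvPolynomial.basisMonomials (Fin n) K α := by
    simp [MvPolynomial.smul_monomial]
  rw [h, map_smul, rayIntegral, Module.Basis.constr_basis, MvPolynomial.smul_monomial, smul_eq_mul,
    mul_comm]

/-- The homotopy operator of the Poincaré lemma, `a ↦ x^i ∫_0^1 a_i(t x) dt`. -/
def poincare : WeylSpace K n →ₗ[K] WeylSpace K n :=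
  LinearMap.inl K _ _ ∘ₗ
    (∑ i, LinearMap.mulLeft K (MvPolynomial.X i) ∘ₗ rayIntegral ∘ₗ LinearMap.proj i) ∘ₗ
      LinearMap.snd K _ _

theorem poincare_apply (a : WeylSpace K n) :
    poincare a = (∑ i, MvPolynomial.X i * rayIntegral (a.2 i), 0) := by
  simp [poincare]

/-- The projection to cohomology and coexact forms, `1 - h d - d h`. -/
def poincareProj : WeylSpace K n →ₗ[K] WeylSpace K n :=
  LinearMap.id - poincare ∘ₗ diff - diff ∘ₗ poincare

theorem poincareProj_apply (a : WeylSpace K n) :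
    poincareProj a = a - poincare (diff a) - diff (poincare a) := rfl

theorem barParity_poincare (a : WeylSpace K n) : barParity (poincare a) = -poincare a := by
  simp [poincare_apply, barParity_apply]

theorem poincare_barParity (a : WeylSpace K n) : poincare (barParity a) = poincare a := by
  simp [poincare_apply, barParity_apply]

theorem poincare_scale (t : K) (a : WeylSpace K n) : poincare (scale t a) = poincare a := by
  simp [poincare_apply, scale_apply]

theorem scale_poincare (t : K) (a : WeylSpace K n) : scale t (poincare a) = t • poincare a := by
  simp [poincare_apply, scale_apply]

@[simp] theorem poincare_unit : poincare (unit : WeylSpace K n) = 0 := by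
  simp [poincare_apply, unit]

theorem scale_diff (t : K) (a : WeylSpace K n) : scale t (diff a) = diff a := by
  simp [diff_apply, scale_apply]

theorem poincareProj_scale (t : K) (a : WeylSpace K n) :
    poincareProj (scale t a) = scale t (poincareProj a) := by
  rw [poincareProj_apply, poincareProj_apply, map_sub, map_sub, poincare_scale, diff_scale,
    scale_poincare, scale_diff, scale_diff, map_smul]

theorem poincareProj_barParity (a : WeylSpace K n) :
    poincareProj (barParity a) = barParity (poincareProj a) := by
  rw [← scale_neg_one, poincareProj_scale, scale_neg_one]

theorem poincareProj_diff (a : WeylSpace K n) :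
    poincareProj (diff a) = diff (poincareProj a) := by
  simp [poincareProj_apply]

@[simp] theorem poincareProj_unit : poincareProj (unit : WeylSpace K n) = unit := by
  simp [poincareProj_apply]

/-- Euler's formula: `x^i ∂_i` multiplies a monomial by its degree, the ray integral divides by the
same number, and only the constant term is lost. -/
theorem poincare_diff [CharZero K] (a : WeylSpace K n) :
    poincare (diff a) = (a.1 - MvPolynomial.C (MvPolynomial.coeff 0 a.1), 0) := by
  rw [poincare_apply, diff_apply]
  ext1
  · simp only [grad]
    induction a.1 using MvPolynomial.induction_on' with
    | monomial α c =>
      have h : ∀ i : Fin n, (MvPolynomial.X i : MvPolynomial (Fin n) K) *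
          rayIntegral (MvPolynomial.pderiv i (MvPolynomial.monomial α c)) =
            MvPolynomial.monomial α ((α.degree : K)⁻¹ * (c * α i)) := by
        intro i
        by_cases hi : α i = 0
        · simp [MvPolynomial.pderiv_monomial, hi]
        · have hle : Finsupp.single i 1 ≤ α := by
            rw [Finsupp.single_le_iff]; omega
          have hd := congrArg Finsupp.degree (tsub_add_cancel_of_le hle)
          rw [map_add, Finsupp.degree_single] at hd
          rw [MvPolynomial.pderiv_monomial, rayIntegral_monomial, MvPolynomial.X,
            MvPolynomial.monomial_mul, one_mul, add_comm (Finsupp.single i 1),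
            tsub_add_cancel_of_le hle, ← hd]
          push_cast
          rfl
      simp only [h]
      rw [← map_sum, ← Finset.mul_sum, ← Finset.mul_sum, ← Nat.cast_sum, ← Finsupp.degree_eq_sum]
      by_cases hα : α = 0
      · subst hα
        simp
      · have hd : (α.degree : K) ≠ 0 := by
          rw [Nat.cast_ne_zero, Ne, Finsupp.degree_eq_zero_iff]; exact hα
        rw [MvPolynomial.coeff_monomial, if_neg hα, map_zero, sub_zero]
        congr 1
        field_simp
    | add p q hp hq =>
      simp only [map_add, mul_add, Finset.sum_add_distrib, hp, hq, MvPolynomial.coeff_add]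
      ring
  · rfl

/-- The function component of `π a` is reduced to a constant by `poincare_diff`, that is, to a
multiple of the unit. Up to what normal cochains ignore, `π` thus produces one-forms. -/
theorem poincareProj_eq [CharZero K] (a : WeylSpace K n) :
    poincareProj a = MvPolynomial.coeff 0 a.1 • unit + scale 0 (poincareProj a) := by
  rw [poincareProj_apply, poincare_diff]
  ext1
  · simp [unit, scale_apply, diff_apply, MvPolynomial.smul_eq_C_mul]
  · simp [unit, scale_apply]

/-- `(hF)(L)`, where `(hF)(a_0, …) = ∑ ± F (a_0, …, h a_i, π a_{i+1}, …)`. -/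
def htpyAt : List (WeylSpace K n) → (List (WeylSpace K n) → X) →ₗ[K] X
  | [] => 0
  | a :: L => LinearMap.proj (poincare a :: L.map poincareProj) +
      htpyAt L ∘ₗ tailOp K (barParity a)

/-- The homotopy operator on sequences of multilinear maps. -/
def htpy : (List (WeylSpace K n) → X) →ₗ[K] (List (WeylSpace K n) → X) := LinearMap.pi htpyAt

@[simp] theorem htpy_nil (F : List (WeylSpace K n) → X) : htpy F [] = 0 := rfl

theorem htpy_cons (F : List (WeylSpace K n) → X) (a : WeylSpace K n) (L) :
    htpy F (a :: L) = F (poincare a :: L.map poincareProj) + htpy (tailFun (barParity a) F) L := rfl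

theorem Multi.htpy {F : List (WeylSpace K n) → X} (hF : Multi K F) : Multi K (htpy F) := by
  intro L₁
  induction L₁ generalizing F with
  | nil =>
    intro L₂
    exact isLinearMap_add (hF.cons_comp poincare (L₂.map poincareProj))
      (htpyAt L₂ ∘ₗ hF.tailLin ∘ₗ barParity).isLinear
  | cons a L₁ ih =>
    intro L₂
    exact isLinearMap_add ((hF.tailFun (poincare a)).precomp poincareProj L₁ L₂)
      (ih (hF.tailFun _) L₂)

theorem htpy_eq_zero {F : List (WeylSpace K n) → X} {L}
    (h : ∀ M, M.length = L.length → F M = 0) : htpy F L = 0 := by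
  induction L generalizing F with
  | nil => rfl
  | cons a L ih =>
    rw [htpy_cons, h _ (by simp), ih, add_zero]
    intro M hM
    exact h _ (by simp [hM])

theorem postcomp_htpy (T : X →ₗ[K] Y) (F : List (WeylSpace K n) → X) (L) :
    T (htpy F L) = htpy (fun M => T (F M)) L := by
  induction L generalizing F with
  | nil => simp
  | cons a L ih => rw [htpy_cons, htpy_cons, map_add, ih]; rfl

/-- The homotopy lowers the degree of one argument; the factor `t` therefore stands on the side
opposite to that in `scaleArgs_delta`. -/
theorem htpy_scaleArgs {F : List (WeylSpace K n) → X} (hF : Multi K F) (t : K) :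
    htpy (scaleArgs t F) = t • scaleArgs t (htpy F) := by
  funext L
  induction L generalizing F with
  | nil => simp [scaleArgs_apply]
  | cons a L ih =>
    have := ih (hF.tailFun (barParity (scale t a)))
    simp only [scaleArgs_apply, Pi.smul_apply, List.map_cons] at this ⊢
    rw [htpy_cons, htpy_cons, smul_add, tailFun_scaleArgs, scale_barParity, this, scaleArgs_apply,
      List.map_cons, scale_poincare, (hF.cons _).map_smul, poincare_scale, List.map_map,
      List.map_map]
    have h : (scale t : WeylSpace K n → WeylSpace K n) ∘ poincareProj =
        poincareProj ∘ scale t := funext fun a => (poincareProj_scale t a).symm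
    rw [h]

/-- `π` commutes with `d` and with the sign operator, so it is a chain map in every argument. -/
theorem delta_map_poincareProj (F : List (WeylSpace K n) → X) (L) :
    delta F (L.map poincareProj) = delta (fun M => F (M.map poincareProj)) L := by
  induction L generalizing F with
  | nil => rfl
  | cons a L ih =>
    rw [List.map_cons, delta_cons, delta_cons, ih, ← poincareProj_diff, ← poincareProj_barParity]
    rfl

/-- The homotopy formula `δ h + h δ = 1 - π ⊗ ⋯ ⊗ π`. -/
theorem delta_htpy {F : List (WeylSpace K n) → X} (hF : Multi K F) (L) :
    delta (htpy F) L + htpy (delta F) L = F L - F (L.map poincareProj) := by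
  induction L generalizing F with
  | nil => simp
  | cons a L ih =>
    have h1 : tailFun (barParity a) (htpy F) =
        (fun M => tailFun (poincare a) F (M.map poincareProj)) + htpy (tailFun a F) := by
      funext M
      rw [tailFun_apply, htpy_cons, poincare_barParity, barParity_barParity]
      rfl
    have h2 : tailFun (barParity a) (delta F) = tailFun (-diff a) F + delta (tailFun a F) := by
      funext M
      rw [tailFun_apply, delta_cons, diff_barParity, barParity_barParity]
      rfl
    rw [delta_cons, htpy_cons, htpy_cons, delta_cons, h1, h2, map_add, map_add, Pi.add_apply,
      Pi.add_apply, ← delta_map_poincareProj, barParity_poincare, hF.tailFun_neg, hF.tailFun_neg,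
      barParity_diff, map_neg, map_neg, Pi.neg_apply, Pi.neg_apply]
    have h3 := ih (hF.tailFun a)
    -- This is `h d + d h = 1 - π` in the first letter. Added to `h3`, the homotopy formula in the
    -- remaining letters, it telescopes.
    have h4 : F (poincare (diff a) :: L.map poincareProj) +
        F (diff (poincare a) :: L.map poincareProj) =
          F (a :: L.map poincareProj) - F (poincareProj a :: L.map poincareProj) := by
      rw [← (hF.cons _).map_add, ← (hF.cons _).map_sub, poincareProj_apply]
      congr 2
      abel
    rw [tailFun_apply, tailFun_apply] at h3
    rw [List.map_cons]
    calc _ = (F (poincare (diff a) :: L.map poincareProj) +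
        F (diff (poincare a) :: L.map poincareProj)) +
        (delta (htpy (tailFun a F)) L + htpy (delta (tailFun a F)) L) := by abel
      _ = _ := by rw [h3, h4]; abel

/-- `F` vanishes if one of its arguments is the unit. -/
def UnitFree (F : List (WeylSpace K n) → X) : Prop :=
  ∀ L₁ L₂ : List (WeylSpace K n), F (L₁ ++ unit :: L₂) = 0

theorem UnitFree.tailFun {F : List (WeylSpace K n) → X} (hF : UnitFree F) (x : WeylSpace K n) :
    UnitFree (tailFun x F) := fun L₁ L₂ => hF (x :: L₁) L₂

/-- The side conditions `h 1 = 0` and `π 1 = 1` keep the homotopy inside the normal cochains. -/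
theorem UnitFree.htpy {F : List (WeylSpace K n) → X} (hF : UnitFree F) (hm : Multi K F) :
    UnitFree (htpy F) := by
  intro L₁
  induction L₁ generalizing F with
  | nil =>
    intro L₂
    rw [List.nil_append, htpy_cons, poincare_unit, (hm.cons _).map_zero, barParity_unit,
      hm.tailFun_neg, show SeibergWitten.tailFun unit F = 0 from funext fun L => hF [] L]
    simp
  | cons a L₁ ih =>
    intro L₂
    rw [List.cons_append, htpy_cons, ih (hF.tailFun _) (hm.tailFun _), List.map_append,
      List.map_cons, poincareProj_unit, ← List.cons_append, hF, add_zero]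

/-- By `poincareProj_eq` each argument `π a` is its one-form part plus a multiple of the unit, and
the latter is annihilated. -/
theorem UnitFree.map_poincareProj [CharZero K] {F : List (WeylSpace K n) → X} (hF : UnitFree F)
    (hm : Multi K F) (L : List (WeylSpace K n)) :
    F (L.map poincareProj) = scaleArgs 0 F (L.map poincareProj) := by
  induction L generalizing F with
  | nil => rfl
  | cons a L ih =>
    have h : SeibergWitten.tailFun (poincareProj a) F =
        SeibergWitten.tailFun (scale 0 (poincareProj a)) F := by
      conv_lhs => rw [poincareProj_eq a]
      rw [hm.tailFun_add, hm.tailFun_smul,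
        show SeibergWitten.tailFun unit F = 0 from funext fun L => hF [] L, smul_zero, zero_add]
    calc F ((a :: L).map poincareProj) =
        SeibergWitten.tailFun (poincareProj a) F (L.map poincareProj) := rfl
      _ = _ := by rw [h, ih (hF.tailFun _) (hm.tailFun _)]; rfl

/-- `scale 2` fixes one-forms, so it cannot change the restriction of `F` to them, while the
hypothesis multiplies it by `c ≠ 1`. A cochain of the wrong degree vanishes if all arguments are
one-forms. -/
theorem scaleArgs_zero_eq_zero [CharZero K] {F : List (WeylSpace K n) → X} {c : K} (hc : c ≠ 1)
    (h : scaleArgs (2 : K) F = c • F) : scaleArgs (0 : K) F = 0 := by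
  have h1 : scaleArgs (0 : K) F = c • scaleArgs (0 : K) F := by
    rw [← map_smul, ← h, scaleArgs_scaleArgs, mul_zero]
  have h2 : (1 - c) • scaleArgs (0 : K) F = 0 := by
    rw [sub_smul, one_smul, ← h1, sub_self]
  exact (smul_eq_zero.mp h2).resolve_left (sub_ne_zero.mpr hc.symm)

end Poincare

/-! ### Taylor expansion of polynomials. -/

section Taylor

set_option linter.unusedSectionVars false

variable {K : Type*} [Field K] {n : ℕ}

/-- The polynomial `f (y + c x)` in `y`, with coefficients in the polynomials in `x`. -/
def translate (c : K) :
    MvPolynomial (Fin n) K →ₐ[K] MvPolynomial (Fin n) (MvPolynomial (Fin n) K) :=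
  MvPolynomial.aeval fun i => MvPolynomial.X i + MvPolynomial.C (c • MvPolynomial.X i)

theorem translate_X (c : K) (i : Fin n) :
    translate c (MvPolynomial.X i : MvPolynomial (Fin n) K) =
      MvPolynomial.X i + MvPolynomial.C (c • MvPolynomial.X i) := by
  simp [translate]

theorem pderiv_translate (c : K) (i : Fin n) (f : MvPolynomial (Fin n) K) :
    MvPolynomial.pderiv i (translate c f) = translate c (MvPolynomial.pderiv i f) := by
  induction f using MvPolynomial.induction_on with
  | C a => simp
  | add p q hp hq => simp only [map_add, hp, hq]
  | mul_X p j hp =>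
    simp only [map_mul, MvPolynomial.pderiv_mul, hp, map_add, translate_X, MvPolynomial.pderiv_C,
      MvPolynomial.pderiv_X, add_zero]
    by_cases h : j = i
    · subst h; simp
    · simp [h]

theorem coeff_zero_translate_one (f : MvPolynomial (Fin n) K) :
    MvPolynomial.coeff 0 (translate (1 : K) f) = f := by
  induction f using MvPolynomial.induction_on with
  | C a => simp
  | add p q hp hq => simp only [map_add, MvPolynomial.coeff_add, hp, hq]
  | mul_X p j hp =>
    rw [map_mul, translate_X, ← MvPolynomial.constantCoeff_eq, map_mul,
      MvPolynomial.constantCoeff_eq, hp]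
    simp

/-- `α!` -/
def multiFactorial (α : Fin n →₀ ℕ) : ℕ := ∏ i, (α i).factorial

theorem multiFactorial_ne_zero [CharZero K] (α : Fin n →₀ ℕ) : (multiFactorial α : K) ≠ 0 := by
  rw [Nat.cast_ne_zero, multiFactorial, Finset.prod_ne_zero_iff]
  exact fun i _ => Nat.factorial_ne_zero _

theorem multiFactorial_add_single (α : Fin n →₀ ℕ) (i : Fin n) :
    multiFactorial (α + Finsupp.single i 1) = (α i + 1) * multiFactorial α := by
  rw [multiFactorial, multiFactorial, ← Finset.mul_prod_erase _ _ (Finset.mem_univ i),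
    ← Finset.mul_prod_erase _ (fun i => (α i).factorial) (Finset.mem_univ i), ← mul_assoc]
  congr 1
  · simp [Nat.factorial_succ]
  · refine Finset.prod_congr rfl fun j hj => ?_
    simp [(Finset.ne_of_mem_erase hj).symm]

theorem iterDeriv_zero : iterDeriv (0 : Fin n →₀ ℕ) = (1 : Module.End K (MvPolynomial (Fin n) K)) := by
  rw [iterDeriv]
  refine List.prod_eq_one fun T hT => ?_
  rw [List.mem_ofFn] at hT
  obtain ⟨i, rfl⟩ := hT
  simp

theorem iterDeriv_add_single (α : Fin n →₀ ℕ) (i : Fin n) :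
    (iterDeriv (α + Finsupp.single i 1) : Module.End K (MvPolynomial (Fin n) K)) =
      iterDeriv α * (MvPolynomial.pderiv i).toLinearMap := by
  -- The ordered product is treated over duplicate-free lists of indices, where the extra `∂_i`
  -- arises at most once and can be commuted to the right end.
  have key : ∀ J : List (Fin n), J.Nodup →
      (J.map fun j => ((MvPolynomial.pderiv j).toLinearMap :
        Module.End K (MvPolynomial (Fin n) K)) ^ ((α + Finsupp.single i 1 : Fin n →₀ ℕ) j)).prod =
      (J.map fun j => ((MvPolynomial.pderiv j).toLinearMap :
        Module.End K (MvPolynomial (Fin n) K)) ^ α j).prod *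
        if i ∈ J then (MvPolynomial.pderiv i).toLinearMap else 1 := by
    intro J
    induction J with
    | nil => simp
    | cons j J ih =>
      intro hJ
      rw [List.nodup_cons] at hJ
      rw [List.map_cons, List.prod_cons, ih hJ.2, List.map_cons, List.prod_cons]
      by_cases h : i = j
      · subst h
        have hc : Commute ((MvPolynomial.pderiv i).toLinearMap :
            Module.End K (MvPolynomial (Fin n) K)) (J.map fun j =>
              ((MvPolynomial.pderiv j).toLinearMap :
                Module.End K (MvPolynomial (Fin n) K)) ^ α j).prod := by
          refine Commute.list_prod_right _ _ fun T hT => ?_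
          obtain ⟨j, -, rfl⟩ := List.mem_map.mp hT
          exact (commute_pderiv i j).pow_right _
        rw [if_neg hJ.1, mul_one, if_pos List.mem_cons_self, mul_assoc, ← hc.eq, ← mul_assoc]
        simp [pow_succ]
      · simp [h, Ne.symm h, mul_assoc]
  have := key (List.finRange n) (List.nodup_finRange n)
  rw [if_pos (List.mem_finRange i), ← List.ofFn_eq_map, ← List.ofFn_eq_map] at this
  exact this

/-- The coefficients of the Taylor expansion are given by the derivatives. -/
theorem coeff_translate_one (α : Fin n →₀ ℕ) (f : MvPolynomial (Fin n) K) :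
    (multiFactorial α : K) • MvPolynomial.coeff α (translate (1 : K) f) = iterDeriv α f := by
  suffices h : ∀ (N : ℕ) (α : Fin n →₀ ℕ), α.degree = N → ∀ f : MvPolynomial (Fin n) K,
      (multiFactorial α : K) • MvPolynomial.coeff α (translate (1 : K) f) = iterDeriv α f from
    h _ α rfl f
  intro N
  induction N with
  | zero =>
    intro α hα f
    obtain rfl : α = 0 := by rwa [Finsupp.degree_eq_zero_iff] at hα
    rw [coeff_zero_translate_one, iterDeriv_zero]
    simp [multiFactorial]
  | succ N ih =>
    intro α hα f
    obtain ⟨i, hi⟩ : ∃ i, α i ≠ 0 := by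
      by_contra! hcon
      rw [show α = 0 from Finsupp.ext hcon] at hα
      simp at hα
    have hle : Finsupp.single i 1 ≤ α := by
      rw [Finsupp.single_le_iff]; omega
    obtain ⟨β, rfl⟩ : ∃ β, α = β + Finsupp.single i 1 := ⟨_, (tsub_add_cancel_of_le hle).symm⟩
    rw [map_add, Finsupp.degree_single] at hα
    rw [iterDeriv_add_single, Module.End.mul_apply, Derivation.coeFn_coe, ← ih β (by omega),
      ← pderiv_translate, MvPolynomial.coeff_pderiv, multiFactorial_add_single,
      ← MvPolynomial.C_eq_coe_nat, MvPolynomial.smul_eq_C_mul, MvPolynomial.smul_eq_C_mul]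
    simp only [Nat.cast_mul, Nat.cast_add, Nat.cast_one, map_mul, map_add, map_one]
    ring

end Taylor

/-! ### Linear maps applied to translated polynomials. -/

section Shift

set_option linter.unusedSectionVars false

variable {K : Type*} [Field K] {n : ℕ} {M : Type*} [AddCommGroup M] [Module K M]
  [Module (MvPolynomial (Fin n) K) M] [IsScalarTower K (MvPolynomial (Fin n) K) M]

/-- The linear extension of `H` to polynomials with polynomial coefficients. -/
def extendCoeff (H : MvPolynomial (Fin n) K →ₗ[K] M) :
    MvPolynomial (Fin n) (MvPolynomial (Fin n) K) →ₗ[MvPolynomial (Fin n) K] M :=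
  (MvPolynomial.basisMonomials (Fin n) (MvPolynomial (Fin n) K)).constr (MvPolynomial (Fin n) K)
    fun α => H (MvPolynomial.monomial α 1)

theorem extendCoeff_monomial (H : MvPolynomial (Fin n) K →ₗ[K] M) (α : Fin n →₀ ℕ)
    (r : MvPolynomial (Fin n) K) :
    extendCoeff H (MvPolynomial.monomial α r) = r • H (MvPolynomial.monomial α 1) := by
  have h : (MvPolynomial.monomial α r : MvPolynomial (Fin n) (MvPolynomial (Fin n) K)) =
      r • MvPolynomial.basisMonomials (Fin n) (MvPolynomial (Fin n) K) α := by
    simp [MvPolynomial.smul_monomial]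
  rw [h, map_smul, extendCoeff, Module.Basis.constr_basis]

theorem extendCoeff_eq_sum (H : MvPolynomial (Fin n) K →ₗ[K] M)
    (p : MvPolynomial (Fin n) (MvPolynomial (Fin n) K)) {S : Finset (Fin n →₀ ℕ)}
    (hS : p.support ⊆ S) :
    extendCoeff H p = ∑ α ∈ S, MvPolynomial.coeff α p • H (MvPolynomial.monomial α 1) := by
  conv_lhs => rw [← MvPolynomial.support_sum_monomial_coeff p]
  rw [map_sum]
  simp only [extendCoeff_monomial]
  refine Finset.sum_subset hS fun α _ hα => ?_
  rw [MvPolynomial.notMem_support_iff.mp hα, zero_smul]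

theorem extendCoeff_add (H H' : MvPolynomial (Fin n) K →ₗ[K] M) (p) :
    extendCoeff (H + H') p = extendCoeff H p + extendCoeff H' p := by
  rw [extendCoeff_eq_sum _ p subset_rfl, extendCoeff_eq_sum _ p subset_rfl,
    extendCoeff_eq_sum _ p subset_rfl, ← Finset.sum_add_distrib]
  simp

theorem extendCoeff_pderiv (H : MvPolynomial (Fin n) K →ₗ[K] M) (i : Fin n) (p) :
    extendCoeff H (MvPolynomial.pderiv i p) =
      extendCoeff (H ∘ₗ (MvPolynomial.pderiv i).toLinearMap) p := by
  induction p using MvPolynomial.induction_on' with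
  | monomial α r =>
    rw [MvPolynomial.pderiv_monomial, extendCoeff_monomial, extendCoeff_monomial,
      LinearMap.comp_apply, Derivation.coeFn_coe, MvPolynomial.pderiv_monomial, one_mul,
      show (MvPolynomial.monomial (α - Finsupp.single i 1) (α i : K) : MvPolynomial (Fin n) K) =
        (α i : K) • MvPolynomial.monomial (α - Finsupp.single i 1) 1 by
          rw [MvPolynomial.smul_monomial, smul_eq_mul, mul_one], map_smul, mul_smul,
      Nat.cast_smul_eq_nsmul, Nat.cast_smul_eq_nsmul]
  | add p q hp hq => simp only [map_add, hp, hq]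

theorem extendCoeff_C (H : MvPolynomial (Fin n) K →ₗ[K] M) :
    extendCoeff H 1 = H 1 := by
  have := extendCoeff_monomial H 0 1
  rwa [one_smul] at this

/-- `f ↦ H_y (f (y + c x))`, where `H_y` is `H` acting on polynomials in `y`. -/
def polyShift (c : K) (H : MvPolynomial (Fin n) K →ₗ[K] M) : MvPolynomial (Fin n) K →ₗ[K] M where
  toFun f := extendCoeff H (translate c f)
  map_add' f g := by rw [map_add, map_add]
  map_smul' a f := by
    rw [map_smul, RingHom.id_apply, ← algebraMap_smul (MvPolynomial (Fin n) K) a (translate c f),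
      map_smul, algebraMap_smul]

theorem polyShift_apply (c : K) (H : MvPolynomial (Fin n) K →ₗ[K] M) (f) :
    polyShift c H f = extendCoeff H (translate c f) := rfl

theorem polyShift_add (c : K) (H H' : MvPolynomial (Fin n) K →ₗ[K] M) :
    polyShift c (H + H') = polyShift c H + polyShift c H' :=
  LinearMap.ext fun _ => extendCoeff_add H H' _

theorem polyShift_pderiv (c : K) (H : MvPolynomial (Fin n) K →ₗ[K] M) (i : Fin n) :
    polyShift c H ∘ₗ (MvPolynomial.pderiv i).toLinearMap =
      polyShift c (H ∘ₗ (MvPolynomial.pderiv i).toLinearMap) := by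
  refine LinearMap.ext fun f => ?_
  rw [LinearMap.comp_apply, polyShift_apply, Derivation.coeFn_coe, ← pderiv_translate,
    extendCoeff_pderiv]
  rfl

theorem polyShift_polyShift (c c' : K) (H : MvPolynomial (Fin n) K →ₗ[K] M) :
    polyShift c (polyShift c' H) = polyShift (c + c') H := by
  -- Substitution of `y + c' x` for `y` with the coefficients in `x` kept fixed; composed with
  -- `translate c` it becomes the translation by `(c + c') x`.
  let E : MvPolynomial (Fin n) (MvPolynomial (Fin n) K) →ₐ[MvPolynomial (Fin n) K]
      MvPolynomial (Fin n) (MvPolynomial (Fin n) K) :=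
    MvPolynomial.aeval fun i => MvPolynomial.X i + MvPolynomial.C (c' • MvPolynomial.X i)
  have hE : ∀ α : Fin n →₀ ℕ, E (MvPolynomial.monomial α 1) =
      translate c' (MvPolynomial.monomial α 1) := fun α => by
    simp only [E, translate, MvPolynomial.aeval_monomial, map_one]
  have h1 : ∀ p, extendCoeff (polyShift c' H) p = extendCoeff H (E p) := by
    intro p
    induction p using MvPolynomial.induction_on' with
    | monomial α r =>
      rw [extendCoeff_monomial, polyShift_apply, ← hE, ← map_smul, ← map_smul,
        MvPolynomial.smul_monomial, smul_eq_mul, mul_one]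
    | add p q hp hq => simp only [map_add, hp, hq]
  have h2 : (E.restrictScalars K).comp (translate c) = translate (c + c') := by
    refine MvPolynomial.algHom_ext fun i => ?_
    rw [AlgHom.comp_apply, translate_X, translate_X, map_add]
    simp only [AlgHom.restrictScalars_apply, E, MvPolynomial.aeval_X, MvPolynomial.aeval_C,
      MvPolynomial.algebraMap_eq, add_smul, map_add]
    ring
  refine LinearMap.ext fun f => ?_
  rw [polyShift_apply, h1, polyShift_apply, ← h2]
  rfl

theorem polyShift_zero (H : MvPolynomial (Fin n) K →ₗ[K] M) : polyShift 0 H = H := by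
  have h : (translate (0 : K) : MvPolynomial (Fin n) K →ₐ[K] _) =
      MvPolynomial.mapAlgHom (Algebra.ofId K (MvPolynomial (Fin n) K)) := by
    refine MvPolynomial.algHom_ext fun i => ?_
    rw [translate_X]
    simp
  refine LinearMap.ext fun f => ?_
  rw [polyShift_apply]
  induction f using MvPolynomial.induction_on' with
  | monomial α r =>
    rw [h, show MvPolynomial.mapAlgHom (Algebra.ofId K (MvPolynomial (Fin n) K))
      (MvPolynomial.monomial α r) = MvPolynomial.monomial α (algebraMap K _ r) from
        MvPolynomial.map_monomial _ _ _, extendCoeff_monomial, algebraMap_smul, ← map_smul,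
      MvPolynomial.smul_monomial, smul_eq_mul, mul_one]
  | add p q hp hq => simp only [map_add, hp, hq]

variable (K n) in
/-- The inclusion `f ↦ f` of the component of degree zero. -/
def inFun : MvPolynomial (Fin n) K →ₗ[K] WeylSpace K n := LinearMap.inl K _ _

variable (K) in
/-- The inclusion `f ↦ f ξ^i`. -/
def inForm (i : Fin n) : MvPolynomial (Fin n) K →ₗ[K] WeylSpace K n :=
  LinearMap.inr K _ _ ∘ₗ LinearMap.single K (fun _ : Fin n => MvPolynomial (Fin n) K) i

theorem inFun_apply (f : MvPolynomial (Fin n) K) : inFun K n f = (f, 0) := rfl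

theorem inForm_apply (i : Fin n) (f : MvPolynomial (Fin n) K) :
    inForm K i f = (0, Pi.single i f) := rfl

theorem sum_inForm (a : Fin n → MvPolynomial (Fin n) K) :
    ∑ i, inForm K i (a i) = (0, a) := by
  simp only [inForm, LinearMap.comp_apply, ← map_sum, LinearMap.coe_single, Finset.univ_sum_single]
  rfl

theorem inFun_add_sum_inForm (a : WeylSpace K n) :
    inFun K n a.1 + ∑ i, inForm K i (a.2 i) = a := by
  rw [sum_inForm, inFun_apply]
  ext1 <;> simp

/-- `polyShift` on all components. -/
def weylShift (c : K) (H : WeylSpace K n →ₗ[K] M) : WeylSpace K n →ₗ[K] M :=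
  polyShift c (H ∘ₗ inFun K n) ∘ₗ LinearMap.fst K _ _ +
    (∑ i, polyShift c (H ∘ₗ inForm K i) ∘ₗ LinearMap.proj i) ∘ₗ LinearMap.snd K _ _

theorem weylShift_apply (c : K) (H : WeylSpace K n →ₗ[K] M) (a) :
    weylShift c H a = polyShift c (H ∘ₗ inFun K n) a.1 +
      ∑ i, polyShift c (H ∘ₗ inForm K i) (a.2 i) := by
  simp [weylShift]

theorem weylShift_add (c : K) (H H' : WeylSpace K n →ₗ[K] M) :
    weylShift c (H + H') = weylShift c H + weylShift c H' := by
  refine LinearMap.ext fun a => ?_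
  simp only [weylShift_apply, LinearMap.add_comp, polyShift_add, LinearMap.add_apply,
    Finset.sum_add_distrib]
  abel

theorem weylShift_weylShift (c c' : K) (H : WeylSpace K n →ₗ[K] M) :
    weylShift c (weylShift c' H) = weylShift (c + c') H := by
  have h1 : weylShift c' H ∘ₗ inFun K n = polyShift c' (H ∘ₗ inFun K n) := by
    refine LinearMap.ext fun f => ?_
    simp [weylShift_apply, inFun_apply]
  have h2 : ∀ i, weylShift c' H ∘ₗ inForm K i = polyShift c' (H ∘ₗ inForm K i) := fun i => by
    refine LinearMap.ext fun f => ?_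
    simp only [LinearMap.comp_apply, weylShift_apply, inForm_apply, map_zero, zero_add]
    rw [Finset.sum_eq_single i]
    · simp
    · intro j _ hj
      rw [Pi.single_eq_of_ne hj, map_zero]
    · simp
  refine LinearMap.ext fun a => ?_
  rw [weylShift_apply, weylShift_apply, h1, polyShift_polyShift]
  simp only [h2, polyShift_polyShift]

theorem weylShift_zero (H : WeylSpace K n →ₗ[K] M) : weylShift 0 H = H := by
  refine LinearMap.ext fun a => ?_
  rw [weylShift_apply]
  simp only [polyShift_zero, LinearMap.comp_apply, ← map_sum, ← map_add, inFun_add_sum_inForm]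

theorem weylShift_scale (c t : K) (H : WeylSpace K n →ₗ[K] M) (a) :
    weylShift c H (scale t a) = weylShift c (H ∘ₗ scale t) a := by
  have h1 : (H ∘ₗ scale t) ∘ₗ inFun K n = t • (H ∘ₗ inFun K n) := by
    refine LinearMap.ext fun f => ?_
    rw [LinearMap.smul_apply, LinearMap.comp_apply, LinearMap.comp_apply, LinearMap.comp_apply,
      ← map_smul]
    congr 1
    ext1 <;> simp [scale_apply, inFun_apply]
  have h2 : ∀ i, (H ∘ₗ scale t) ∘ₗ inForm K i =
      H ∘ₗ inForm K i := fun i => by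
    refine LinearMap.ext fun f => ?_
    simp [scale_apply, inForm_apply]
  have h3 : ∀ (H' : MvPolynomial (Fin n) K →ₗ[K] M) f,
      polyShift c (t • H') f = t • polyShift c H' f := fun H' f => by
    rw [polyShift_apply, polyShift_apply, extendCoeff_eq_sum _ _ subset_rfl,
      extendCoeff_eq_sum _ _ subset_rfl, Finset.smul_sum]
    refine Finset.sum_congr rfl fun α _ => ?_
    rw [LinearMap.smul_apply, ← algebraMap_smul (MvPolynomial (Fin n) K) t (H' _), smul_smul,
      mul_comm, ← smul_smul, algebraMap_smul]
  rw [weylShift_apply, weylShift_apply, h1, h3]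
  simp only [h2, scale_apply, map_smul]

theorem weylShift_barParity (c : K) (H : WeylSpace K n →ₗ[K] M) (a) :
    weylShift c H (barParity a) = weylShift c (H ∘ₗ barParity) a := by
  have h : (barParity : WeylSpace K n →ₗ[K] WeylSpace K n) = scale (-1) :=
    LinearMap.ext fun a => (scale_neg_one a).symm
  rw [h, weylShift_scale]

/-- `d` differentiates in `y`, and `c x` is a mere parameter there, so translation and derivative
commute (`polyShift_pderiv`). -/
theorem weylShift_diff (c : K) (H : WeylSpace K n →ₗ[K] M) (a) :
    weylShift c H (diff a) = weylShift c (H ∘ₗ diff) a := by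
  have h1 : (H ∘ₗ diff) ∘ₗ inFun K n =
      ∑ i, (H ∘ₗ inForm K i) ∘ₗ
        (MvPolynomial.pderiv i).toLinearMap := by
    refine LinearMap.ext fun f => ?_
    simp only [LinearMap.sum_apply, LinearMap.comp_apply, ← map_sum, Derivation.coeFn_coe]
    rw [sum_inForm (fun i => MvPolynomial.pderiv i f)]
    rfl
  have h2 : ∀ i, (H ∘ₗ diff) ∘ₗ inForm K i = 0 := fun i => by
    refine LinearMap.ext fun f => ?_
    rw [LinearMap.comp_apply, LinearMap.comp_apply, inForm_apply, diff_apply,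
      show ((0 : MvPolynomial (Fin n) K), grad (0 : MvPolynomial (Fin n) K)) = 0 by
        ext1
        · rfl
        · funext j; simp [grad], map_zero]
    rfl
  have h3 : ∀ (s : Finset (Fin n)) (G : Fin n → MvPolynomial (Fin n) K →ₗ[K] M),
      polyShift c (∑ i ∈ s, G i) = ∑ i ∈ s, polyShift c (G i) := fun s G =>
    map_sum (AddMonoidHom.mk' (polyShift c) (polyShift_add c)) G s
  have h4 : polyShift c (0 : MvPolynomial (Fin n) K →ₗ[K] M) = 0 :=
    (AddMonoidHom.mk' (polyShift c) (polyShift_add c)).map_zero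
  rw [weylShift_apply, weylShift_apply, h1, h3]
  simp only [h2, h4, diff_apply, map_zero, zero_add, LinearMap.zero_apply,
    Finset.sum_const_zero, add_zero, LinearMap.sum_apply, ← polyShift_pderiv]
  rfl

theorem weylShift_unit (c : K) (H : WeylSpace K n →ₗ[K] M) :
    weylShift c H unit = H unit := by
  rw [weylShift_apply]
  simp [unit, polyShift_apply, extendCoeff_C, inFun_apply]

end Shift

/-! ### Passage between operators and symbols, and the conjugated homotopy. -/

section ListShift

set_option linter.unusedSectionVars false

variable {K : Type*} [Field K] {n : ℕ} {M : Type*} [AddCommGroup M] [Module K M]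
  [Module (MvPolynomial (Fin n) K) M] [IsScalarTower K (MvPolynomial (Fin n) K) M]

/-- The component `a_0` or `a_i` of `a`. -/
def slotComp : Option (Fin n) → WeylSpace K n → MvPolynomial (Fin n) K
  | none, a => a.1
  | some i, a => a.2 i

/-- The elements `x^α / α!` and `(x^α / α!) ξ^i`. -/
def slotVec : Slot n → WeylSpace K n
  | (α, none) => inFun K n (MvPolynomial.monomial α (multiFactorial α : K)⁻¹)
  | (α, some i) => inForm K i (MvPolynomial.monomial α (multiFactorial α : K)⁻¹)

/-- The exponents which occur in `a (y + c x)`. -/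
def shiftSupport (c : K) (a : WeylSpace K n) : Finset (Fin n →₀ ℕ) :=
  Finset.univ.biUnion fun o : Option (Fin n) => (translate c (slotComp o a)).support

theorem support_subset_shiftSupport (c : K) (a : WeylSpace K n) (o : Option (Fin n)) :
    (translate c (slotComp o a)).support ⊆ shiftSupport c a :=
  Finset.subset_biUnion_of_mem (fun o => (translate c (slotComp o a)).support)
    (Finset.mem_univ o)

/-- The coordinates of `a (y + c x)`, with coefficients in the polynomials in `x`, with respect to
`slotVec`. -/
def coords (c : K) (a : WeylSpace K n) : Slot n →₀ MvPolynomial (Fin n) K :=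
  Finsupp.onFinset (shiftSupport c a ×ˢ Finset.univ)
    (fun s => (multiFactorial s.1 : K) • MvPolynomial.coeff s.1 (translate c (slotComp s.2 a)))
    (fun s hs => by
      rw [Finset.mem_product]
      refine ⟨support_subset_shiftSupport c a s.2 ?_, Finset.mem_univ _⟩
      rw [MvPolynomial.mem_support_iff]
      intro h
      exact hs (by rw [h, smul_zero]))

theorem coords_apply (c : K) (a : WeylSpace K n) (s : Slot n) :
    coords c a s =
      (multiFactorial s.1 : K) • MvPolynomial.coeff s.1 (translate c (slotComp s.2 a)) := rfl

/-- Taylor's formula identifies the coordinates of `a (y + x)` with the operators `σ`; this is why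
`shift 1` is the map `Σ` (see `isOperatorOf_symb`). -/
theorem coords_one_apply (a : WeylSpace K n) (s : Slot n) : coords (1 : K) a s = sigma s a := by
  rw [coords_apply, coeff_translate_one]
  obtain ⟨α, o⟩ := s
  cases o <;> rfl

/-- Expansion of `a (y + c x)` in powers of `y`; the factors `α!` in `coords` and `1/α!` in
`slotVec` cancel. -/
theorem coords_sum [CharZero K] (c : K) (a : WeylSpace K n) (H : WeylSpace K n →ₗ[K] M) :
    ((coords c a).sum fun s r => r • H (slotVec s)) = weylShift c H a := by
  have h0 : ∀ (α : Fin n →₀ ℕ) (p : MvPolynomial (Fin n) K) (G : MvPolynomial (Fin n) K →ₗ[K] M),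
      ((multiFactorial α : K) • p) • G (MvPolynomial.monomial α (multiFactorial α : K)⁻¹) =
        p • G (MvPolynomial.monomial α 1) := by
    intro α p G
    have h : (MvPolynomial.monomial α (multiFactorial α : K)⁻¹ : MvPolynomial (Fin n) K) =
        (multiFactorial α : K)⁻¹ • MvPolynomial.monomial α 1 := by
      rw [MvPolynomial.smul_monomial, smul_eq_mul, mul_one]
    rw [h, map_smul, ← algebraMap_smul (MvPolynomial (Fin n) K) (multiFactorial α : K)⁻¹,
      smul_smul, smul_mul_assoc, mul_comm p, ← smul_mul_assoc, Algebra.smul_def, ← map_mul,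
      mul_inv_cancel₀ (multiFactorial_ne_zero α), map_one, one_mul]
  have h1 : ∀ (o : Option (Fin n)) (G : MvPolynomial (Fin n) K →ₗ[K] M),
      polyShift c G (slotComp o a) = ∑ α ∈ shiftSupport c a,
        MvPolynomial.coeff α (translate c (slotComp o a)) • G (MvPolynomial.monomial α 1) :=
    fun o G => extendCoeff_eq_sum G _ (support_subset_shiftSupport c a o)
  have h5 : ((coords c a).sum fun s r => r • H (slotVec s)) =
      ∑ s ∈ shiftSupport c a ×ˢ Finset.univ, coords c a s • H (slotVec s) :=
    Finsupp.sum_of_support_subset _ Finsupp.support_onFinset_subset _ fun s _ => zero_smul _ _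
  simp only [coords_apply] at h5
  rw [h5, Finset.sum_product_right, Fintype.sum_option, weylShift_apply]
  have h2 := h1 none (H ∘ₗ inFun K n)
  have h3 := fun i => h1 (some i) (H ∘ₗ inForm K i)
  simp only [slotComp] at h2 h3
  rw [h2]
  simp only [h3]
  congr 1
  · exact Finset.sum_congr rfl fun α _ => h0 α _ (H ∘ₗ inFun K n)
  · exact Finset.sum_congr rfl fun i _ => Finset.sum_congr rfl fun α _ => h0 α _ (H ∘ₗ inForm K i)

/-- `(shift c F)(L)`, the value of `F` on the words `L (y + c x)` in the variable `y`. -/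
def shiftAt (c : K) : List (WeylSpace K n) →
    (List (WeylSpace K n) → WeylSpace K n) →ₗ[MvPolynomial (Fin n) K] WeylSpace K n
  | [] => LinearMap.proj []
  | a :: L => (coords c a).sum fun s r => r • (shiftAt c L ∘ₗ
      LinearMap.funLeft (MvPolynomial (Fin n) K) (WeylSpace K n) (List.cons (slotVec s)))

/-- The operator whose symbol is `F`, for `c = 1`; the symbol of the operator `F`, for `c = -1`. -/
def shift (c : K) : (List (WeylSpace K n) → WeylSpace K n) →ₗ[MvPolynomial (Fin n) K]
    (List (WeylSpace K n) → WeylSpace K n) := LinearMap.pi (shiftAt c)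

@[simp] theorem shift_nil (c : K) (F : List (WeylSpace K n) → WeylSpace K n) :
    shift c F [] = F [] := rfl

theorem shift_cons_eq_sum (c : K) (F : List (WeylSpace K n) → WeylSpace K n) (a : WeylSpace K n)
    (L) : shift c F (a :: L) =
      (coords c a).sum fun s r => r • shift c (tailFun (slotVec s) F) L := by
  change shiftAt c (a :: L) F = _
  rw [shiftAt, Finsupp.sum, LinearMap.sum_apply]
  rfl

/-- `x ↦ shift c F_x (L)` as a linear map. -/
def shiftTail (c : K) {F : List (WeylSpace K n) → WeylSpace K n} (hF : Multi K F)
    (L : List (WeylSpace K n)) : WeylSpace K n →ₗ[K] WeylSpace K n :=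
  (shiftAt c L).restrictScalars K ∘ₗ hF.tailLin

theorem shiftTail_apply (c : K) {F : List (WeylSpace K n) → WeylSpace K n} (hF : Multi K F)
    (L : List (WeylSpace K n)) (x) : shiftTail c hF L x = shift c (tailFun x F) L := rfl

theorem shift_cons [CharZero K] (c : K) {F : List (WeylSpace K n) → WeylSpace K n}
    (hF : Multi K F) (a : WeylSpace K n) (L) :
    shift c F (a :: L) = weylShift c (shiftTail c hF L) a := by
  rw [shift_cons_eq_sum, ← coords_sum]
  rfl

theorem tailFun_shift (c : K) (F : List (WeylSpace K n) → WeylSpace K n) (a : WeylSpace K n) :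
    tailFun a (shift c F) = ∑ s ∈ (coords c a).support,
      coords c a s • shift c (tailFun (slotVec s) F) := by
  funext L
  rw [tailFun_apply, shift_cons_eq_sum, Finset.sum_apply]
  rfl

theorem Multi.shift [CharZero K] {F : List (WeylSpace K n) → WeylSpace K n}
    (hF : Multi K F) (c : K) : Multi K (shift c F) := by
  intro L₁
  induction L₁ generalizing F with
  | nil =>
    intro L₂
    simp only [List.nil_append, shift_cons c hF]
    exact LinearMap.isLinear _
  | cons a L₁ ih =>
    intro L₂
    simp only [List.cons_append, shift_cons_eq_sum]
    refine ⟨fun x y => ?_, fun t x => ?_⟩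
    · rw [Finsupp.sum, Finsupp.sum, Finsupp.sum, ← Finset.sum_add_distrib]
      refine Finset.sum_congr rfl fun s _ => ?_
      rw [(ih (hF.tailFun (slotVec s)) L₂).map_add, smul_add]
    · rw [Finsupp.sum, Finsupp.sum, Finset.smul_sum]
      refine Finset.sum_congr rfl fun s _ => ?_
      rw [(ih (hF.tailFun (slotVec s)) L₂).map_smul, smul_comm]

theorem shift_eq_zero {c : K} {F : List (WeylSpace K n) → WeylSpace K n} {L}
    (h : ∀ M, M.length = L.length → F M = 0) : shift c F L = 0 := by
  induction L generalizing F with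
  | nil => exact h [] rfl
  | cons a L ih =>
    rw [shift_cons_eq_sum]
    refine Finset.sum_eq_zero fun s _ => ?_
    dsimp only
    rw [ih, smul_zero]
    intro M hM
    exact h _ (by simp [hM])

theorem postcomp_shift (c : K) (T : WeylSpace K n →ₗ[MvPolynomial (Fin n) K] WeylSpace K n)
    (F : List (WeylSpace K n) → WeylSpace K n) (L) :
    T (shift c F L) = shift c (fun M => T (F M)) L := by
  induction L generalizing F with
  | nil => rfl
  | cons a L ih =>
    rw [shift_cons_eq_sum, shift_cons_eq_sum, Finsupp.sum, Finsupp.sum, map_sum]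
    refine Finset.sum_congr rfl fun s _ => ?_
    rw [map_smul, ih]
    rfl

/-- Translations compose additively in each argument. Together with `shift_zero` this makes `shift
(-1)`, the symbol map, inverse to `shift 1`. -/
theorem shift_shift [CharZero K] (c c' : K) {F : List (WeylSpace K n) → WeylSpace K n}
    (hF : Multi K F) : shift c (shift c' F) = shift (c + c') F := by
  funext L
  induction L generalizing F with
  | nil => rfl
  | cons a L ih =>
    rw [shift_cons c (hF.shift c'), shift_cons (c + c') hF, ← weylShift_weylShift]
    refine congrArg (fun H => weylShift c H a) (LinearMap.ext fun x => ?_)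
    rw [shiftTail_apply, tailFun_shift, map_sum, Finset.sum_apply, ← coords_sum]
    refine Finset.sum_congr rfl fun s _ => ?_
    rw [map_smul, Pi.smul_apply, ih (hF.tailFun _)]
    rfl

theorem shift_zero [CharZero K] {F : List (WeylSpace K n) → WeylSpace K n}
    (hF : Multi K F) : shift (0 : K) F = F := by
  funext L
  induction L generalizing F with
  | nil => rfl
  | cons a L ih =>
    rw [shift_cons 0 hF, weylShift_zero, shiftTail_apply, ih (hF.tailFun _), tailFun_apply]

theorem delta_polySmul (r : MvPolynomial (Fin n) K) (F : List (WeylSpace K n) → WeylSpace K n) (L) :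
    delta (r • F) L = r • delta F L :=
  (postcomp_delta (LinearMap.lsmul (MvPolynomial (Fin n) K) (WeylSpace K n) r
    |>.restrictScalars K) F L).symm

/-- Translation commutes with `d` in every argument, so an operator and its symbol have the same
`δ`. -/
theorem delta_shift [CharZero K] (c : K) {F : List (WeylSpace K n) → WeylSpace K n}
    (hF : Multi K F) : delta (shift c F) = shift c (delta F) := by
  funext L
  induction L generalizing F with
  | nil => rfl
  | cons a L ih =>
    have h1 : delta (tailFun (barParity a) (shift c F)) L =
        weylShift c (shiftTail c hF.delta L - shiftTail c hF L ∘ₗ diff) a := by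
      rw [tailFun_shift, map_sum, Finset.sum_apply]
      -- Subtracting the term with `d` on the first letter leaves the action of `delta` on the tail,
      -- written as a linear function of the first letter so that `coords_sum` applies.
      have h2 : shiftTail c hF.delta L - shiftTail c hF L ∘ₗ diff =
          ((shiftAt c L).restrictScalars K ∘ₗ delta ∘ₗ hF.tailLin) ∘ₗ barParity := by
        refine LinearMap.ext fun x => ?_
        rw [LinearMap.sub_apply, LinearMap.comp_apply, shiftTail_apply, shiftTail_apply,
          show tailFun x (delta F) = tailFun (diff x) F + delta (tailFun (barParity x) F) from rfl,
          map_add, Pi.add_apply, add_sub_cancel_left]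
        rfl
      rw [h2, ← weylShift_barParity, ← coords_sum]
      refine Finset.sum_congr rfl fun s _ => ?_
      rw [delta_polySmul, ih (hF.tailFun _)]
      rfl
    rw [delta_cons, h1, shift_cons c hF, weylShift_diff, shift_cons c hF.delta,
      ← LinearMap.add_apply, ← weylShift_add, add_sub_cancel]

theorem scaleArgs_shift [CharZero K] (c t : K) {F : List (WeylSpace K n) → WeylSpace K n}
    (hF : Multi K F) : scaleArgs t (shift c F) = shift c (scaleArgs t F) := by
  funext L
  induction L generalizing F with
  | nil => rfl
  | cons a L ih =>
    have h1 : ∀ x, scaleArgs t (tailFun x (shift c F)) L =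
        weylShift c ((shiftAt c L).restrictScalars K ∘ₗ scaleArgs t ∘ₗ hF.tailLin) x := by
      intro x
      rw [tailFun_shift, map_sum, Finset.sum_apply, ← coords_sum]
      refine Finset.sum_congr rfl fun s _ => ?_
      rw [show scaleArgs t (coords c x s • shift c (tailFun (slotVec s) F)) =
        coords c x s • scaleArgs t (shift c (tailFun (slotVec s) F)) from rfl, Pi.smul_apply,
        ih (hF.tailFun _)]
      rfl
    change scaleArgs t (tailFun (scale t a) (shift c F)) L = _
    rw [h1, weylShift_scale,
      shift_cons c (hF.scaleArgs t)]
    rfl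

/-- Translations fix the unit. -/
theorem UnitFree.shift [CharZero K] {F : List (WeylSpace K n) → WeylSpace K n} (hF : UnitFree F)
    (hm : Multi K F) (c : K) : UnitFree (shift c F) := by
  intro L₁
  induction L₁ generalizing F with
  | nil =>
    intro L₂
    rw [List.nil_append, shift_cons c hm, weylShift_unit, shiftTail_apply,
      show SeibergWitten.tailFun unit F = 0 from funext fun L => hF [] L]
    simp
  | cons a L₁ ih =>
    intro L₂
    rw [List.cons_append, shift_cons_eq_sum]
    refine Finset.sum_eq_zero fun s _ => ?_
    dsimp only
    rw [ih (hF.tailFun _) (hm.tailFun _), smul_zero]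

/-- The homotopy operator on sequences of polydifferential operators. -/
def opHtpy (F : List (WeylSpace K n) → WeylSpace K n) : List (WeylSpace K n) → WeylSpace K n :=
  shift 1 (htpy (shift (-1) F))

theorem Multi.opHtpy [CharZero K] {F : List (WeylSpace K n) → WeylSpace K n} (hF : Multi K F) :
    Multi K (opHtpy F) := (hF.shift (-1)).htpy.shift 1

theorem UnitFree.opHtpy [CharZero K] {F : List (WeylSpace K n) → WeylSpace K n}
    (hF : UnitFree F) (hm : Multi K F) : UnitFree (opHtpy F) :=
  ((hF.shift hm (-1)).htpy (hm.shift (-1))).shift (hm.shift (-1)).htpy 1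

theorem opHtpy_eq_zero {F : List (WeylSpace K n) → WeylSpace K n} {L}
    (h : ∀ M, M.length = L.length → F M = 0) : opHtpy F L = 0 :=
  shift_eq_zero fun _ hM => htpy_eq_zero fun _ hM' => shift_eq_zero fun _ hM'' =>
    h _ (by omega)

theorem opHtpy_sub (F G : List (WeylSpace K n) → WeylSpace K n) :
    opHtpy (F - G) = opHtpy F - opHtpy G := by
  simp only [opHtpy, map_sub]

theorem scaleArgs_opHtpy [CharZero K] {F : List (WeylSpace K n) → WeylSpace K n} (hF : Multi K F)
    {t : K} (ht : t ≠ 0) {c : K} (h : scaleArgs t F = (t * c) • F) :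
    scaleArgs t (opHtpy F) = c • opHtpy F := by
  have h1 : ∀ (r : K) (G : List (WeylSpace K n) → WeylSpace K n) (b : K),
      shift b (r • G) = r • shift b G := fun r G b =>
    ((shift b).restrictScalars K).map_smul r G
  have h2 : t • scaleArgs t (htpy (shift (-1) F)) = (t * c) • htpy (shift (-1) F) := by
    rw [← htpy_scaleArgs (hF.shift _), scaleArgs_shift _ _ hF, h, h1, map_smul]
  have h3 : scaleArgs t (htpy (shift (-1) F)) = c • htpy (shift (-1) F) := by
    rw [mul_smul] at h2
    exact smul_right_injective _ ht h2
  rw [opHtpy, scaleArgs_shift _ _ (hF.shift _).htpy, h3, h1]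

/-- Linearity over the polynomials matters: `shift` multiplies values by polynomials in `x`, so a
map which is only `K`-linear, such as `d`, need not pass through. -/
theorem postcomp_opHtpy (T : WeylSpace K n →ₗ[MvPolynomial (Fin n) K] WeylSpace K n)
    (F : List (WeylSpace K n) → WeylSpace K n) (L) :
    T (opHtpy F L) = opHtpy (fun M => T (F M)) L := by
  rw [opHtpy, postcomp_shift, opHtpy]
  refine congrFun (congrArg (shift 1) ?_) L
  have h : (fun M => T (shift (-1) F M)) = shift (-1) fun M => T (F M) :=
    funext fun M => postcomp_shift (-1) T F M
  rw [← h]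
  exact funext fun M => postcomp_htpy (T.restrictScalars K) (shift (-1) F) M

/-- `h` solves `δ f = F` for normal cocycles `F` which need an argument of degree zero. -/
theorem delta_opHtpy [CharZero K] {F : List (WeylSpace K n) → WeylSpace K n} (hF : Multi K F)
    (hd : delta F = 0) (hu : UnitFree F) (h0 : scaleArgs (0 : K) F = 0) :
    delta (opHtpy F) = F := by
  -- In the homotopy formula for the symbol, `h δ` vanishes by closedness, and the term with `π` in
  -- all arguments vanishes by normality together with `h0`.
  have h1 : delta (htpy (shift (-1) F)) = shift (-1) F := by
    funext L
    have h := delta_htpy (hF.shift (-1)) L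
    rw [delta_shift _ hF, hd, map_zero, map_zero, Pi.zero_apply, add_zero,
      (hu.shift hF (-1)).map_poincareProj (hF.shift (-1)), scaleArgs_shift _ _ hF, h0, map_zero,
      Pi.zero_apply, sub_zero] at h
    exact h
  rw [opHtpy, delta_shift _ (hF.shift _).htpy, h1, shift_shift _ _ hF, add_neg_cancel,
    shift_zero hF]

end ListShift

/-! ### Components of values, the obstruction `Ψ`, and its normality. -/

section Construction

set_option linter.unusedSectionVars false

variable {K : Type*} [Field K] {n : ℕ} {X : Type*} [AddCommGroup X] [Module K X]

/-! ### The recurrence -/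

variable (K n) in
/-- The projection to the component of degree zero. -/
def funPart : WeylSpace K n →ₗ[MvPolynomial (Fin n) K] WeylSpace K n :=
  LinearMap.inl _ _ _ ∘ₗ LinearMap.fst _ _ _

variable (K n) in
/-- The projection to the component of degree one. -/
def formPart : WeylSpace K n →ₗ[MvPolynomial (Fin n) K] WeylSpace K n :=
  LinearMap.inr _ _ _ ∘ₗ LinearMap.snd _ _ _

theorem funPart_apply (a : WeylSpace K n) : funPart K n a = (a.1, 0) := rfl

theorem formPart_apply (a : WeylSpace K n) : formPart K n a = (0, a.2) := rfl

theorem funPart_add_formPart (a : WeylSpace K n) : funPart K n a + formPart K n a = a := by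
  ext1 <;> simp [funPart_apply, formPart_apply]

@[simp] theorem funPart_funPart (a : WeylSpace K n) :
    funPart K n (funPart K n a) = funPart K n a := rfl

@[simp] theorem formPart_formPart (a : WeylSpace K n) :
    formPart K n (formPart K n a) = formPart K n a := rfl

@[simp] theorem formPart_funPart (a : WeylSpace K n) : formPart K n (funPart K n a) = 0 := rfl

@[simp] theorem funPart_formPart (a : WeylSpace K n) : funPart K n (formPart K n a) = 0 := rfl

@[simp] theorem funPart_diff (a : WeylSpace K n) : funPart K n (diff a) = 0 := rfl

@[simp] theorem formPart_diff (a : WeylSpace K n) : formPart K n (diff a) = diff a := rfl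

@[simp] theorem diff_funPart (a : WeylSpace K n) : diff (funPart K n a) = diff a := rfl

@[simp] theorem diff_formPart (a : WeylSpace K n) : diff (formPart K n a) = 0 := by
  simp [diff_apply, formPart_apply, Prod.ext_iff, funext_iff, grad]

theorem funPart_scale (t : K) (a : WeylSpace K n) :
    funPart K n (scale t a) = t • funPart K n a := by
  simp [funPart_apply, scale_apply]

theorem formPart_scale (t : K) (a : WeylSpace K n) :
    formPart K n (scale t a) = formPart K n a := rfl

theorem scale_funPart (t : K) (a : WeylSpace K n) :
    scale t (funPart K n a) = t • funPart K n a := by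
  simp [funPart_apply, scale_apply]

theorem scale_formPart (t : K) (a : WeylSpace K n) :
    scale t (formPart K n a) = formPart K n a := by
  simp [formPart_apply, scale_apply]

theorem Multi.funPart {F : List (WeylSpace K n) → WeylSpace K n} (hF : Multi K F) :
    Multi K fun L => funPart K n (F L) :=
  hF.postcomp ((SeibergWitten.funPart K n).restrictScalars K)

theorem Multi.formPart {F : List (WeylSpace K n) → WeylSpace K n} (hF : Multi K F) :
    Multi K fun L => formPart K n (F L) :=
  hF.postcomp ((SeibergWitten.formPart K n).restrictScalars K)

variable (K) in
/-- Restriction of functions to words of length `N`. -/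
def lengthPart {V : Type*} (N : ℕ) : (List V → X) →ₗ[K] (List V → X) where
  toFun F L := if L.length = N then F L else 0
  map_add' F G := by
    funext L
    by_cases h : L.length = N <;> simp [h]
  map_smul' c F := by
    funext L
    by_cases h : L.length = N <;> simp [h]

theorem lengthPart_apply {V : Type*} (N : ℕ) (F : List V → X) (L : List V) :
    lengthPart K N F L = if L.length = N then F L else 0 := rfl

theorem lengthPart_of_eq {V : Type*} {N : ℕ} (F : List V → X) {L : List V} (h : L.length = N) :
    lengthPart K N F L = F L := if_pos h

theorem lengthPart_of_ne {V : Type*} {N : ℕ} (F : List V → X) {L : List V} (h : L.length ≠ N) :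
    lengthPart K N F L = 0 := if_neg h

theorem Multi.lengthPart {V : Type*} [AddCommGroup V] [Module K V] {F : List V → X}
    (hF : Multi K F) (N : ℕ) : Multi K (lengthPart K N F) := by
  intro L₁ L₂
  by_cases h : L₁.length + (L₂.length + 1) = N
  · simpa [lengthPart_apply, h] using hF L₁ L₂
  · simpa [lengthPart_apply, h] using isLinearMap_zero

theorem delta_congr {F G : List (WeylSpace K n) → X} {L}
    (h : ∀ M, M.length = L.length → F M = G M) : delta F L = delta G L := by
  rw [← sub_eq_zero, ← Pi.sub_apply, ← map_sub]
  exact delta_eq_zero fun M hM => sub_eq_zero.mpr (h M hM)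

theorem opHtpy_congr {F G : List (WeylSpace K n) → WeylSpace K n} {L}
    (h : ∀ M, M.length = L.length → F M = G M) : opHtpy F L = opHtpy G L := by
  rw [← sub_eq_zero, ← Pi.sub_apply, ← opHtpy_sub]
  exact opHtpy_eq_zero fun M hM => sub_eq_zero.mpr (h M hM)

theorem delta_lengthPart (N : ℕ) (F : List (WeylSpace K n) → X) :
    delta (lengthPart K N F) = lengthPart K N (delta F) := by
  funext L
  by_cases h : L.length = N
  · rw [lengthPart_of_eq _ h]
    exact delta_congr fun M hM => lengthPart_of_eq _ (hM.trans h)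
  · rw [lengthPart_of_ne _ h]
    exact delta_eq_zero fun M hM => lengthPart_of_ne _ (by omega)

/-- The obstruction `Ψ` to multiplicativity. -/
def psi (θ θ' : Matrix (Fin n) (Fin n) K) (f : List (WeylSpace K n) → WeylSpace K n) :
    List (WeylSpace K n) → WeylSpace K n :=
  mulCoder θ f - cup θ' (scaleArgs (-1) f) f

theorem Multi.psi {f : List (WeylSpace K n) → WeylSpace K n} (hf : Multi K f)
    (θ θ' : Matrix (Fin n) (Fin n) K) : Multi K (psi θ θ' f) :=
  (hf.mulCoder θ).sub ((hf.scaleArgs (-1)).cup hf θ')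

theorem defect_eq_psi (θ θ' : Matrix (Fin n) (Fin n) K)
    (f : List (WeylSpace K n) → WeylSpace K n) (L) :
    defect θ θ' f L = delta f L - diff (f L) + psi θ θ' f L := by
  simp only [defect, psi, Pi.sub_apply, bar_apply]
  abel

/-- `Ψ` on words of length `N` depends on the components of smaller arity only. -/
theorem psi_add {θ θ' : Matrix (Fin n) (Fin n) K} {f φ : List (WeylSpace K n) → WeylSpace K n}
    {L} (hf : f [] = 0) (hφ : ∀ M, M.length < L.length → φ M = 0) (h0 : φ [] = 0) :
    psi θ θ' (f + φ) L = psi θ θ' f L := by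
  have h1 : ∀ M : List (WeylSpace K n), M.length < L.length → scaleArgs (-1 : K) φ M = 0 :=
    fun M hM => hφ _ (by simpa using hM)
  have h2 : scaleArgs (-1 : K) f [] = 0 := hf
  have h3 : scaleArgs (-1 : K) φ [] = 0 := h0
  have h4 : mulCoder θ φ L = 0 := mulCoder_eq_zero fun M hM => hφ M (by omega)
  simp only [psi, map_add, Pi.sub_apply, Pi.add_apply, cup_add_left, cup_add_right,
    cup_eq_zero_of_left hf h1, cup_eq_zero_of_left h0 h1, cup_eq_zero_of_right h2 hφ,
    h4, add_zero]

theorem psi_congr {θ θ' : Matrix (Fin n) (Fin n) K} {f g : List (WeylSpace K n) → WeylSpace K n}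
    {L} (hf : f [] = 0) (hg : g [] = 0) (h : ∀ M, M.length < L.length → f M = g M) :
    psi θ θ' f L = psi θ θ' g L := by
  have h1 := psi_add (θ := θ) (θ' := θ') (f := g) (φ := f - g) (L := L) hg
    (fun M hM => sub_eq_zero.mpr (h M hM)) (by simp [hf, hg])
  rwa [add_sub_cancel] at h1

/-- `Ψ` has bar degree one, hence the extra factor `t`. -/
theorem scaleArgs_psi (θ θ' : Matrix (Fin n) (Fin n) K)
    {f : List (WeylSpace K n) → WeylSpace K n} (hf : Multi K f) (he : ScaleEquivariant f)
    {t : K} (ht : t ≠ 0) : scaleArgs t (psi θ θ' f) = fun L => t • scale t (psi θ θ' f L) := by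
  funext L
  rw [psi, map_sub, scaleArgs_mulCoder hf, scaleArgs_cup, scaleArgs_scaleArgs, mul_comm,
    ← scaleArgs_scaleArgs, he t ht, Pi.sub_apply, Pi.smul_apply, ← postcomp_mulCoder]
  have h1 : scaleArgs (-1 : K) (fun L => scale t (f L)) = fun L => scale t (scaleArgs (-1) f L) :=
    rfl
  rw [h1]
  have h2 : cup θ' (fun L => scale t (scaleArgs (-1) f L)) (fun L => scale t (f L)) L =
      t • scale t (cup θ' (scaleArgs (-1) f) f L) := by
    rw [← LinearMap.smul_apply, cup, cup, postcomp_conv, conv_postcomp (scale t)]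
    exact conv_congr fun L₁ L₂ _ => starMul_scale _ _ _ _
  rw [h2, Pi.sub_apply, map_sub, smul_sub]

/-- A perturbation that starts in the current arity enters the defect there only linearly: `Ψ`
depends on smaller arities. -/
theorem defect_add {θ θ' : Matrix (Fin n) (Fin n) K} {f φ : List (WeylSpace K n) → WeylSpace K n}
    {L} (hf : f [] = 0) (hφ : ∀ M, M.length < L.length → φ M = 0) (h0 : φ [] = 0) :
    defect θ θ' (f + φ) L = defect θ θ' f L + delta φ L - diff (φ L) := by
  rw [defect_eq_psi, defect_eq_psi, psi_add hf hφ h0, map_add, Pi.add_apply, Pi.add_apply, map_add]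
  abel

/-! ### Normality -/

/-- If the unit comes first, only its product with the next letter survives. With the unit last
(`mulCoder_append_unit`) only the product with the preceding letter survives, and in an inner
position (`mulCoder_append_unit_cons`) the products with the two neighbours cancel. -/
theorem mulCoder_unit_cons {ν : List (WeylSpace K n) → X} (hν : UnitFree ν) (hm : Multi K ν)
    (θ : Matrix (Fin n) (Fin n) K) (c : WeylSpace K n) (L) :
    mulCoder θ ν (unit :: c :: L) = -ν (c :: L) := by
  rw [mulCoder_cons, barParity_unit, hm.tailFun_neg,
    show tailFun unit ν = 0 from funext fun L => hν [] L]
  simp [(hm.cons L).map_neg]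

theorem mulCoder_append_unit {ν : List (WeylSpace K n) → X} (hν : UnitFree ν) (hm : Multi K ν)
    (θ : Matrix (Fin n) (Fin n) K) (a : WeylSpace K n) (L) :
    mulCoder θ ν (a :: (L ++ [unit])) = scaleArgs (-1 : K) ν (a :: L) := by
  induction L generalizing a ν with
  | nil =>
    rw [scaleArgs_apply, List.map_cons, scale_neg_one, List.nil_append, mulCoder_cons,
      mulCoder_cons]
    simp
  | cons b L ih =>
    rw [List.cons_append, mulCoder_cons, ih (hν.tailFun _) (hm.tailFun _), contr_cons,
      show ν (_ :: (L ++ [unit])) = 0 from hν (_ :: L) [], zero_add, scaleArgs_apply,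
      scaleArgs_apply, List.map_cons, List.map_cons, List.map_cons, scale_neg_one a]
    rfl

theorem mulCoder_append_unit_cons {ν : List (WeylSpace K n) → X} (hν : UnitFree ν)
    (hm : Multi K ν) (θ : Matrix (Fin n) (Fin n) K) (a c : WeylSpace K n) (L M) :
    mulCoder θ ν (a :: (L ++ unit :: c :: M)) = 0 := by
  induction L generalizing a ν with
  | nil =>
    rw [List.nil_append, mulCoder_cons, mulCoder_unit_cons (hν.tailFun _) (hm.tailFun _),
      contr_cons, starMul_unit_right]
    exact add_neg_cancel _
  | cons b L ih =>
    rw [List.cons_append, mulCoder_cons, ih (hν.tailFun _) (hm.tailFun _), contr_cons, add_zero]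
    exact hν (_ :: L) _

theorem cup_singleFun_left (θ : Matrix (Fin n) (Fin n) K)
    (F : List (WeylSpace K n) → WeylSpace K n) (a : WeylSpace K n) (L) :
    cup θ (scaleArgs (-1 : K) singleFun) F (a :: L) = starMul θ (barParity a) (F L) := by
  rw [cup_cons, show scaleArgs (-1 : K) (singleFun : List (WeylSpace K n) → _) [] = 0 from rfl,
    map_zero, LinearMap.zero_apply, zero_add]
  cases L with
  | nil => rw [cup_nil, tailFun_apply, scaleArgs_apply]; simp [scale_neg_one]
  | cons b L =>
    rw [cup_cons, tailFun_apply, scaleArgs_apply]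
    have h : cup θ (tailFun b (tailFun a (scaleArgs (-1 : K) singleFun))) F L = 0 :=
      conv_eq_zero fun L₁ L₂ _ => by
        rw [show tailFun b (tailFun a (scaleArgs (-1 : K) singleFun)) L₁ = 0 from rfl,
          map_zero, Pi.zero_apply]
    rw [h]
    simp [scale_neg_one]

theorem cup_singleFun_right (θ : Matrix (Fin n) (Fin n) K)
    (F : List (WeylSpace K n) → WeylSpace K n) (L) (z : WeylSpace K n) :
    cup θ F singleFun (L ++ [z]) = starMul θ (F L) z := by
  induction L generalizing F with
  | nil => simp [cup_cons]
  | cons a L ih =>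
    rw [List.cons_append, cup_cons, ih]
    cases L <;> simp

theorem unitFree_cup {F G : List (WeylSpace K n) → WeylSpace K n} (hF : UnitFree F)
    (hG : UnitFree G) (θ : Matrix (Fin n) (Fin n) K) : UnitFree (cup θ F G) := by
  intro L₁
  induction L₁ generalizing F with
  | nil =>
    intro L₂
    rw [List.nil_append, cup_cons, show tailFun unit F = 0 from funext fun L => hF [] L,
      show G (unit :: L₂) = 0 from hG [] L₂, map_zero, zero_add]
    exact conv_eq_zero fun M₁ M₂ _ => by rw [Pi.zero_apply, map_zero, Pi.zero_apply]
  | cons a L₁ ih =>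
    intro L₂
    rw [List.cons_append, cup_cons, ih (hF.tailFun a), ← List.cons_append, hG, map_zero, zero_add]

theorem UnitFree.scaleArgs_neg_one {F : List (WeylSpace K n) → X} (hF : UnitFree F)
    (hm : Multi K F) : UnitFree (scaleArgs (-1 : K) F) := by
  intro L₁ L₂
  rw [scaleArgs_apply, List.map_append, List.map_cons, scale_neg_one, barParity_unit,
    (hm _ _).map_neg, hF, neg_zero]

theorem UnitFree.lengthPart {F : List (WeylSpace K n) → X} {N : ℕ}
    (hF : ∀ L₁ L₂ : List (WeylSpace K n), L₁.length + L₂.length + 1 = N →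
      F (L₁ ++ unit :: L₂) = 0) : UnitFree (lengthPart K N F) := by
  intro L₁ L₂
  by_cases h : (L₁ ++ unit :: L₂).length = N
  · rw [lengthPart_of_eq _ h]
    exact hF _ _ (by simpa [add_assoc] using h)
  · exact lengthPart_of_ne _ h

/-- Expand `Ψ` bilinearly in `singleFun` and `ν`. The pure `singleFun` terms cancel because both
products have the same unit; the boundary terms of `mulCoder θ ν` for a unit at either end are the
cup products of `ν` with `singleFun`; the cup product of `ν` with itself is normal. -/
theorem psi_eq_zero_of_unit (θ θ' : Matrix (Fin n) (Fin n) K)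
    {ν : List (WeylSpace K n) → WeylSpace K n} (hν : UnitFree ν) (hm : Multi K ν)
    (L₁ L₂ : List (WeylSpace K n)) (h : 1 ≤ L₁.length + L₂.length) :
    psi θ θ' (singleFun + ν) (L₁ ++ unit :: L₂) = 0 := by
  have hc := unitFree_cup (hν.scaleArgs_neg_one hm) hν θ' L₁ L₂
  have e : psi θ θ' (singleFun + ν) (L₁ ++ unit :: L₂) =
      (mulCoder θ singleFun (L₁ ++ unit :: L₂) -
        cup θ' (scaleArgs (-1 : K) singleFun) singleFun (L₁ ++ unit :: L₂)) +
      (mulCoder θ ν (L₁ ++ unit :: L₂) -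
        cup θ' (scaleArgs (-1 : K) singleFun) ν (L₁ ++ unit :: L₂) -
        cup θ' (scaleArgs (-1 : K) ν) singleFun (L₁ ++ unit :: L₂)) := by
    simp only [psi, map_add, Pi.sub_apply, Pi.add_apply, cup_add_left, cup_add_right, hc]
    abel
  have h1 : mulCoder θ singleFun (L₁ ++ unit :: L₂) -
        cup θ' (scaleArgs (-1 : K) singleFun) singleFun (L₁ ++ unit :: L₂) = 0 := by
    have hz : ∀ (a b c : WeylSpace K n) (L : List (WeylSpace K n)),
        mulCoder θ singleFun (a :: b :: c :: L) = 0 := fun a b c L =>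
      mulCoder_eq_zero fun M hM => by
        match M, hM with
        | [], h => simp at h
        | [x], h => simp at h
        | x :: y :: M, _ => rfl
    match L₁, L₂, h with
    | [], [b], _ =>
      rw [List.nil_append, cup_singleFun_left, mulCoder_cons, mulCoder_cons]
      simp [barParity_unit]
    | [], b :: c :: L, _ =>
      rw [List.nil_append, cup_singleFun_left, hz]
      simp
    | [a], [], _ =>
      rw [List.singleton_append, cup_singleFun_left, mulCoder_cons, mulCoder_cons]
      simp
    | [a], c :: L, _ =>
      rw [List.singleton_append, cup_singleFun_left, hz]
      simp
    | a :: b :: M, L, _ =>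
      have : ∃ c L', M ++ unit :: L = c :: L' := by cases M <;> simp
      obtain ⟨c, L', hL⟩ := this
      rw [List.cons_append, List.cons_append, hL, cup_singleFun_left, hz]
      simp
  have h2 : mulCoder θ ν (L₁ ++ unit :: L₂) -
        cup θ' (scaleArgs (-1 : K) singleFun) ν (L₁ ++ unit :: L₂) -
        cup θ' (scaleArgs (-1 : K) ν) singleFun (L₁ ++ unit :: L₂) = 0 := by
    have hr : ∀ c L, cup θ' (scaleArgs (-1 : K) ν) singleFun (L₁ ++ unit :: c :: L) = 0 := by
      intro c L
      obtain ⟨L', z, hz⟩ : ∃ L' z, c :: L = L' ++ [z] :=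
        ⟨(c :: L).dropLast, _, (List.dropLast_append_getLast (List.cons_ne_nil c L)).symm⟩
      rw [hz, ← List.cons_append, ← List.append_assoc, cup_singleFun_right,
        hν.scaleArgs_neg_one hm, map_zero, LinearMap.zero_apply]
    match L₁, L₂, h, hr with
    | [], c :: L, _, hr =>
      rw [hr]
      rw [List.nil_append, mulCoder_unit_cons hν hm, cup_singleFun_left, barParity_unit]
      simp
    | a :: L, [], _, _ =>
      rw [cup_singleFun_right, List.cons_append, mulCoder_append_unit hν hm, cup_singleFun_left,
        hν]
      simp
    | a :: L, c :: M, _, hr =>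
      rw [hr]
      rw [List.cons_append, mulCoder_append_unit_cons hν hm, cup_singleFun_left, hν]
      simp
  rw [e, h1, h2, add_zero]

end Construction

/-! ### Solving the recurrence arity by arity. -/

section Solution

set_option linter.unusedSectionVars false

variable {K : Type*} [Field K] {n : ℕ}

/-- `f''_N`, given `Ψ`. -/
def stepFun (N : ℕ) (q : List (WeylSpace K n) → WeylSpace K n) :
    List (WeylSpace K n) → WeylSpace K n :=
  opHtpy fun L => -funPart K n (lengthPart K N q L)

/-- `f'_N`, given `Ψ`. -/
def stepForm (N : ℕ) (q : List (WeylSpace K n) → WeylSpace K n) :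
    List (WeylSpace K n) → WeylSpace K n :=
  opHtpy fun L => diff (stepFun N q L) - formPart K n (lengthPart K N q L)

/-- The first `k + 1` components of the solution of the recurrence. -/
def approx (θ θ' : Matrix (Fin n) (Fin n) K) : ℕ → List (WeylSpace K n) → WeylSpace K n
  | 0 => singleFun
  -- `k + 2` is the first arity missing from `approx θ θ' k`.
  | k + 1 => approx θ θ' k +
      (stepFun (k + 2) (psi θ θ' (approx θ θ' k)) + stepForm (k + 2) (psi θ θ' (approx θ θ' k)))

/-- The solution of the recurrence. -/
def solution (θ θ' : Matrix (Fin n) (Fin n) K) : List (WeylSpace K n) → WeylSpace K n :=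
  fun L => approx θ θ' L.length L

theorem stepFun_eq_zero {N : ℕ} (q : List (WeylSpace K n) → WeylSpace K n) {L}
    (h : L.length ≠ N) : stepFun N q L = 0 :=
  opHtpy_eq_zero fun M hM => by rw [lengthPart_of_ne _ (by omega), map_zero, neg_zero]

theorem stepForm_eq_zero {N : ℕ} (q : List (WeylSpace K n) → WeylSpace K n) {L}
    (h : L.length ≠ N) : stepForm N q L = 0 :=
  opHtpy_eq_zero fun M hM => by
    rw [lengthPart_of_ne _ (by omega), stepFun_eq_zero _ (by omega), map_zero, map_zero, sub_zero]

theorem formPart_stepFun (N : ℕ) (q : List (WeylSpace K n) → WeylSpace K n) (L) :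
    formPart K n (stepFun N q L) = 0 := by
  rw [stepFun, postcomp_opHtpy]
  exact opHtpy_eq_zero fun M _ => by rw [map_neg, formPart_funPart, neg_zero]

theorem funPart_stepForm (N : ℕ) (q : List (WeylSpace K n) → WeylSpace K n) (L) :
    funPart K n (stepForm N q L) = 0 := by
  rw [stepForm, postcomp_opHtpy]
  exact opHtpy_eq_zero fun M _ => by rw [map_sub, funPart_diff, funPart_formPart, sub_zero]

theorem funPart_stepFun (N : ℕ) (q : List (WeylSpace K n) → WeylSpace K n) (L) :
    funPart K n (stepFun N q L) = stepFun N q L := by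
  have h := funPart_add_formPart (stepFun N q L)
  rwa [formPart_stepFun, add_zero] at h

theorem formPart_stepForm (N : ℕ) (q : List (WeylSpace K n) → WeylSpace K n) (L) :
    formPart K n (stepForm N q L) = stepForm N q L := by
  have h := funPart_add_formPart (stepForm N q L)
  rwa [funPart_stepForm, zero_add] at h

section Step

variable {N : ℕ} {q : List (WeylSpace K n) → WeylSpace K n}

theorem multi_stepFun [CharZero K] (hq : Multi K q) (N : ℕ) : Multi K (stepFun N q) :=
  (hq.lengthPart N).funPart.neg.opHtpy

theorem multi_stepForm [CharZero K] (hq : Multi K q) (N : ℕ) : Multi K (stepForm N q) :=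
  (((multi_stepFun hq N).postcomp diff).sub (hq.lengthPart N).formPart).opHtpy

theorem unitFree_stepFun [CharZero K] (hq : Multi K q) (hu : UnitFree (lengthPart K N q)) :
    UnitFree (stepFun N q) :=
  UnitFree.opHtpy (fun L₁ L₂ => by rw [hu, map_zero, neg_zero]) (hq.lengthPart N).funPart.neg

theorem unitFree_stepForm [CharZero K] (hq : Multi K q) (hu : UnitFree (lengthPart K N q)) :
    UnitFree (stepForm N q) :=
  UnitFree.opHtpy
    (fun L₁ L₂ => by rw [hu, unitFree_stepFun hq hu, map_zero, map_zero, sub_zero])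
    (((multi_stepFun hq N).postcomp diff).sub (hq.lengthPart N).formPart)

theorem scaleArgs_stepFun_source (N : ℕ)
    (hs : ∀ t : K, t ≠ 0 → scaleArgs t q = fun L => t • scale t (q L)) {t : K} (ht : t ≠ 0) :
    scaleArgs t (fun L => -funPart K n (lengthPart K N q L)) =
      (t * t) • fun L => -funPart K n (lengthPart K N q L) := by
  funext L
  have h := congrFun (hs t ht) L
  simp only [scaleArgs_apply] at h
  simp only [scaleArgs_apply, lengthPart_apply, List.length_map, Pi.smul_apply]
  split_ifs
  · rw [h, ← algebraMap_smul (MvPolynomial (Fin n) K) t, map_smul, funPart_scale, algebraMap_smul,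
      smul_neg, smul_smul]
  · simp

theorem scaleArgs_stepFun [CharZero K] (hq : Multi K q) (N : ℕ)
    (hs : ∀ t : K, t ≠ 0 → scaleArgs t q = fun L => t • scale t (q L)) {t : K} (ht : t ≠ 0) :
    scaleArgs t (stepFun N q) = t • stepFun N q :=
  scaleArgs_opHtpy (hq.lengthPart N).funPart.neg ht (scaleArgs_stepFun_source N hs ht)

theorem scaleArgs_stepForm_source [CharZero K] (hq : Multi K q) (N : ℕ)
    (hs : ∀ t : K, t ≠ 0 → scaleArgs t q = fun L => t • scale t (q L)) {t : K} (ht : t ≠ 0) :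
    scaleArgs t (fun L => diff (stepFun N q L) - formPart K n (lengthPart K N q L)) =
      t • fun L => diff (stepFun N q L) - formPart K n (lengthPart K N q L) := by
  funext L
  have h := congrFun (hs t ht) L
  have h' := congrFun (scaleArgs_stepFun hq N hs ht) L
  simp only [scaleArgs_apply] at h h'
  simp only [scaleArgs_apply, Pi.smul_apply, h', lengthPart_apply, List.length_map]
  split_ifs
  · rw [h, ← algebraMap_smul (MvPolynomial (Fin n) K) t (scale t (q L)),
      (formPart K n).map_smul, formPart_scale, algebraMap_smul, map_smul, smul_sub]
  · simp

theorem scaleArgs_stepForm [CharZero K] (hq : Multi K q) (N : ℕ)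
    (hs : ∀ t : K, t ≠ 0 → scaleArgs t q = fun L => t • scale t (q L)) {t : K} (ht : t ≠ 0) :
    scaleArgs t (stepForm N q) = stepForm N q := by
  have h := scaleArgs_opHtpy
    (((multi_stepFun hq N).postcomp diff).sub (hq.lengthPart N).formPart) ht (c := 1)
    (by rw [mul_one]; exact scaleArgs_stepForm_source hq N hs ht)
  rwa [one_smul] at h

/-- The source `-Ψ''` is closed because `δ Ψ = -d Ψ` has no function component. It scales by `t²`,
and `4 ≠ 1` at `t = 2`, so it vanishes on one-forms and `delta_opHtpy` applies. -/
theorem delta_stepFun [CharZero K] (hq : Multi K q) (hu : UnitFree (lengthPart K N q))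
    (hs : ∀ t : K, t ≠ 0 → scaleArgs t q = fun L => t • scale t (q L))
    (hd : ∀ L, L.length = N → delta q L = -diff (q L)) :
    delta (stepFun N q) = fun L => -funPart K n (lengthPart K N q L) := by
  refine delta_opHtpy (hq.lengthPart N).funPart.neg ?_ (fun L₁ L₂ => by rw [hu, map_zero, neg_zero])
    (scaleArgs_zero_eq_zero (c := (2 * 2 : K)) (by norm_num)
      (scaleArgs_stepFun_source N hs two_ne_zero))
  funext L
  have h := postcomp_delta (-(funPart K n).restrictScalars K) (lengthPart K N q) L
  refine h.symm.trans ?_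
  rw [delta_lengthPart, lengthPart_apply]
  split_ifs with hL
  · rw [hd L hL]
    simp
  · simp

/-- Closedness of the source: `δ (d f'') = d (δ f'') = -d Ψ''` by `delta_stepFun`, and `δ Ψ'` is the
form part of `-d Ψ`, which is the same. The source scales by `t`, and `2 ≠ 1`. -/
theorem delta_stepForm [CharZero K] (hq : Multi K q) (hu : UnitFree (lengthPart K N q))
    (hs : ∀ t : K, t ≠ 0 → scaleArgs t q = fun L => t • scale t (q L))
    (hd : ∀ L, L.length = N → delta q L = -diff (q L)) :
    delta (stepForm N q) = fun L => diff (stepFun N q L) - formPart K n (lengthPart K N q L) := by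
  refine delta_opHtpy (((multi_stepFun hq N).postcomp diff).sub (hq.lengthPart N).formPart) ?_
    (fun L₁ L₂ => by rw [hu, unitFree_stepFun hq hu, map_zero, map_zero, sub_zero])
    (scaleArgs_zero_eq_zero (c := (2 : K)) (by norm_num)
      (scaleArgs_stepForm_source hq N hs two_ne_zero))
  funext L
  have h1 := postcomp_delta diff (stepFun N q) L
  have h2 := postcomp_delta ((funPart K n).restrictScalars K) (lengthPart K N q) L
  have h3 := postcomp_delta ((formPart K n).restrictScalars K) (lengthPart K N q) L
  have h4 : delta (fun L => diff (stepFun N q L) - formPart K n (lengthPart K N q L)) L =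
      diff (delta (stepFun N q) L) - formPart K n (delta (lengthPart K N q) L) := by
    rw [h1]
    refine Eq.trans ?_ (congrArg _ h3.symm)
    exact congrFun (map_sub delta (fun L => diff (stepFun N q L)) _) L
  rw [h4, delta_stepFun hq hu hs hd, map_neg, diff_funPart, delta_lengthPart, lengthPart_apply,
    lengthPart_apply]
  split_ifs with hL
  · rw [hd L hL, map_neg, formPart_diff]
    simp
  · simp

end Step

/-- The first components of a morphism of degree zero, defined on words of length less than `N`. -/
structure IsPartialMorphism (θ θ' : Matrix (Fin n) (Fin n) K) (N : ℕ)
    (f : List (WeylSpace K n) → WeylSpace K n) : Prop where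
  multi : Multi K f
  nil : f [] = 0
  single : ∀ a, f [a] = a
  equivariant : ScaleEquivariant f
  normal : UnitFree (f - singleFun)
  eq_zero : ∀ L, N ≤ L.length → f L = 0
  defect : ∀ L, L.length < N → defect θ θ' f L = 0

theorem isPartialMorphism_singleFun (θ θ' : Matrix (Fin n) (Fin n) K) :
    IsPartialMorphism θ θ' 2 (singleFun : List (WeylSpace K n) → WeylSpace K n) where
  multi := multi_singleFun
  nil := rfl
  single _ := rfl
  equivariant t _ := by
    funext L
    match L with
    | [] => simp [scaleArgs_apply]
    | [a] => rfl
    | a :: b :: L => simp [scaleArgs_apply]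
  normal L₁ L₂ := by rw [sub_self, Pi.zero_apply]
  eq_zero L hL := by
    match L, hL with
    | a :: b :: L, _ => rfl
  defect L hL := by
    rw [defect_eq_psi, psi]
    match L, hL with
    | [], _ => simp
    | [a], _ => simp [delta_cons, mulCoder_cons, cup_cons, scaleArgs_apply]

/-- Before the step `f` has no component of arity `N`, so its defect there is `Ψ_N`, and
`delta_defect` yields the closedness needed by `delta_stepFun` and `delta_stepForm`. The new
component `φ` satisfies `δ φ = -Ψ'' + d f'' - Ψ'` and `d φ = d f''`, so `defect_add` gives zero in
arity `N`. -/
theorem IsPartialMorphism.step [CharZero K] {θ θ' : Matrix (Fin n) (Fin n) K} {N : ℕ}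
    (hN : 2 ≤ N) {f : List (WeylSpace K n) → WeylSpace K n} (hf : IsPartialMorphism θ θ' N f) :
    IsPartialMorphism θ θ' (N + 1)
      (f + (stepFun N (psi θ θ' f) + stepForm N (psi θ θ' f))) := by
  have hq := hf.multi.psi θ θ'
  have hu : UnitFree (lengthPart K N (psi θ θ' f)) := UnitFree.lengthPart fun L₁ L₂ h => by
    have h1 := psi_eq_zero_of_unit θ θ' hf.normal (hf.multi.sub multi_singleFun) L₁ L₂ (by omega)
    rwa [add_sub_cancel] at h1
  have hs : ∀ t : K, t ≠ 0 → scaleArgs t (psi θ θ' f) = fun L => t • scale t (psi θ θ' f L) :=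
    fun t ht => scaleArgs_psi θ θ' hf.multi hf.equivariant ht
  have hde : ∀ L, L.length = N → SeibergWitten.defect θ θ' f L = psi θ θ' f L := fun L hL => by
    rw [defect_eq_psi, hf.eq_zero L (by omega), delta_eq_zero fun M hM => hf.eq_zero M (by omega),
      map_zero, sub_zero, zero_add]
  have hd : ∀ L, L.length = N → delta (psi θ θ' f) L = -diff (psi θ θ' f L) := fun L hL => by
    rw [← hde L hL, ← delta_defect θ θ' hf.multi hf.equivariant hf.nil
      fun M hM => hf.defect M (by omega)]
    exact delta_congr fun M hM => (hde M (by omega)).symm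
  set q := psi θ θ' f
  have hz : ∀ L, L.length ≠ N → (stepFun N q + stepForm N q) L = 0 := fun L hL => by
    rw [Pi.add_apply, stepFun_eq_zero _ hL, stepForm_eq_zero _ hL, add_zero]
  refine ⟨hf.multi.add ((multi_stepFun hq N).add (multi_stepForm hq N)), ?_, fun a => ?_,
    fun t ht => ?_, ?_, fun L hL => ?_, fun L hL => ?_⟩
  · rw [Pi.add_apply, hf.nil, hz _ (by simp; omega), add_zero]
  · rw [Pi.add_apply, hf.single, hz _ (by simp; omega), add_zero]
  · funext L
    rw [map_add, map_add, hf.equivariant t ht, scaleArgs_stepFun hq N hs ht,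
      scaleArgs_stepForm hq N hs ht, Pi.add_apply, Pi.add_apply, Pi.add_apply, Pi.add_apply,
      map_add, map_add, ← funPart_stepFun, ← formPart_stepForm, scale_funPart, scale_formPart,
      Pi.smul_apply, funPart_stepFun]
  · intro L₁ L₂
    have h := hf.normal L₁ L₂
    rw [Pi.sub_apply] at h
    rw [Pi.sub_apply, Pi.add_apply, Pi.add_apply, unitFree_stepFun hq hu, unitFree_stepForm hq hu,
      add_zero, add_zero, h]
  · rw [Pi.add_apply, hf.eq_zero L (by omega), hz L (by omega), add_zero]
  · rw [defect_add hf.nil (fun M hM => hz M (by omega)) (hz [] (by simp; omega))]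
    by_cases h : L.length = N
    · rw [hde L h, map_add, Pi.add_apply, delta_stepFun hq hu hs hd, delta_stepForm hq hu hs hd,
        Pi.add_apply, map_add, ← formPart_stepForm, diff_formPart]
      dsimp only
      rw [lengthPart_of_eq _ h]
      have h1 := funPart_add_formPart (q L)
      rw [← h1]
      simp
      abel
    · rw [hf.defect L (by omega), hz L h, map_zero, delta_eq_zero fun M hM => hz M (by omega)]
      simp

theorem isPartialMorphism_approx [CharZero K] (θ θ' : Matrix (Fin n) (Fin n) K) (k : ℕ) :
    IsPartialMorphism θ θ' (k + 2) (approx θ θ' k) := by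
  induction k with
  | zero => exact isPartialMorphism_singleFun θ θ'
  | succ k ih => exact ih.step (by omega)

theorem approx_eq_solution (θ θ' : Matrix (Fin n) (Fin n) K) {k : ℕ} {L : List (WeylSpace K n)}
    (h : L.length ≤ k + 1) : approx θ θ' k L = solution θ θ' L := by
  have h1 : ∀ k, L.length ≤ k + 1 → approx θ θ' (k + 1) L = approx θ θ' k L := fun k hk => by
    rw [approx, Pi.add_apply, Pi.add_apply, stepFun_eq_zero _ (by omega),
      stepForm_eq_zero _ (by omega), add_zero, add_zero]
  have h2 : ∀ j m, L.length ≤ m + 1 → approx θ θ' (m + j) L = approx θ θ' m L := fun j => by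
    induction j with
    | zero => intro m _; rfl
    | succ j ih => intro m hm; rw [← add_assoc, h1 _ (by omega), ih m hm]
  rw [solution]
  rcases Nat.lt_or_ge k L.length with hk | hk
  · rw [show L.length = k + 1 by omega, h1 k h]
  · obtain ⟨j, rfl⟩ := Nat.exists_eq_add_of_le hk
    exact h2 j _ (by omega)

section Properties

variable [CharZero K] (θ θ' : Matrix (Fin n) (Fin n) K)

theorem multi_solution : Multi K (solution θ θ') := by
  refine multi_of_truncFun fun N => ?_
  have h : truncFun N (solution θ θ') = truncFun N (approx θ θ' N) := by
    funext L
    simp only [truncFun]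
    split_ifs
    · exact (approx_eq_solution θ θ' (by omega)).symm
    · rfl
  rw [h]
  exact (isPartialMorphism_approx θ θ' N).multi.truncFun N

theorem solution_nil : solution θ θ' [] = 0 := rfl

theorem solution_single (a : WeylSpace K n) : solution θ θ' [a] = a :=
  (isPartialMorphism_approx θ θ' 1).single a

theorem scaleEquivariant_solution : ScaleEquivariant (solution θ θ') := fun t ht => by
  funext L
  have h := congrFun ((isPartialMorphism_approx θ θ' L.length).equivariant t ht) L
  rw [scaleArgs_apply] at h ⊢
  rwa [approx_eq_solution θ θ' (by simp), approx_eq_solution θ θ' (by simp)] at h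

theorem solution_normal : UnitFree (solution θ θ' - singleFun) := fun L₁ L₂ =>
  (isPartialMorphism_approx θ θ' (L₁ ++ unit :: L₂).length).normal L₁ L₂

theorem defect_solution (L) : defect θ θ' (solution θ θ') L = 0 := by
  have h := isPartialMorphism_approx θ θ' L.length
  have hz : ∀ M, M.length ≤ L.length → (solution θ θ' - approx θ θ' L.length) M = 0 :=
    fun M hM => by rw [Pi.sub_apply, approx_eq_solution θ θ' (by omega), sub_self]
  have h1 := defect_add (θ := θ) (θ' := θ') (L := L) h.nil (fun M hM => hz M hM.le)
    (hz [] (by simp))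
  rw [add_sub_cancel, h.defect L (by omega), hz L le_rfl, map_zero,
    delta_eq_zero fun M hM => hz M hM.le] at h1
  simpa using h1

theorem psi_approx {k : ℕ} {L : List (WeylSpace K n)} (h : L.length ≤ k + 2) :
    psi θ θ' (approx θ θ' k) L = psi θ θ' (solution θ θ') L :=
  psi_congr (isPartialMorphism_approx θ θ' k).nil (solution_nil θ θ') fun M hM =>
    approx_eq_solution θ θ' (by omega)

theorem solution_eq {k : ℕ} {L : List (WeylSpace K n)} (h : L.length = k + 2) :
    solution θ θ' L =
      stepFun (k + 2) (psi θ θ' (approx θ θ' k)) L +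
        stepForm (k + 2) (psi θ θ' (approx θ θ' k)) L := by
  rw [← approx_eq_solution θ θ' (k := k + 1) (by omega), approx, Pi.add_apply,
    (isPartialMorphism_approx θ θ' k).eq_zero L (by omega), zero_add, Pi.add_apply]

theorem funPart_solution {L : List (WeylSpace K n)} (h : 2 ≤ L.length) :
    funPart K n (solution θ θ' L) = opHtpy (fun M => -funPart K n (psi θ θ' (solution θ θ') M)) L := by
  obtain ⟨k, hk⟩ := Nat.exists_eq_add_of_le' h
  rw [solution_eq θ θ' hk, map_add, funPart_stepFun, funPart_stepForm, add_zero, stepFun]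
  exact opHtpy_congr fun M hM => by
    rw [lengthPart_of_eq _ (hM.trans hk), psi_approx θ θ' (by omega)]

theorem formPart_solution_of_two_le {L : List (WeylSpace K n)} (h : 2 ≤ L.length) :
    formPart K n (solution θ θ' L) =
      opHtpy (fun M => diff (funPart K n (solution θ θ' M)) -
        formPart K n (psi θ θ' (solution θ θ') M)) L := by
  obtain ⟨k, hk⟩ := Nat.exists_eq_add_of_le' h
  rw [solution_eq θ θ' hk, map_add, formPart_stepForm, formPart_stepFun, zero_add, stepForm]
  refine opHtpy_congr fun M hM => ?_
  rw [lengthPart_of_eq _ (hM.trans hk), psi_approx θ θ' (by omega),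
    solution_eq θ θ' (hM.trans hk), map_add, funPart_stepFun, funPart_stepForm, add_zero]

end Properties

/-- The function `a ↦ a_i(0) ξ^i` on words of length one. -/
def originFun : List (WeylSpace K n) → WeylSpace K n
  | [a] => (0, fun i => MvPolynomial.C (MvPolynomial.coeff 0 (a.2 i)))
  | _ => 0

theorem multi_originFun : Multi K (originFun : List (WeylSpace K n) → WeylSpace K n) := by
  intro L₁ L₂
  match L₁, L₂ with
  | [], [] =>
    refine ⟨fun x y => ?_, fun c x => ?_⟩
    · simp [originFun, Prod.ext_iff, funext_iff]
    · simp [originFun, Prod.ext_iff, funext_iff, MvPolynomial.smul_eq_C_mul]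
  | [], _ :: _ => exact isLinearMap_zero
  | [_], _ => exact isLinearMap_zero
  | _ :: _ :: _, _ => exact isLinearMap_zero

/-- `originFun` is the symbol of the projection to one-forms: the value of `a_i (y + x)` at `y = 0`
is `a_i (x)`. -/
theorem shift_one_originFun [CharZero K] (a : WeylSpace K n) :
    shift (1 : K) originFun [a] = formPart K n a := by
  rw [shift_cons 1 multi_originFun, weylShift_apply]
  have h0 : shiftTail 1 multi_originFun [] ∘ₗ inFun K n = 0 := by
    refine LinearMap.ext fun f => ?_
    rw [LinearMap.comp_apply, shiftTail_apply]
    simp [originFun, inFun_apply, Prod.ext_iff, funext_iff]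
  have h1 : ∀ i, polyShift 1 (shiftTail 1 multi_originFun [] ∘ₗ inForm K i) (a.2 i) =
      (0, Pi.single i (a.2 i)) := by
    intro i
    have h2 : ∀ α : Fin n →₀ ℕ, (shiftTail 1 multi_originFun [] ∘ₗ inForm K i)
        (MvPolynomial.monomial α 1) = if α = 0 then (0, Pi.single i 1) else 0 := by
      intro α
      rw [LinearMap.comp_apply, shiftTail_apply, shift_nil, tailFun_apply, inForm_apply, originFun]
      split_ifs with h
      · subst h
        refine Prod.ext rfl (funext fun j => ?_)
        by_cases hj : j = i
        · subst hj; simp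
        · simp [hj]
      · refine Prod.ext rfl (funext fun j => ?_)
        by_cases hj : j = i
        · subst hj; simp [MvPolynomial.coeff_monomial, h]
        · simp [hj]
    -- The index set is enlarged by `0` so that the only relevant term is present even if its
    -- coefficient vanishes.
    rw [polyShift_apply, extendCoeff_eq_sum _ _ (Finset.subset_insert 0 _)]
    simp only [h2]
    rw [Finset.sum_eq_single 0 (fun b _ hb => by rw [if_neg hb, smul_zero])
      (fun h => absurd (Finset.mem_insert_self _ _) h), if_pos rfl, coeff_zero_translate_one]
    simp [← Pi.single_smul]
  rw [h0, Finset.sum_congr rfl fun i _ => h1 i]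
  have h3 : polyShift (1 : K) (0 : MvPolynomial (Fin n) K →ₗ[K] WeylSpace K n) a.1 = 0 := by
    have h := congrArg (fun T => T a.1) (polyShift_add (1 : K)
      (0 : MvPolynomial (Fin n) K →ₗ[K] WeylSpace K n) 0)
    simpa using h
  rw [h3, zero_add]
  exact sum_inForm a.2

/-- At the origin the `i`-th derivative of `x^j ∫ a_j (t x) dt` is `a_i (0)`: wherever `x^j` is not
differentiated the term vanishes. -/
theorem htpy_delta_originFun [CharZero K] (a : WeylSpace K n) :
    htpy (delta (originFun : List (WeylSpace K n) → WeylSpace K n)) [a] = originFun [a] := by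
  have h : ∀ i, MvPolynomial.coeff 0 (MvPolynomial.pderiv i
      (∑ j, MvPolynomial.X j * rayIntegral (a.2 j))) = MvPolynomial.coeff 0 (a.2 i) := by
    intro i
    have h1 : ∀ f : MvPolynomial (Fin n) K,
        MvPolynomial.coeff 0 (rayIntegral f) = MvPolynomial.coeff 0 f := by
      intro f
      induction f using MvPolynomial.induction_on' with
      | monomial α c =>
        rw [rayIntegral_monomial, MvPolynomial.coeff_monomial, MvPolynomial.coeff_monomial]
        split_ifs with h
        · subst h; simp
        · rfl
      | add p q hp hq => rw [map_add, MvPolynomial.coeff_add, MvPolynomial.coeff_add, hp, hq]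
    have h2 : ∀ (j : Fin n) (f : MvPolynomial (Fin n) K),
        MvPolynomial.coeff 0 (MvPolynomial.X j * f) = 0 := fun j f => by
      rw [← MvPolynomial.constantCoeff_eq, map_mul, MvPolynomial.constantCoeff_X, zero_mul]
    rw [map_sum, MvPolynomial.coeff_sum, Finset.sum_eq_single i]
    · rw [MvPolynomial.pderiv_mul, MvPolynomial.coeff_add, MvPolynomial.pderiv_X_self, one_mul, h1]
      simp [h2]
    · intro j _ hj
      rw [MvPolynomial.pderiv_mul, MvPolynomial.pderiv_X_of_ne hj]
      simp [h2]
    · simp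
  rw [htpy_cons, List.map_nil, htpy_nil, add_zero, delta_cons, delta_nil, add_zero]
  simp only [originFun, diff_apply, poincare_apply, grad, h]

/-- Arity one is not produced by `stepForm`. There `Ψ_1 = 0`, and `d f''_1` is `δ` of the projection
to one-forms, whose symbol is `originFun`; by `htpy_delta_originFun` the homotopy returns this
projection, in agreement with `f_1 = id`. -/
theorem formPart_solution [CharZero K] (θ θ' : Matrix (Fin n) (Fin n) K)
    {L : List (WeylSpace K n)} (h : 1 ≤ L.length) :
    formPart K n (solution θ θ' L) =
      opHtpy (fun M => diff (funPart K n (solution θ θ' M)) -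
        formPart K n (psi θ θ' (solution θ θ') M)) L := by
  match L, h with
  | a :: b :: L, _ => exact formPart_solution_of_two_le θ θ' (by simp)
  | [a], _ =>
    have h1 : opHtpy (fun M => diff (funPart K n (solution θ θ' M)) -
        formPart K n (psi θ θ' (solution θ θ') M)) [a] =
          opHtpy (shift (1 : K) (delta originFun)) [a] := by
      refine opHtpy_congr fun M hM => ?_
      match M, hM with
      | [b], _ =>
        rw [← delta_shift _ multi_originFun, delta_cons, shift_one_originFun, solution_single]
        simp [psi, mulCoder_cons, cup_cons, scaleArgs_apply, solution_nil]
    have h2 : opHtpy (shift (1 : K) (delta originFun)) [a] = shift (1 : K) originFun [a] := by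
      rw [opHtpy, shift_shift _ _ multi_originFun.delta, neg_add_cancel,
        shift_zero multi_originFun.delta, ← sub_eq_zero, ← Pi.sub_apply, ← map_sub]
      refine shift_eq_zero fun M hM => ?_
      match M, hM with
      | [b], _ => rw [Pi.sub_apply, htpy_delta_originFun, sub_self]
    rw [h1, h2, shift_one_originFun, solution_single]

end Solution

/-! ### Inverting a morphism whose linear part is the identity. -/

section Inverse

set_option linter.unusedSectionVars false

variable {K : Type*} [Field K] {V W : Type*} [AddCommGroup V] [Module K V] [AddCommGroup W]
  [Module K W]

theorem comp_congr {f : List V → V} {φ ψ : List V → W} {L}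
    (h : ∀ M : List V, M.length ≤ L.length → φ M = ψ M) : comp f φ L = comp f ψ L := by
  have h1 : comp f (φ - ψ) L = 0 := comp_eq_zero fun M hM => sub_eq_zero.mpr (h M hM)
  have h2 := congrFun (comp_add f ψ (φ - ψ)) L
  rwa [add_sub_cancel, Pi.add_apply, h1, add_zero] at h2

variable (K) in
/-- The components of arity less than `N` of the inverse of the morphism of coalgebras defined by a
function `f` with `f [a] = a`. -/
def invApprox (f : List V → V) : ℕ → List V → V
  | 0 => 0
  | N + 1 => invApprox f N + lengthPart K N (singleFun - comp f (invApprox f N))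

variable (K) in
/-- The inverse of the morphism of coalgebras defined by a function `f` with `f [a] = a`. -/
def inverse (f : List V → V) : List V → V := fun L => invApprox K f (L.length + 1) L

theorem invApprox_eq_inverse (f : List V → V) {N : ℕ} {L : List V} (h : L.length < N) :
    invApprox K f N L = inverse K f L := by
  obtain ⟨j, rfl⟩ := Nat.exists_eq_add_of_le (Nat.succ_le_of_lt h)
  induction j with
  | zero => rfl
  | succ j ih =>
    rw [← add_assoc, invApprox, Pi.add_apply, ih (by omega), lengthPart_of_ne _ (by omega),
      add_zero]

theorem multi_invApprox {f : List V → V} (hf : Multi K f) (N : ℕ) :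
    Multi K (invApprox K f N) := by
  induction N with
  | zero => exact Multi.zero
  | succ N ih => exact ih.add ((multi_singleFun.sub (hf.comp ih)).lengthPart N)

theorem multi_inverse {f : List V → V} (hf : Multi K f) : Multi K (inverse K f) := by
  refine multi_of_truncFun fun N => ?_
  have h : truncFun N (inverse K f) = truncFun N (invApprox K f N) := by
    funext L
    simp only [truncFun]
    split_ifs with h
    · exact (invApprox_eq_inverse f h).symm
    · rfl
  rw [h]
  exact (multi_invApprox hf N).truncFun N

theorem inverse_nil (f : List V → V) : inverse K f [] = 0 := by
  simp [inverse, invApprox, lengthPart_apply]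

/-- By `comp_eq_self` a correction of top arity passes through `comp f` unchanged, since `f [a] =
a`. Adding the current error as the component of that arity therefore removes it. -/
theorem comp_inverse {f : List V → V} (h1 : ∀ a, f [a] = a) :
    comp f (inverse K f) = singleFun := by
  funext L
  rw [comp_congr fun M hM => (invApprox_eq_inverse f (N := L.length + 1) (by omega)).symm,
    invApprox, comp_add, Pi.add_apply,
    comp_eq_self h1 fun M hM => lengthPart_of_ne _ (by omega), lengthPart_of_eq _ rfl,
    Pi.sub_apply, add_sub_cancel]

theorem inverse_single {f : List V → V} (h1 : ∀ a, f [a] = a) (a : V) :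
    inverse K f [a] = a := by
  have h := congrFun (comp_inverse (K := K) h1) [a]
  rwa [comp_eq_self h1 fun M hM => ?_] at h
  rw [List.length_singleton, Nat.lt_one_iff, List.length_eq_zero_iff] at hM
  rw [hM, inverse_nil]

/-- The group-theoretic argument: `g` also has an inverse on the same side, and associativity
identifies it with `f`. -/
theorem inverse_comp {f : List V → V} (hf : Multi K f) (h0 : f [] = 0) (h1 : ∀ a, f [a] = a) :
    comp (inverse K f) f = singleFun := by
  set g := inverse K f with hg
  have hg1 : ∀ a, g [a] = a := inverse_single h1
  have hgm : Multi K g := multi_inverse hf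
  have h := comp_comp f g (multi_inverse hgm)
  rw [comp_inverse hg1, comp_singleFun h0, comp_inverse h1, singleFun_comp (multi_inverse hgm)] at h
  have h2 := comp_inverse (K := K) hg1
  rwa [← h] at h2

theorem comp_cup {n : ℕ} (f F G : List (WeylSpace K n) → WeylSpace K n)
    (θ : Matrix (Fin n) (Fin n) K) (L) :
    comp f (cup θ F G) L = cup θ (comp f F) (comp f G) L := by
  rw [cup, comp_conv]
  refine conv_congr fun L₁ L₂ _ => ?_
  exact (postcomp_comp f G (starMul θ _) L₂).symm

theorem mulCoder_singleFun_eq_zero {n : ℕ} (θ : Matrix (Fin n) (Fin n) K)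
    (a b c : WeylSpace K n) (L) : mulCoder θ singleFun (a :: b :: c :: L) = 0 :=
  mulCoder_eq_zero fun M hM => by
    match M, hM with
    | [], h => simp at h
    | [x], h => simp at h
    | x :: y :: M, _ => rfl

/-- The identity is a strict morphism. The same function will represent the structure maps
(`structureMaps_eq`), so this also computes `m_1 + m_2` after substitution of values of `f`. -/
theorem bar_singleFun {n : ℕ} (θ : Matrix (Fin n) (Fin n) K) (L) :
    bar θ singleFun L = diff (singleFun L) + cup θ (scaleArgs (-1 : K) singleFun) singleFun L := by
  have hd : ∀ (a b : WeylSpace K n) (L), delta singleFun (a :: b :: L) = 0 := fun a b L =>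
    delta_eq_zero fun M hM => by
      match M, hM with
      | x :: y :: M, _ => rfl
  match L with
  | [] => simp
  | [a] => rw [cup_singleFun_left]; simp [bar_cons]
  | [a, b] => rw [bar_apply, hd, cup_singleFun_left]; simp [mulCoder_cons]
  | a :: b :: c :: L =>
    rw [bar_apply, hd, mulCoder_singleFun_eq_zero, cup_singleFun_left]
    simp

section Weyl

variable {n : ℕ} {f : List (WeylSpace K n) → WeylSpace K n}

theorem scaleArgs_singleFun (t : K) :
    scaleArgs t (singleFun : List (WeylSpace K n) → WeylSpace K n) =
      fun L => scale t (singleFun L) := by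
  funext L
  match L with
  | [] => simp [scaleArgs_apply]
  | [a] => rfl
  | a :: b :: L => simp [scaleArgs_apply]

/-- The two sides agree after composition with `f`, by equivariance of `f` and of the identity; `f`
is then cancelled. -/
theorem scaleEquivariant_inverse (hf : Multi K f) (h0 : f [] = 0) (h1 : ∀ a, f [a] = a)
    (he : ScaleEquivariant f) : ScaleEquivariant (inverse K f) := by
  intro t ht
  have hg := multi_inverse hf
  have h : comp f (scaleArgs t (inverse K f)) = comp f fun L => scale t (inverse K f L) := by
    funext L
    have e1 : comp f (scaleArgs t (inverse K f)) L = comp (scaleArgs t f) (inverse K f) L := by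
      rw [he t ht]
      exact (comp_postcomp (K := K) f (inverse K f) (scale t) L).symm
    have e2 : comp (scaleArgs t f) (inverse K f) L = scaleArgs t (comp f (inverse K f)) L :=
      (comp_map (K := K) f (inverse K f) (scale t) L).symm
    rw [e1, e2, comp_inverse h1, ← postcomp_comp, comp_inverse h1, scaleArgs_singleFun]
  have h2 := congrArg (comp (inverse K f)) h
  rwa [comp_comp _ _ (hg.scaleArgs t), comp_comp _ _ (hg.postcomp (scale t)),
    inverse_comp hf h0 h1, singleFun_comp (hg.scaleArgs t),
    singleFun_comp (hg.postcomp (scale t))] at h2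

/-- `bar_comp` for `φ = inverse K f` computes `bar` of the identity; composing with the inverse
isolates `bar θ'` of the inverse, and `bar_singleFun` turns the other side into `d` and the cup
product. -/
theorem defect_inverse {θ θ' : Matrix (Fin n) (Fin n) K} (hf : Multi K f) (h0 : f [] = 0)
    (h1 : ∀ a, f [a] = a) (he : ScaleEquivariant f) (hd : ∀ L, defect θ θ' f L = 0) (L) :
    defect θ' θ (inverse K f) L = 0 := by
  have hg := multi_inverse hf
  have h := congrArg (comp (inverse K f)) (funext fun L => bar_comp he h0 hd hg L)
  rw [comp_inverse h1, comp_comp _ _ (hg.bar θ'), inverse_comp hf h0 h1,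
    singleFun_comp (hg.bar θ'), show bar θ (singleFun : List (WeylSpace K n) → WeylSpace K n) =
      (fun L => diff (singleFun L)) + cup θ (scaleArgs (-1 : K) singleFun) singleFun from
        funext (bar_singleFun θ), comp_add] at h
  have h2 := congrFun h L
  rw [Pi.add_apply, ← postcomp_comp, comp_cup, comp_singleFun (inverse_nil f),
    scaleArgs_singleFun] at h2
  have h3 : comp (inverse K f) (fun L => scale (-1 : K) (singleFun L)) =
      scaleArgs (-1 : K) (inverse K f) := by
    funext M
    rw [← postcomp_comp, comp_singleFun (inverse_nil f),
      scaleEquivariant_inverse hf h0 h1 he _ (by simp)]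
  rw [h3] at h2
  rw [defect, Pi.sub_apply, Pi.sub_apply, ← h2]
  abel

end Weyl

end Inverse

/-! ### Translation between cochains and functions on words. -/

section Bridge

set_option linter.unusedSectionVars false

variable {K : Type*} [Field K] {V W X : Type*} [AddCommGroup V] [Module K V]
  [AddCommGroup W] [Module K W] [AddCommGroup X] [Module K X]

/-! ### Cochains as functions on words -/

/-- The word `a_0 ⋯ a_{l-1}`. -/
def seqList {V : Type*} : ℕ → (ℕ → V) → List V
  | 0, _ => []
  | l + 1, a => a 0 :: seqList l fun j => a (j + 1)

@[simp] theorem seqList_zero {V : Type*} (a : ℕ → V) : seqList 0 a = [] := rfl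

theorem seqList_succ {V : Type*} (l : ℕ) (a : ℕ → V) :
    seqList (l + 1) a = a 0 :: seqList l fun j => a (j + 1) := rfl

@[simp] theorem length_seqList {V : Type*} (l : ℕ) (a : ℕ → V) : (seqList l a).length = l := by
  induction l generalizing a with
  | zero => rfl
  | succ l ih => simp [seqList_succ, ih]

theorem ofFn_eq_seqList {V : Type*} (l : ℕ) (a : ℕ → V) :
    List.ofFn (fun j : Fin l => a j) = seqList l a := by
  induction l generalizing a with
  | zero => rfl
  | succ l ih => rw [List.ofFn_succ, seqList_succ, ← ih]; rfl

theorem seqList_congr {V : Type*} {l : ℕ} {a b : ℕ → V} (h : ∀ j < l, a j = b j) :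
    seqList l a = seqList l b := by
  rw [← ofFn_eq_seqList, ← ofFn_eq_seqList]
  exact congrArg List.ofFn (funext fun j => h j j.2)

theorem map_seqList {V W : Type*} (T : V → W) (l : ℕ) (a : ℕ → V) :
    (seqList l a).map T = seqList l fun j => T (a j) := by
  induction l generalizing a with
  | zero => rfl
  | succ l ih => rw [seqList_succ, List.map_cons, ih]; rfl

theorem ofFn_update {V : Type*} {l : ℕ} (a : Fin l → V) (i : Fin l) [DecidableEq (Fin l)] (x : V) :
    List.ofFn (Function.update a i x) =
      (List.ofFn a).take i ++ x :: (List.ofFn a).drop (i + 1) := by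
  rw [← (List.set_eq_take_append_cons_drop (l := List.ofFn a) (i := i) (a := x)).trans
    (if_pos (by simp))]
  refine List.ext_getElem (by simp) fun j h1 h2 => ?_
  rw [List.getElem_ofFn, List.getElem_set]
  simp only [List.length_ofFn] at h1
  by_cases h : i.1 = j
  · subst h; simp
  · rw [if_neg h, Function.update_of_ne (fun e => h (by rw [← e])), List.getElem_ofFn]

/-- The sequence of multilinear maps given by a multilinear function on words. -/
def toCochain (F : List V → X) (hF : Multi K F) : Cochain K V X := fun l =>
  { toFun := fun a => F (List.ofFn a)
    map_update_add' := fun a i x y => by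
      rw [ofFn_update, ofFn_update, ofFn_update]
      exact (hF _ _).map_add x y
    map_update_smul' := fun a i c x => by
      rw [ofFn_update, ofFn_update]
      exact (hF _ _).map_smul c x }

theorem toCochain_apply (F : List V → X) (hF : Multi K F) (l : ℕ) (a : Fin l → V) :
    toCochain F hF l a = F (List.ofFn a) := rfl

theorem ev_toCochain (F : List V → X) (hF : Multi K F) (l : ℕ) (a : ℕ → V) :
    ev (toCochain F hF) l a = F (seqList l a) := by
  rw [ev, toCochain_apply, ofFn_eq_seqList]

/-! ### Composition with morphisms of coalgebras -/

/-- The word `f (a_0, …, a_{b_0 - 1}), f (a_{b_0}, …), …` obtained from a division into blocks of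
lengths `b_0, b_1, …`. -/
def splitWord (f : List V → W) : List ℕ → (ℕ → V) → List W
  | [], _ => []
  | b :: bs, a => f (seqList b a) :: splitWord f bs fun j => a (b + j)

theorem ofFn_eq_splitWord (f : List V → W) (bs : List ℕ) (a : ℕ → V) :
    List.ofFn (fun r : Fin bs.length => f (seqList bs[r] fun j => a ((bs.take r).sum + j))) =
      splitWord f bs a := by
  induction bs generalizing a with
  | nil => rfl
  | cons b bs ih =>
    rw [splitWord, ← ih, List.ofFn_succ]
    congr 1
    · simp
    · congr 1
      funext r
      simp [add_assoc]

/-- The lists of positive natural numbers with sum `N`. -/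
def blockLists (N : ℕ) : Finset (List ℕ) :=
  (Finset.univ : Finset (Composition N)).image Composition.blocks

theorem mem_blockLists {N : ℕ} {bs : List ℕ} :
    bs ∈ blockLists N ↔ (∀ b ∈ bs, 0 < b) ∧ bs.sum = N := by
  simp only [blockLists, Finset.mem_image, Finset.mem_univ, true_and]
  constructor
  · rintro ⟨c, rfl⟩
    exact ⟨fun b hb => c.blocks_pos hb, c.blocks_sum⟩
  · rintro ⟨h1, h2⟩
    exact ⟨⟨bs, fun hb => h1 _ hb, h2⟩, rfl⟩

theorem blockLists_zero : blockLists 0 = {[]} := by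
  ext bs
  rw [mem_blockLists, Finset.mem_singleton]
  constructor
  · rintro ⟨h1, h2⟩
    cases bs with
    | nil => rfl
    | cons b bs =>
      have := h1 b (by simp)
      simp at h2
      omega
  · rintro rfl
    simp

theorem blockLists_succ (N : ℕ) : blockLists (N + 1) =
    (Finset.range (N + 1)).biUnion fun i => (blockLists (N - i)).image (List.cons (i + 1)) := by
  ext bs
  simp only [Finset.mem_biUnion, Finset.mem_image, Finset.mem_range, mem_blockLists]
  constructor
  · rintro ⟨h1, h2⟩
    cases bs with
    | nil => simp at h2
    | cons b bs =>
      have hb := h1 b (by simp)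
      rw [List.sum_cons] at h2
      exact ⟨b - 1, by omega, bs, ⟨fun c hc => h1 c (by simp [hc]), by omega⟩,
        by rw [Nat.sub_add_cancel hb]⟩
  · rintro ⟨i, hi, bs, ⟨h1, h2⟩, rfl⟩
    refine ⟨fun c hc => ?_, by rw [List.sum_cons]; omega⟩
    rcases List.mem_cons.mp hc with rfl | hc
    · omega
    · exact h1 c hc

theorem sum_blockLists_succ (N : ℕ) (g : List ℕ → X) :
    ∑ bs ∈ blockLists (N + 1), g bs =
      ∑ i ∈ Finset.range (N + 1), ∑ bs ∈ blockLists (N - i), g ((i + 1) :: bs) := by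
  rw [blockLists_succ, Finset.sum_biUnion]
  · refine Finset.sum_congr rfl fun i _ => ?_
    rw [Finset.sum_image]
    intro x _ y _ h
    exact List.cons_injective h
  · intro i _ j _ hij
    rw [Function.onFun, Finset.disjoint_left]
    intro bs h1 h2
    rw [Finset.mem_image] at h1 h2
    obtain ⟨_, _, rfl⟩ := h1
    obtain ⟨_, _, h⟩ := h2
    simp at h
    omega

theorem conv_seqList (Ξ : W → List V → X) (u : List V → W) (l : ℕ) (a : ℕ → V) :
    conv Ξ u (seqList l a) =
      ∑ i ∈ Finset.range (l + 1), Ξ (u (seqList i a)) (seqList (l - i) fun j => a (i + j)) := by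
  induction l generalizing u a with
  | zero => simp
  | succ l ih =>
    rw [seqList_succ, conv_cons, ih, Finset.sum_range_succ' _ (l + 1)]
    refine (add_comm _ _).trans (congrArg₂ _ (Finset.sum_congr rfl fun i hi => ?_) ?_)
    · rw [Nat.succ_sub_succ, tailFun_apply, seqList_succ i]
      simp only [add_right_comm]
    · simp [seqList_succ]

/-- The nonempty first block in `comp_cons`, of length `i + 1`, is the head of the list of block
lengths. -/
theorem comp_seqList (f : List V → W) (φ : List W → X) (N : ℕ) (a : ℕ → V) :
    comp f φ (seqList N a) = ∑ bs ∈ blockLists N, φ (splitWord f bs a) := by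
  induction N using Nat.strong_induction_on generalizing φ a with
  | _ N ih =>
    cases N with
    | zero => simp [blockLists_zero, splitWord]
    | succ N =>
      rw [seqList_succ, comp_cons, conv_seqList, sum_blockLists_succ]
      refine Finset.sum_congr rfl fun i hi => ?_
      rw [ih (N - i) (by omega)]
      refine Finset.sum_congr rfl fun bs _ => ?_
      rw [tailFun_apply, tailFun_apply, splitWord, seqList_succ]
      congr 3
      funext j
      congr 1
      omega

theorem compCohom_toCochain (f : List V → W) (hf : Multi K f) (φ : List W → X) (hφ : Multi K φ)
    (N : ℕ) (a : ℕ → V) :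
    compCohom (toCochain φ hφ) (toCochain f hf) N a = comp f φ (seqList N a) := by
  rw [comp_seqList, blockLists, Finset.sum_image fun c _ c' _ h => Composition.ext h, compCohom]
  refine Finset.sum_congr rfl fun c _ => ?_
  rw [toCochain_apply, ← ofFn_eq_splitWord]
  congr 2
  funext r
  rw [toCochain_apply, ← ofFn_eq_seqList]
  rfl

theorem idCochain_eq (N : ℕ) (a : ℕ → V) : idCochain N a = singleFun (seqList N a) := by
  match N with
  | 0 => rfl
  | 1 => rfl
  | N + 2 => rfl

/-! ### The coderivations -/

section Weyl

variable {n : ℕ}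

/-- With `m` expressed as `bar` of the identity, the A-infinity relation is `bar_bar`. -/
theorem structureMaps_eq (θ : Matrix (Fin n) (Fin n) K) :
    structureMaps θ = toCochain (bar θ singleFun) (multi_singleFun.bar θ) := by
  funext l
  refine MultilinearMap.ext fun a => ?_
  rw [toCochain_apply]
  match l, a with
  | 0, a =>
    change (0 : WeylSpace K n) = _
    rw [List.ofFn_zero, bar_nil]
  | 1, a =>
    change diff (a 0) = _
    simp [bar_cons]
  | 2, a =>
    change starMul θ (barParity (a 0)) (a 1) = _
    have : List.ofFn a = [a 0, a 1] := by simp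
    rw [this, bar_cons, bar_cons]
    simp
  | l + 3, a =>
    change (0 : WeylSpace K n) = _
    rw [List.ofFn_succ, List.ofFn_succ, List.ofFn_succ, bar_singleFun, cup_singleFun_left]
    simp

/-- On homogeneous elements `barParity` is the Koszul sign; this is how formulas on words, written
without degrees, match the signed sums. Outside degrees zero and one the element is zero. -/
theorem barParity_of_mem {d : ℤ} {a : WeylSpace K n} (h : a ∈ grading K n d) :
    barParity a = Int.negOnePow (d - 1) • a := by
  rw [barParity_apply]
  by_cases h0 : d = 0
  · subst h0
    have : a.2 = 0 := h.2 (by omega)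
    ext1 <;> simp [this]
  · by_cases h1 : d = 1
    · subst h1
      have : a.1 = 0 := h.1 (by omega)
      ext1 <;> simp [this]
    · have e1 : a.1 = 0 := h.1 h0
      have e2 : a.2 = 0 := h.2 h1
      ext1 <;> simp [e1, e2]

theorem koszul_succ (d : ℕ → ℤ) (i : ℕ) :
    koszul d (i + 1) = Int.negOnePow (d 0 - 1) * koszul (fun j => d (j + 1)) i := by
  rw [koszul, Finset.sum_range_succ', add_comm, Int.negOnePow_add]
  rfl

theorem contract_zero (l : ℕ) (y : V) (a : ℕ → V) (N : ℕ) :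
    seqList (N + 1) (contract 0 (l + 1) y a) = y :: seqList N fun j => a (l + 1 + j) := by
  rw [seqList_succ]
  congr 1
  refine seqList_congr fun j _ => ?_
  simp only [contract]
  rw [if_neg (by omega), if_neg (by omega)]
  congr 1
  omega

theorem contract_succ (i l : ℕ) (y : V) (a : ℕ → V) (N : ℕ) :
    seqList (N + 1) (contract (i + 1) (l + 1) y a) =
      a 0 :: seqList N (contract i (l + 1) y fun j => a (j + 1)) := by
  rw [seqList_succ]
  congr 1
  refine seqList_congr fun j _ => ?_
  simp only [contract, Nat.add_lt_add_iff_right, Nat.add_right_cancel_iff]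
  split_ifs
  · rfl
  · rfl
  · congr 1
    omega

theorem Multi.units_smul {F : List V → X} (hF : Multi K F) (u : ℤˣ) (x : V) :
    SeibergWitten.tailFun (u • x) F = u • SeibergWitten.tailFun x F := by
  rcases Int.units_eq_one_or u with rfl | rfl
  · simp
  · simpa using hF.tailFun_neg x

theorem units_smul_map (T : X →ₗ[K] W) (u : ℤˣ) (x : X) : T (u • x) = u • T x := by
  rcases Int.units_eq_one_or u with rfl | rfl <;> simp

theorem delta_seqList {F : List (WeylSpace K n) → X} (hF : Multi K F) (N : ℕ) (d : ℕ → ℤ)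
    (a : ℕ → WeylSpace K n) (h : ∀ j < N, a j ∈ grading K n (d j)) :
    delta F (seqList N a) =
      ∑ i ∈ Finset.range N, koszul d i • F (seqList N (contract i 1 (diff (a i)) a)) := by
  induction N generalizing F d a with
  | zero => simp
  | succ N ih =>
    rw [Finset.sum_range_succ', contract_zero, seqList_succ, delta_cons,
      barParity_of_mem (h 0 (by omega)), hF.units_smul, units_smul_map, Pi.smul_apply,
      ih (hF.tailFun _) (fun j => d (j + 1)) _ fun j hj => h (j + 1) (by omega), Finset.smul_sum,
      add_comm]
    congr 1
    · refine Finset.sum_congr rfl fun i _ => ?_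
      rw [contract_succ, koszul_succ, mul_smul]
      rfl
    · simp [koszul, add_comm]

theorem mulCoder_seqList_graded {F : List (WeylSpace K n) → X} (hF : Multi K F)
    (θ : Matrix (Fin n) (Fin n) K) (N : ℕ) (d : ℕ → ℤ)
    (a : ℕ → WeylSpace K n) (h : ∀ j < N, a j ∈ grading K n (d j)) :
    mulCoder θ F (seqList N a) = ∑ i ∈ Finset.range (N - 1), koszul d i •
      F (seqList (N - 1) (contract i 2 (starMul θ (barParity (a i)) (a (i + 1))) a)) := by
  induction N generalizing F d a with
  | zero => simp
  | succ N ih =>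
    cases N with
    | zero => simp [seqList_succ, mulCoder_cons]
    | succ N =>
    rw [Nat.add_sub_cancel, Finset.sum_range_succ', contract_zero, seqList_succ, mulCoder_cons,
      barParity_of_mem (h 0 (by omega)), hF.units_smul, units_smul_map, Pi.smul_apply,
      ih (hF.tailFun _) (fun j => d (j + 1)) _ fun j hj => h (j + 1) (by omega), Finset.smul_sum,
      add_comm]
    congr 1
    · refine Finset.sum_congr rfl fun i _ => ?_
      rw [contract_succ, koszul_succ, mul_smul]
      rfl
    · rw [seqList_succ, contr_cons]
      simp [koszul, Nat.add_comm 2, add_assoc]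

theorem ev_structureMaps_one (θ : Matrix (Fin n) (Fin n) K) (a : ℕ → WeylSpace K n) :
    ev (structureMaps θ) 1 a = diff (a 0) := rfl

theorem ev_structureMaps_two (θ : Matrix (Fin n) (Fin n) K) (a : ℕ → WeylSpace K n) :
    ev (structureMaps θ) 2 a = starMul θ (barParity (a 0)) (a 1) := rfl

theorem compCoder_toCochain (F : List (WeylSpace K n) → X) (hF : Multi K F)
    (θ : Matrix (Fin n) (Fin n) K) (N : ℕ) (d : ℕ → ℤ)
    (a : ℕ → WeylSpace K n) (h : ∀ j < N, a j ∈ grading K n (d j)) :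
    compCoder (toCochain F hF) (structureMaps θ) N d a = bar θ F (seqList N a) := by
  rw [bar_apply, delta_seqList hF N d a h, mulCoder_seqList_graded hF θ N d a h, compCoder]
  have h3 : ∀ l ∈ Finset.Icc 1 N, 3 ≤ l → (∑ i ∈ Finset.range (N + 1 - l), koszul d i •
      ev (toCochain F hF) (N + 1 - l) (contract i l (ev (structureMaps θ) l
        fun j => a (i + j)) a)) = 0 := by
    intro l hl h3
    refine Finset.sum_eq_zero fun i hi => ?_
    obtain ⟨m, rfl⟩ := Nat.exists_eq_add_of_le' h3
    rw [show ev (structureMaps θ) (m + 3) (fun j => a (i + j)) = 0 from rfl, ev]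
    rw [Finset.mem_range] at hi
    rw [MultilinearMap.map_coord_zero _ (⟨i, hi⟩ : Fin (N + 1 - (m + 3))) (by simp [contract]),
      smul_zero]
  match N, h3 with
  | 0, _ => simp
  | 1, _ => simp [ev_toCochain, ev_structureMaps_one]
  | N + 2, h3 =>
    rw [← Finset.sum_subset (s₁ := {1, 2})
      (fun l hl => by
        simp only [Finset.mem_insert, Finset.mem_singleton] at hl
        rw [Finset.mem_Icc]; omega)
      (fun l hl hl' => h3 l hl (by
        simp only [Finset.mem_insert, Finset.mem_singleton] at hl'
        rw [Finset.mem_Icc] at hl; omega)), Finset.sum_pair (by omega)]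
    simp only [ev_toCochain, ev_structureMaps_one, ev_structureMaps_two]
    rfl

theorem mulCoder_seqList (θ : Matrix (Fin n) (Fin n) K) (F : List (WeylSpace K n) → X) (N : ℕ)
    (a : ℕ → WeylSpace K n) :
    mulCoder θ F (seqList N a) = ∑ i ∈ Finset.range (N - 1), F (seqList (N - 1) fun j =>
        if j < i then barParity (a j)
        else if j = i then starMul θ (barParity (a i)) (a (i + 1))
        else a (j + 1)) := by
  induction N generalizing F a with
  | zero => simp
  | succ N ih =>
    cases N with
    | zero => simp [seqList_succ, mulCoder_cons]
    | succ N =>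
    rw [Nat.add_sub_cancel, Finset.sum_range_succ', seqList_succ, mulCoder_cons, ih, add_comm]
    congr 1
    · refine Finset.sum_congr rfl fun i _ => ?_
      rw [Nat.add_sub_cancel, seqList_succ N, tailFun_apply]
      congr 2
      refine seqList_congr fun j _ => ?_
      simp only [Nat.add_lt_add_iff_right, Nat.add_right_cancel_iff]

theorem Psi_toCochain {F : List (WeylSpace K n) → WeylSpace K n} (hF : Multi K F) (h0 : F [] = 0)
    (θ θ' : Matrix (Fin n) (Fin n) K) (l : ℕ) (a : ℕ → WeylSpace K n) :
    Psi θ θ' (toCochain F hF) l a = psi θ θ' F (seqList l a) := by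
  rw [Psi, psi, Pi.sub_apply, mulCoder_seqList, cup, conv_seqList]
  simp only [ev_toCochain]
  congr 1
  refine Eq.trans (Finset.sum_congr rfl fun i _ => ?_)
    (Finset.sum_subset (s₁ := Finset.Icc 1 (l - 1)) ?_ ?_)
  · rw [starLin_apply, scaleArgs_apply, map_seqList]
    simp only [scale_neg_one]
  · intro i hi
    rw [Finset.mem_Icc] at hi
    rw [Finset.mem_range]
    omega
  · intro i hi hi'
    rw [Finset.mem_Icc] at hi'
    rw [Finset.mem_range] at hi
    rw [starLin_apply]
    -- The two splittings with an empty part occur in `cup` but not in `Psi`; they vanish because `F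
    -- [] = 0`.
    obtain rfl | rfl : i = 0 ∨ i = l := by omega
    · rw [seqList_zero, show scaleArgs (-1 : K) F [] = 0 from h0, map_zero, LinearMap.zero_apply]
    · rw [Nat.sub_self, seqList_zero, h0, map_zero]

end Weyl

end Bridge

/-! ### The A-infinity algebra, the morphism, and its invertibility. -/

section AInfinityStructure

set_option linter.unusedSectionVars false

variable {K : Type*} [Field K] [CharZero K] {n : ℕ}

theorem two_zpow_injective : Function.Injective fun m : ℤ => (2 : K) ^ m := by
  intro a b h
  have h1 : (((2 : ℚ) ^ a : ℚ) : K) = (((2 : ℚ) ^ b : ℚ) : K) := by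
    push_cast
    exact h
  exact zpow_right_injective₀ (by norm_num) (by norm_num) (Rat.cast_injective h1)

/-- The graded pieces are eigenspaces of `scale 2` with distinct eigenvalues. This gives their
independence, and the degree of a cochain can be read off from a single scaling
(`hasDegree_toCochain`). -/
theorem mem_grading_iff {d : ℤ} {a : WeylSpace K n} :
    a ∈ grading K n d ↔ scale (2 : K) a = (2 : K) ^ (1 - d) • a := by
  constructor
  · intro h
    by_cases h0 : d = 0
    · subst h0
      have : a.2 = 0 := h.2 (by omega)
      ext1 <;> simp [scale_apply, this]
    · by_cases h1 : d = 1
      · subst h1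
        have : a.1 = 0 := h.1 (by omega)
        ext1 <;> simp [scale_apply, this]
      · have e1 : a.1 = 0 := h.1 h0
        have e2 : a.2 = 0 := h.2 h1
        ext1 <;> simp [scale_apply, e1, e2]
  · intro h
    have h1 : (2 : K) • a.1 = (2 : K) ^ (1 - d) • a.1 := congrArg Prod.fst h
    have h2 : a.2 = (2 : K) ^ (1 - d) • a.2 := congrArg Prod.snd h
    refine ⟨fun hd => ?_, fun hd => ?_⟩
    · rw [← sub_eq_zero, ← sub_smul] at h1
      refine (smul_eq_zero.mp h1).resolve_left fun h3 => hd ?_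
      have := two_zpow_injective (K := K) (a₁ := 1) (a₂ := 1 - d)
        (by simpa using sub_eq_zero.mp h3)
      omega
    · have h3 : ((1 : K) - (2 : K) ^ (1 - d)) • a.2 = 0 := by
        rw [sub_smul, one_smul, ← h2, sub_self]
      refine (smul_eq_zero.mp h3).resolve_left fun h4 => hd ?_
      have := two_zpow_injective (K := K) (a₁ := 0) (a₂ := 1 - d)
        (by simpa using sub_eq_zero.mp h4)
      omega

theorem isInternal_grading : DirectSum.IsInternal (grading K n) := by
  refine DirectSum.isInternal_submodule_of_iSupIndep_of_iSup_eq_top ?_ ?_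
  · have h := (Module.End.eigenspaces_iSupIndep
      (scale (2 : K) : Module.End K (WeylSpace K n))).comp
        (f := fun d : ℤ => (2 : K) ^ (1 - d)) fun d d' h => by
          have := two_zpow_injective (K := K) h
          omega
    convert h using 1
    funext d
    ext a
    rw [mem_grading_iff, Function.comp_apply, Module.End.mem_eigenspace_iff]
  · rw [eq_top_iff]
    intro a _
    rw [← funPart_add_formPart a]
    refine Submodule.add_mem _ (Submodule.mem_iSup_of_mem 0 ?_) (Submodule.mem_iSup_of_mem 1 ?_)
    · exact ⟨fun h => absurd rfl h, fun _ => rfl⟩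
    · exact ⟨fun _ => rfl, fun h => absurd rfl h⟩

theorem hasDegree_toCochain {F : List (WeylSpace K n) → WeylSpace K n} (hF : Multi K F) {k : ℤ}
    (h : scaleArgs (2 : K) F = fun L => (2 : K) ^ k • scale 2 (F L)) :
    HasDegree (grading K n) (grading K n) k (toCochain F hF) := by
  intro l d a ha
  have h1 : ∀ (l : ℕ) (G : List (WeylSpace K n) → WeylSpace K n), Multi K G →
      ∀ (d : ℕ → ℤ) (a : ℕ → WeylSpace K n), (∀ j < l, a j ∈ grading K n (d j)) →
      scaleArgs (2 : K) G (seqList l a) =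
        (2 : K) ^ (-∑ j ∈ Finset.range l, (d j - 1)) • G (seqList l a) := by
    intro l
    induction l with
    | zero => intro G _ d a _; simp [scaleArgs_apply]
    | succ l ih =>
      intro G hG d a ha
      have h2 := ih (tailFun (scale 2 (a 0)) G) (hG.tailFun _) (fun j => d (j + 1))
        (fun j => a (j + 1)) fun j hj => ha (j + 1) (by omega)
      rw [seqList_succ]
      refine h2.trans ?_
      rw [mem_grading_iff.mp (ha 0 (by omega)), hG.tailFun_smul, Pi.smul_apply, smul_smul,
        ← zpow_add₀ two_ne_zero, Finset.sum_range_succ']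
      congr 2
      ring
  rw [ev_toCochain, mem_grading_iff]
  have h2 := congrFun h (seqList l a)
  rw [h1 l F hF d a ha] at h2
  have h3 : scale (2 : K) (F (seqList l a)) =
      (2 : K) ^ (-k) • (2 : K) ^ k • scale (2 : K) (F (seqList l a)) := by
    rw [smul_smul, ← zpow_add₀ two_ne_zero]
    simp
  rw [h3, ← h2, smul_smul, ← zpow_add₀ two_ne_zero]
  congr 2
  ring

theorem isAInfinityAlgebra (θ : Matrix (Fin n) (Fin n) K) :
    IsAInfinityAlgebra (grading K n) (structureMaps θ) where
  internal := isInternal_grading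
  zero := rfl
  degree := by
    rw [structureMaps_eq]
    refine hasDegree_toCochain _ ?_
    rw [scaleArgs_bar multi_singleFun, scaleArgs_singleFun]
    funext L
    rw [Pi.smul_apply, ← postcomp_bar, zpow_one]
  relation N d a ha := by
    have h := compCoder_toCochain _ (multi_singleFun.bar θ) θ N d a ha
    rw [← structureMaps_eq] at h
    rw [h, bar_bar multi_singleFun]

theorem isAInfinityMorphism_toCochain {θ θ' : Matrix (Fin n) (Fin n) K}
    {f : List (WeylSpace K n) → WeylSpace K n} (hf : Multi K f) (h0 : f [] = 0)
    (he : ScaleEquivariant f) (hd : ∀ L, defect θ θ' f L = 0) :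
    IsAInfinityMorphism (grading K n) (structureMaps θ) (grading K n) (structureMaps θ')
      (toCochain f hf) where
  zero := MultilinearMap.ext fun a => by
    rw [toCochain_apply, List.ofFn_zero, h0]
    rfl
  degree := hasDegree_toCochain hf (by rw [he 2 two_ne_zero]; simp)
  relation N d a ha := by
    rw [compCoder_toCochain f hf θ N d a ha, structureMaps_eq, compCohom_toCochain,
      show bar θ' (singleFun : List (WeylSpace K n) → WeylSpace K n) =
      (fun L => diff (singleFun L)) + cup θ' (scaleArgs (-1 : K) singleFun) singleFun from
        funext (bar_singleFun θ'), comp_add, Pi.add_apply, ← postcomp_comp, comp_cup,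
      comp_singleFun h0]
    have h1 : comp f (scaleArgs (-1 : K) singleFun) = scaleArgs (-1 : K) f := by
      rw [scaleArgs_singleFun]
      funext M
      rw [← postcomp_comp, comp_singleFun h0, he _ (by simp)]
    have h2 := hd (seqList N a)
    rw [defect, Pi.sub_apply, Pi.sub_apply, sub_sub, sub_eq_zero] at h2
    rw [h1, h2]

/-- `f_1` is the identity and both algebras have the same differential, so the two complexes
coincide. -/
theorem isAInfinityQuasiIso_toCochain {θ θ' : Matrix (Fin n) (Fin n) K}
    {f : List (WeylSpace K n) → WeylSpace K n} (hf : Multi K f) (h0 : f [] = 0)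
    (h1 : ∀ a, f [a] = a) (he : ScaleEquivariant f) (hd : ∀ L, defect θ θ' f L = 0) :
    IsAInfinityQuasiIso (grading K n) (structureMaps θ) (grading K n) (structureMaps θ')
      (toCochain f hf) := by
  have h2 : ∀ a, toCochain f hf 1 (fun _ => a) = a := fun a => by
    rw [toCochain_apply, List.ofFn_succ, List.ofFn_zero, h1]
  refine ⟨isAInfinityMorphism_toCochain hf h0 he hd, fun a _ hb => ?_, fun b hb => ?_⟩
  · obtain ⟨b, hb⟩ := hb
    rw [h2] at hb
    exact ⟨b, hb⟩
  · exact ⟨b, hb, 0, by rw [h2]; change b = b + diff 0; rw [map_zero, add_zero]⟩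

theorem isAInfinityIso_toCochain {θ θ' : Matrix (Fin n) (Fin n) K}
    {f : List (WeylSpace K n) → WeylSpace K n} (hf : Multi K f) (h0 : f [] = 0)
    (h1 : ∀ a, f [a] = a) (he : ScaleEquivariant f) (hd : ∀ L, defect θ θ' f L = 0) :
    IsAInfinityIso (grading K n) (structureMaps θ) (grading K n) (structureMaps θ')
      (toCochain f hf) := by
  refine ⟨isAInfinityMorphism_toCochain hf h0 he hd, toCochain _ (multi_inverse hf),
    isAInfinityMorphism_toCochain _ (inverse_nil f) (scaleEquivariant_inverse hf h0 h1 he)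
      (defect_inverse hf h0 h1 he hd), fun N a => ?_, fun N a => ?_⟩
  · rw [compCohom_toCochain, comp_inverse h1, idCochain_eq]
  · rw [compCohom_toCochain, inverse_comp hf h0 h1, idCochain_eq]

end AInfinityStructure

/-! ### Symbols of operators, duality of the homotopies, existence and uniqueness. -/

section Symbols

set_option linter.unusedSectionVars false

variable {K : Type*} [Field K] {n : ℕ}

/-! ### Symbols -/

/-- The symbol of `shift 1 G`. -/
def symb (l : ℕ) (G : List (WeylSpace K n) → WeylSpace K n) : Symbol K n l :=
  fun s => G (List.ofFn fun j => slotVec (s j))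

theorem finite_support_sigma (l : ℕ) (a : ℕ → WeylSpace K n) (Φ : Symbol K n l) :
    (Function.support fun s : Fin l → Slot n => (∏ k, sigma (s k) (a k)) • Φ s).Finite := by
  refine (Set.Finite.pi' (t := fun k : Fin l => {t : Slot n | t ∈ (coords (1 : K) (a k)).support})
    fun k => Finset.finite_toSet _).subset fun s hs k => ?_
  rw [Set.mem_ofPred_eq, Finsupp.mem_support_iff, coords_one_apply]
  intro h
  refine hs ?_
  dsimp only
  rw [Finset.prod_eq_zero (f := fun k => sigma (s k) (a k)) (Finset.mem_univ k) h, zero_smul]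

/-- Taylor expansion of each argument in the vectors `slotVec`, with coefficients given by `σ`
(`coords_one_apply`). -/
theorem isOperatorOf_symb (l : ℕ) (G : List (WeylSpace K n) → WeylSpace K n) :
    IsOperatorOf (symb l G) fun a => shift (1 : K) G (seqList l a) := by
  intro a
  induction l generalizing G a with
  | zero =>
    rw [finsum_eq_single _ (default : Fin 0 → Slot n) fun s hs => absurd (Subsingleton.elim _ _) hs]
    simp [symb]
  | succ l ih =>
    have h1 : (∑ᶠ s : Fin (l + 1) → Slot n, (∏ k, sigma (s k) (a k)) • symb (l + 1) G s) =
        ∑ᶠ p : Slot n × (Fin l → Slot n), sigma p.1 (a 0) •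
          (∏ k, sigma (p.2 k) (a (k + 1))) • symb l (tailFun (slotVec p.1) G) p.2 := by
      rw [← finsum_comp_equiv (Fin.consEquiv fun _ : Fin (l + 1) => Slot n)]
      refine finsum_congr fun p => ?_
      rw [Fin.prod_univ_succ, mul_smul, symb, List.ofFn_succ]
      rfl
    have h2 : (Function.support fun p : Slot n × (Fin l → Slot n) => sigma p.1 (a 0) •
          (∏ k, sigma (p.2 k) (a (k + 1))) • symb l (tailFun (slotVec p.1) G) p.2).Finite := by
      have h := (finite_support_sigma (l + 1) a (symb (l + 1) G)).preimage
        (Fin.consEquiv fun _ : Fin (l + 1) => Slot n).injective.injOn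
      refine h.subset fun p hp => ?_
      rw [Set.mem_preimage, Function.mem_support]
      rw [Function.mem_support] at hp
      rw [Fin.prod_univ_succ, mul_smul, symb, List.ofFn_succ]
      exact hp
    dsimp only
    rw [seqList_succ, shift_cons_eq_sum, h1, finsum_curry _ h2]
    refine Eq.trans ?_ (finsum_eq_sum_of_support_subset
      (s := (coords (1 : K) (a 0)).support) _ fun s hs => ?_).symm
    · refine Finset.sum_congr rfl fun s _ => ?_
      dsimp only
      rw [← smul_finsum' _ (finite_support_sigma l (fun j => a (j + 1)) _), coords_one_apply]
      exact congrArg _ (ih (tailFun (slotVec s) G) fun j => a (j + 1))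
    · rw [Finset.mem_coe, Finsupp.mem_support_iff, coords_one_apply]
      intro h
      refine hs ?_
      simp only [h, zero_smul, finsum_zero]

theorem iterDeriv_monomial [CharZero K] (α β : Fin n →₀ ℕ) :
    iterDeriv α (MvPolynomial.monomial β (multiFactorial β : K)⁻¹) =
      if α ≤ β then MvPolynomial.monomial (β - α) (multiFactorial (β - α) : K)⁻¹ else 0 := by
  suffices h : ∀ (N : ℕ) (α : Fin n →₀ ℕ), α.degree = N → ∀ β : Fin n →₀ ℕ,
      iterDeriv α (MvPolynomial.monomial β (multiFactorial β : K)⁻¹) =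
        if α ≤ β then MvPolynomial.monomial (β - α) (multiFactorial (β - α) : K)⁻¹ else 0 from
    h _ α rfl β
  intro N
  induction N with
  | zero =>
    intro α hα β
    rw [Finsupp.degree_eq_zero_iff] at hα
    subst hα
    rw [iterDeriv_zero, if_pos (zero_le (a := β)), tsub_zero]
    rfl
  | succ N ih =>
    intro α hα β
    have hα0 : α ≠ 0 := fun h => by rw [h, map_zero] at hα; omega
    obtain ⟨i, hi⟩ := Finsupp.ne_iff.mp hα0
    have hle : Finsupp.single i 1 ≤ α := by
      rw [Finsupp.single_le_iff]
      exact Nat.one_le_iff_ne_zero.mpr hi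
    obtain ⟨γ, rfl⟩ := exists_add_of_le hle
    rw [add_comm] at hα ⊢
    rw [map_add, Finsupp.degree_single] at hα
    rw [iterDeriv_add_single, Module.End.mul_apply, Derivation.coeFn_coe,
      MvPolynomial.pderiv_monomial]
    by_cases hβ : β i = 0
    · rw [hβ, if_neg]
      · simp
      · intro h
        have := h i
        simp [hβ] at this
    · have hle' : Finsupp.single i 1 ≤ β := by
        rw [Finsupp.single_le_iff]
        exact Nat.one_le_iff_ne_zero.mpr hβ
      obtain ⟨δ, rfl⟩ := exists_add_of_le hle'
      rw [add_comm (Finsupp.single i 1) δ, add_tsub_cancel_right, multiFactorial_add_single]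
      have h1 : ((((δ i + 1) * multiFactorial δ : ℕ) : K)⁻¹ * (((δ + Finsupp.single i 1 : Fin n →₀ ℕ) i : ℕ) : K)) =
          (multiFactorial δ : K)⁻¹ := by
        have h2 : ((δ i : K) + 1) ≠ 0 := by exact_mod_cast (δ i).succ_ne_zero
        rw [Finsupp.add_apply, Finsupp.single_eq_same]
        push_cast
        field_simp
      rw [h1, ih γ (by omega)]
      simp only [add_le_add_iff_right, add_tsub_add_eq_tsub_right]

theorem sigma_slotVec_self [CharZero K] (s : Slot n) : sigma s (slotVec s : WeylSpace K n) = 1 := by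
  have h : ∀ α : Fin n →₀ ℕ,
      iterDeriv α (MvPolynomial.monomial α (multiFactorial α : K)⁻¹) = 1 := fun α => by
    rw [iterDeriv_monomial, if_pos le_rfl, tsub_self]
    simp [multiFactorial]
  obtain ⟨α, o⟩ := s
  cases o with
  | none => exact h α
  | some i => simpa [sigma, slotVec, inForm_apply] using h α

theorem le_of_sigma_slotVec_ne_zero [CharZero K] {s t : Slot n}
    (h : sigma t (slotVec s : WeylSpace K n) ≠ 0) : t.1 ≤ s.1 ∧ t.2 = s.2 := by
  have h1 : ∀ α β : Fin n →₀ ℕ,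
      iterDeriv α (MvPolynomial.monomial β (multiFactorial β : K)⁻¹) ≠ 0 → α ≤ β := fun α β h => by
    rw [iterDeriv_monomial] at h
    by_contra h'
    exact h (if_neg h')
  obtain ⟨α, o⟩ := t
  obtain ⟨β, o'⟩ := s
  cases o with
  | none =>
    cases o' with
    | none => exact ⟨h1 _ _ h, rfl⟩
    | some j => exact absurd (map_zero _) h
  | some i =>
    cases o' with
    | none => exact absurd (map_zero _) h
    | some j =>
      by_cases hij : i = j
      · subst hij
        refine ⟨h1 _ _ ?_, rfl⟩
        simpa [sigma, slotVec, inForm_apply] using h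
      · refine absurd ?_ h
        simp [sigma, slotVec, inForm_apply, hij]

/-- The pairing of `σ` with `slotVec` is triangular with ones on the diagonal. Testing the
difference of two symbols on the vectors of an index `s` of least total degree in its support leaves
only the coefficient at `s`. -/
theorem IsOperatorOf.unique [CharZero K] {l : ℕ} {Φ Φ' : Symbol K n l}
    {g : (ℕ → WeylSpace K n) → WeylSpace K n} (h : IsOperatorOf Φ g) (h' : IsOperatorOf Φ' g) :
    Φ = Φ' := by
  by_contra hne
  rw [← Ne, ← sub_ne_zero] at hne
  have h0 : ∀ a : ℕ → WeylSpace K n,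
      (∑ᶠ s : Fin l → Slot n, (∏ k, sigma (s k) (a k)) • (Φ - Φ') s) = 0 := fun a => by
    simp only [Pi.sub_apply, smul_sub]
    rw [finsum_sub_distrib (finite_support_sigma l a Φ) (finite_support_sigma l a Φ'), ← h, ← h',
      sub_self]
  have hex : ∃ N, ∃ s : Fin l → Slot n, (Φ - Φ') s ≠ 0 ∧ ∑ k, (s k).1.degree = N := by
    obtain ⟨s, hs⟩ := Function.ne_iff.mp hne
    exact ⟨_, s, hs, rfl⟩
  classical
  obtain ⟨s, hs, hN⟩ := Nat.find_spec hex
  have hmin := fun N hN => Nat.find_min hex (m := N) hN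
  let a : ℕ → WeylSpace K n := fun j => if h : j < l then slotVec (s ⟨j, h⟩) else 0
  have ha : ∀ k : Fin l, a k = slotVec (s k) := fun k => dif_pos k.2
  have h1 := h0 a
  rw [finsum_eq_single _ s] at h1
  · rw [Finset.prod_eq_one fun k _ => by rw [ha, sigma_slotVec_self], one_smul] at h1
    exact hs h1
  · intro t ht
    by_contra hne'
    have h2 : ∀ k, (t k).1 ≤ (s k).1 ∧ (t k).2 = (s k).2 := fun k =>
      le_of_sigma_slotVec_ne_zero (K := K) fun h3 => hne' (by
        rw [Finset.prod_eq_zero (Finset.mem_univ k) (by rw [ha, h3]), zero_smul])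
    have h3 : (Φ - Φ') t ≠ 0 := fun h3 => hne' (by rw [h3, smul_zero])
    have h4 : ∀ k, (t k).1.degree ≤ (s k).1.degree := fun k => Finsupp.degree_mono (h2 k).1
    -- Minimality forces equality of the total degrees, hence of each exponent, so `t = s`.
    have h5 : ∑ k, (t k).1.degree = ∑ k, (s k).1.degree := by
      refine le_antisymm (Finset.sum_le_sum fun k _ => h4 k) ?_
      by_contra h6
      exact hmin _ (by rw [← hN]; omega) ⟨t, h3, rfl⟩
    refine ht (funext fun k => ?_)
    have h6 := (Finset.sum_eq_sum_iff_of_le fun k _ => h4 k).mp h5 k (Finset.mem_univ k)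
    obtain ⟨γ, hγ⟩ := exists_add_of_le (h2 k).1
    rw [hγ, map_add] at h6
    have h7 : γ = 0 := by
      rw [← Finsupp.degree_eq_zero_iff]
      omega
    rw [h7, add_zero] at hγ
    exact Prod.ext hγ.symm (h2 k).2

theorem IsHomotopyImage.unique [CharZero K] {l : ℕ}
    {g f f' : (ℕ → WeylSpace K n) → WeylSpace K n}
    (h : IsHomotopyImage l g f) (h' : IsHomotopyImage l g f') : f = f' := by
  obtain ⟨Φ, h1, h2⟩ := h
  obtain ⟨Φ', h1', h2'⟩ := h'
  obtain rfl := h1.unique h1'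
  funext a
  rw [h2 a, h2' a]

/-! ### The homotopy operator on symbols -/

/-- The operator `T` on series is dual to the operator `D`. -/
def IsDualTo (T : Module.End K (Series n (WeylSpace K n))) (D : WeylSpace K n →ₗ[K] WeylSpace K n) :
    Prop :=
  ∀ (H : WeylSpace K n → WeylSpace K n), IsLinearMap K H →
    ∀ s : Slot n, T (fun t => H (slotVec t)) s = H (D (slotVec s))

theorem isDualTo_seriesParity :
    IsDualTo (seriesParity K n (WeylSpace K n)) barParity := by
  intro H hH s
  obtain ⟨α, o⟩ := s
  cases o with
  | none =>
    change -H _ = _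
    rw [← hH.map_neg]
    congr 1
    ext1 <;> simp [slotVec, inFun_apply, barParity_apply]
  | some i =>
    change H _ = _
    congr 1
    ext1 <;> simp [slotVec, inForm_apply, barParity_apply]

theorem poincare_slotVec [CharZero K] (α : Fin n →₀ ℕ) (i : Fin n) :
    poincare (slotVec (α, some i) : WeylSpace K n) =
      (((α.degree : K) + 1)⁻¹ * ((α i : K) + 1)) •
        (slotVec (α + Finsupp.single i 1, none) : WeylSpace K n) := by
  have h1 : ∀ j, (MvPolynomial.X j : MvPolynomial (Fin n) K) *
      rayIntegral ((slotVec (α, some i) : WeylSpace K n).2 j) =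
        if j = i then MvPolynomial.X i *
          rayIntegral (MvPolynomial.monomial α (multiFactorial α : K)⁻¹) else 0 := by
    intro j
    split_ifs with h
    · subst h; simp [slotVec, inForm_apply]
    · simp [slotVec, inForm_apply, h]
  rw [poincare_apply, Finset.sum_congr rfl fun j _ => h1 j, Finset.sum_ite_eq' _ _ _,
    if_pos (Finset.mem_univ _), rayIntegral_monomial, MvPolynomial.X, MvPolynomial.monomial_mul,
    add_comm (Finsupp.single i 1), one_mul]
  ext1
  · simp only [slotVec, inFun_apply, Prod.smul_fst, MvPolynomial.smul_monomial, smul_eq_mul,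
      multiFactorial_add_single]
    congr 1
    have h2 : ((α i : K) + 1) ≠ 0 := by exact_mod_cast (α i).succ_ne_zero
    push_cast
    field_simp
  · simp [slotVec, inFun_apply]

/-- With `p^α` paired to `x^α / α!`, the derivative `∂/∂p_i` is dual to multiplication by `x^i`, and
both ray integrals have the weight `1/(|α| + 1)`. -/
theorem isDualTo_homotopy [CharZero K] : IsDualTo (homotopy K n (WeylSpace K n)) poincare := by
  intro H hH s
  obtain ⟨α, o⟩ := s
  cases o with
  | none =>
    change 0 = _
    rw [show poincare (slotVec (α, none) : WeylSpace K n) = 0 by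
      simp [slotVec, poincare_apply, inFun_apply], hH.map_zero]
  | some i =>
    change psIntegral K (psDeriv i fun β => H (slotVec (β, none))) α = _
    rw [poincare_slotVec, hH.map_smul, psIntegral, psDeriv, mul_smul]
    congr 1
    rw [← Nat.cast_smul_eq_nsmul K]
    push_cast
    rfl

theorem diff_slotVec [CharZero K] (α : Fin n →₀ ℕ) :
    diff (slotVec (α, none) : WeylSpace K n) =
      ∑ i, if α i = 0 then 0 else slotVec (α - Finsupp.single i 1, some i) := by
  have h : ∀ i, (if α i = 0 then 0 else slotVec (α - Finsupp.single i 1, some i)) =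
      inForm K i (MvPolynomial.pderiv i (MvPolynomial.monomial α (multiFactorial α : K)⁻¹)) := by
    intro i
    rw [MvPolynomial.pderiv_monomial]
    split_ifs with h
    · simp [h]
    · have hle : Finsupp.single i 1 ≤ α := by
        rw [Finsupp.single_le_iff]
        exact Nat.one_le_iff_ne_zero.mpr h
      obtain ⟨δ, rfl⟩ := exists_add_of_le hle
      rw [add_comm (Finsupp.single i 1) δ, add_tsub_cancel_right, multiFactorial_add_single,
        slotVec]
      congr 2
      have h2 : ((δ i : K) + 1) ≠ 0 := by exact_mod_cast (δ i).succ_ne_zero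
      rw [Finsupp.add_apply, Finsupp.single_eq_same]
      push_cast
      field_simp
  simp only [h]
  rw [sum_inForm fun i =>
    MvPolynomial.pderiv i (MvPolynomial.monomial α (multiFactorial α : K)⁻¹)]
  rfl

/-- On functions `1 - h d` leaves the constant. On one-forms `π = 1 - d h`; here multiplication by
`p_i` is dual to `∂/∂x^i`, and the weights match since adding one unit to an exponent and removing
another preserves `|α|`. -/
theorem isDualTo_projection [CharZero K] :
    IsDualTo (projection K n (WeylSpace K n)) poincareProj := by
  intro H hH s
  obtain ⟨α, o⟩ := s
  cases o with
  | none =>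
    change (if α = 0 then H (slotVec (0, none)) else 0) = _
    have h1 : poincareProj (slotVec (α, none) : WeylSpace K n) =
        if α = 0 then slotVec (0, none) else 0 := by
      rw [poincareProj_apply, poincare_diff, show poincare (slotVec (α, none) : WeylSpace K n) = 0 by
        simp [slotVec, poincare_apply, inFun_apply], map_zero, sub_zero]
      split_ifs with h
      · subst h
        ext1 <;> simp [slotVec, inFun_apply]
      · ext1
        · simp [slotVec, inFun_apply, MvPolynomial.coeff_monomial, h]
        · simp [slotVec, inFun_apply]
    rw [h1]
    split_ifs
    · rfl
    · exact hH.map_zero.symm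
  | some j =>
    change H (slotVec (α, some j)) - psDeriv j
      (∑ i, psMul i (psIntegral K fun β => H (slotVec (β, some i)))) α = _
    have h1 : diff (slotVec (α, some j) : WeylSpace K n) = 0 := by
      simp [slotVec, diff_apply, inForm_apply, Prod.ext_iff, funext_iff, grad]
    rw [poincareProj_apply, h1, map_zero, sub_zero, poincare_slotVec, map_smul, diff_slotVec,
      hH.map_sub, hH.map_smul, ← hH.mk'_apply, ← hH.mk'_apply, map_sum, psDeriv, Finset.sum_apply,
      mul_comm, mul_smul, Finset.smul_sum]
    congr 1
    rw [Finset.smul_sum, Finset.smul_sum]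
    refine Finset.sum_congr rfl fun i _ => ?_
    rw [← Nat.cast_smul_eq_nsmul K, Nat.cast_add, Nat.cast_one]
    congr 1
    rw [psMul]
    split_ifs with h
    · simp [hH.map_zero]
    · rw [psIntegral]
      have h3 : (α + Finsupp.single j 1 - Finsupp.single i 1).degree = α.degree := by
        have hle : Finsupp.single i 1 ≤ α + Finsupp.single j 1 := by
          rw [Finsupp.single_le_iff]
          exact Nat.one_le_iff_ne_zero.mpr h
        have h4 := congrArg Finsupp.degree (tsub_add_cancel_of_le hle)
        rw [map_add, map_add, Finsupp.degree_single, Finsupp.degree_single] at h4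
        omega
      rw [h3]
      rfl

theorem onSlot_succ_prod {l : ℕ} (T : Fin l → Module.End K (Series n (WeylSpace K n)))
    (J : List (Fin l)) (Φ : Symbol K n (l + 1)) (t : Slot n) (s : Fin l → Slot n) :
    (J.map fun j => onSlot j.succ (T j)).prod Φ (Fin.cons t s) =
      (J.map fun j => onSlot j (T j)).prod (fun s' => Φ (Fin.cons t s')) s := by
  induction J generalizing s with
  | nil => rfl
  | cons j J ih =>
    rw [List.map_cons, List.prod_cons, List.map_cons, List.prod_cons, Module.End.mul_apply,
      Module.End.mul_apply]
    change T j (fun t' => _) _ = T j (fun t' => _) _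
    rw [Fin.cons_succ]
    refine congrFun (congrArg (T j) (funext fun t' => ?_)) _
    rw [← Fin.cons_update, ih]

/-- Operators in different slots act on different arguments, so the duality can be applied one
argument at a time. -/
theorem onSlot_prod_symb {l : ℕ} (T : Fin l → Module.End K (Series n (WeylSpace K n)))
    (D : Fin l → WeylSpace K n →ₗ[K] WeylSpace K n) (h : ∀ j, IsDualTo (T j) (D j))
    {G : List (WeylSpace K n) → WeylSpace K n} (hG : Multi K G) (s : Fin l → Slot n) :
    (List.ofFn fun j => onSlot j (T j)).prod (symb l G) s =
      G (List.ofFn fun j => D j (slotVec (s j))) := by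
  induction l generalizing G with
  | zero => simp [symb]
  | succ l ih =>
    obtain ⟨t, s, rfl⟩ : ∃ t s', s = Fin.cons t s' := ⟨s 0, Fin.tail s, (Fin.cons_self_tail s).symm⟩
    rw [List.ofFn_succ, List.prod_cons, Module.End.mul_apply]
    have h1 : ∀ t', (List.ofFn fun j : Fin l => onSlot j.succ (T j.succ)).prod (symb (l + 1) G)
        (Fin.cons t' s) = G (slotVec t' :: List.ofFn fun j => D j.succ (slotVec (s j))) := by
      intro t'
      rw [List.ofFn_eq_map, onSlot_succ_prod (fun j => T j.succ), ← List.ofFn_eq_map]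
      have h2 : (fun s' => symb (l + 1) G (Fin.cons t' s')) = symb l (tailFun (slotVec t') G) := by
        funext s'
        rw [symb, List.ofFn_succ]
        rfl
      rw [h2]
      exact ih (fun j => T j.succ) (fun j => D j.succ) (fun j => h j.succ) (hG.tailFun _) s
    change T 0 (fun t' => _) _ = _
    simp only [Fin.update_cons_zero, h1]
    rw [h 0 _ (hG.cons _), List.ofFn_succ]
    simp

theorem sum_ofFn_eq_htpy {l : ℕ} (G : List (WeylSpace K n) → WeylSpace K n)
    (a : Fin l → WeylSpace K n) :
    ∑ i : Fin l, G (List.ofFn fun j : Fin l =>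
      (if j < i then barParity else if j = i then poincare else poincareProj :
        WeylSpace K n →ₗ[K] WeylSpace K n) (a j)) = htpy G (List.ofFn a) := by
  induction l generalizing G with
  | zero => simp
  | succ l ih =>
    rw [Fin.sum_univ_succ, List.ofFn_succ (f := a), htpy_cons, ← ih]
    congr 1
    · rw [List.ofFn_succ, List.map_ofFn]
      simp [Fin.succ_ne_zero]
      rfl
    · refine Finset.sum_congr rfl fun i _ => ?_
      rw [List.ofFn_succ]
      simp

theorem homotopyTensor_symb [CharZero K] (l : ℕ) {G : List (WeylSpace K n) → WeylSpace K n}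
    (hG : Multi K G) : homotopyTensor K n l (symb l G) = symb l (htpy G) := by
  funext s
  rw [homotopyTensor, LinearMap.sum_apply, Finset.sum_apply]
  refine Eq.trans (Finset.sum_congr rfl fun i _ => ?_) (sum_ofFn_eq_htpy G fun j => slotVec (s j))
  refine onSlot_prod_symb _ _ (fun j => ?_) hG s
  split_ifs
  · exact isDualTo_seriesParity
  · exact isDualTo_homotopy
  · exact isDualTo_projection

/-- `symb l (shift (-1) F)` is the symbol of `F`, and on symbols the tensor homotopy is `htpy`;
hence `opHtpy` realises `h^Σ_l`. -/
theorem isHomotopyImage_opHtpy [CharZero K] (l : ℕ) {F : List (WeylSpace K n) → WeylSpace K n}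
    (hF : Multi K F) :
    IsHomotopyImage l (fun a => F (seqList l a)) fun a => opHtpy F (seqList l a) := by
  refine ⟨symb l (shift (-1) F), ?_, ?_⟩
  · have h := isOperatorOf_symb l (shift (-1 : K) F)
    rwa [shift_shift _ _ hF, add_neg_cancel, shift_zero hF] at h
  · rw [homotopyTensor_symb l (hF.shift (-1))]
    exact isOperatorOf_symb l _

/-! ### Existence and uniqueness -/

theorem satisfiesRecurrence_solution [CharZero K] (θ θ' : Matrix (Fin n) (Fin n) K) :
    SatisfiesRecurrence θ θ' (toCochain (solution θ θ') (multi_solution θ θ')) where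
  zero := MultilinearMap.ext fun a => by
    rw [toCochain_apply, List.ofFn_zero, solution_nil]
    rfl
  initial a := by rw [ev_toCochain, seqList_succ, seqList_zero, solution_single]
  degree_zero l hl := by
    have hm := multi_solution θ θ'
    have h := isHomotopyImage_opHtpy l (hm.psi θ θ').funPart.neg
    convert h using 1
    · funext a
      rw [Psi_toCochain hm (solution_nil θ θ')]
      rfl
    · funext a
      rw [ev_toCochain]
      exact funPart_solution θ θ' (by simpa using hl)
  degree_one l hl := by
    have hm := multi_solution θ θ'
    have h := isHomotopyImage_opHtpy l ((hm.funPart.postcomp diff).sub (hm.psi θ θ').formPart)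
    convert h using 1
    · funext a
      rw [Psi_toCochain hm (solution_nil θ θ'), ev_toCochain]
      rfl
    · funext a
      rw [ev_toCochain]
      exact formPart_solution θ θ' (by simpa using hl)

theorem Psi_congr {θ θ' : Matrix (Fin n) (Fin n) K}
    {f g : Cochain K (WeylSpace K n) (WeylSpace K n)} {l : ℕ} (h : ∀ k < l, f k = g k)
    (a : ℕ → WeylSpace K n) : Psi θ θ' f l a = Psi θ θ' g l a := by
  rw [Psi, Psi]
  refine congrArg₂ _ (Finset.sum_congr rfl fun i hi => ?_) (Finset.sum_congr rfl fun i hi => ?_)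
  · rw [Finset.mem_range] at hi
    rw [ev, ev, h _ (by omega)]
  · rw [Finset.mem_Icc] at hi
    rw [ev, ev, ev, ev, h i (by omega), h (l - i) (by omega)]

theorem part0_add_part1 (a : WeylSpace K n) : part0 a + part1 a = a := funPart_add_formPart a

/-- Strong induction on the arity: `Ψ_l` sees lower arities only, `f'_l` depends on the already
determined `f''_l`, and `h^Σ_l` is single-valued by uniqueness of symbols. -/
theorem SatisfiesRecurrence.unique [CharZero K] {θ θ' : Matrix (Fin n) (Fin n) K}
    {f g : Cochain K (WeylSpace K n) (WeylSpace K n)} (hf : SatisfiesRecurrence θ θ' f)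
    (hg : SatisfiesRecurrence θ θ' g) : f = g := by
  funext l
  induction l using Nat.strong_induction_on with
  | _ l ih =>
    rcases Nat.eq_zero_or_pos l with rfl | hl
    · rw [hf.zero, hg.zero]
    have h0 : ∀ a : ℕ → WeylSpace K n, part0 (ev f l a) = part0 (ev g l a) := by
      obtain rfl | hl2 : l = 1 ∨ 2 ≤ l := by omega
      · intro a
        rw [hf.initial, hg.initial]
      · have h1 := hf.degree_zero l hl2
        simp only [Psi_congr ih] at h1
        exact congrFun (h1.unique (hg.degree_zero l hl2))
    have h1 : ∀ a : ℕ → WeylSpace K n, part1 (ev f l a) = part1 (ev g l a) := by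
      have h1 := hf.degree_one l hl
      simp only [Psi_congr ih, h0] at h1
      exact congrFun (h1.unique (hg.degree_one l hl))
    refine MultilinearMap.ext fun a => ?_
    have h2 : ∀ b : ℕ → WeylSpace K n, ev f l b = ev g l b := fun b => by
      rw [← part0_add_part1 (ev f l b), h0, h1, part0_add_part1]
    have h3 := h2 fun j => if h : j < l then a ⟨j, h⟩ else 0
    simpa [ev] using h3

theorem isNormal_toCochain {F : List (WeylSpace K n) → WeylSpace K n} (hF : Multi K F)
    (h : UnitFree (F - singleFun)) {l : ℕ} (hl : 2 ≤ l) : IsNormal (toCochain F hF l) := by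
  rintro a ⟨i, hi⟩
  have h1 := h ((List.ofFn a).take i) ((List.ofFn a).drop (i + 1))
  rw [← hi, ← ofFn_update, Function.update_eq_self, Pi.sub_apply] at h1
  rw [toCochain_apply]
  have h2 : singleFun (List.ofFn a) = 0 := by
    match l, hl, a with
    | l + 2, _, a => rw [List.ofFn_succ, List.ofFn_succ]; rfl
  rwa [h2, sub_zero] at h1

end Symbols

/-! ### Insertions of gauge parameters and the Seiberg–Witten equations. -/

section GaugeTheory

set_option linter.unusedSectionVars false

variable {K : Type*} [Field K] {n : ℕ} {V W X : Type*} [AddCommGroup V] [Module K V]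
  [AddCommGroup W] [Module K W] [AddCommGroup X] [Module K X]

/-! ### Insertions into constant words -/

variable (K) in
/-- The sum of `F (A, …, A, x, A, …, A)` over all words of length `l`. -/
def insertion (A x : V) : ℕ → (List V → X) →ₗ[K] X
  | 0 => 0
  | l + 1 => LinearMap.proj (x :: List.replicate l A) + insertion A x l ∘ₗ tailOp K A

variable (K) in
/-- The sum of `F (A, …, A, x, A, …, A, y, A, …, A)` over all words of length `l`. -/
def insertionTwo (A x y : V) : ℕ → (List V → X) →ₗ[K] X
  | 0 => 0
  | l + 1 => insertion K A y l ∘ₗ tailOp K x + insertionTwo A x y l ∘ₗ tailOp K A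

theorem insertion_succ (A x : V) (l : ℕ) (F : List V → X) :
    insertion K A x (l + 1) F =
      F (x :: List.replicate l A) + insertion K A x l (tailFun A F) := rfl

theorem insertionTwo_succ (A x y : V) (l : ℕ) (F : List V → X) :
    insertionTwo K A x y (l + 1) F =
      insertion K A y l (tailFun x F) + insertionTwo K A x y l (tailFun A F) := rfl

theorem postcomp_insertion (T : W →ₗ[K] X) (A x : V) (l : ℕ) (F : List V → W) :
    T (insertion K A x l F) = insertion K A x l fun L => T (F L) := by
  induction l generalizing F with
  | zero => exact map_zero T
  | succ l ih => rw [insertion_succ, insertion_succ, map_add, ih]; rfl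

theorem postcomp_insertionTwo (T : W →ₗ[K] X) (A x y : V) (l : ℕ) (F : List V → W) :
    T (insertionTwo K A x y l F) = insertionTwo K A x y l fun L => T (F L) := by
  induction l generalizing F with
  | zero => exact map_zero T
  | succ l ih => rw [insertionTwo_succ, insertionTwo_succ, map_add, ih, postcomp_insertion]; rfl

theorem insertion_map (T : V → V) (A x : V) (l : ℕ) (F : List V → X) :
    insertion K A x l (fun L => F (L.map T)) = insertion K (T A) (T x) l F := by
  induction l generalizing F with
  | zero => rfl
  | succ l ih =>
    rw [insertion_succ, insertion_succ, ← ih]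
    simp only [List.map_cons, List.map_replicate]
    rfl

theorem insertionTwo_map (T : V → V) (A x y : V) (l : ℕ) (F : List V → X) :
    insertionTwo K A x y l (fun L => F (L.map T)) = insertionTwo K (T A) (T x) (T y) l F := by
  induction l generalizing F with
  | zero => rfl
  | succ l ih =>
    rw [insertionTwo_succ, insertionTwo_succ, ← ih, ← insertion_map]
    rfl

theorem isLinearMap_insertion {F : List V → X} (hF : Multi K F) (A : V) (l : ℕ) :
    IsLinearMap K fun x => insertion K A x l F := by
  induction l generalizing F with
  | zero => exact isLinearMap_zero
  | succ l ih => exact isLinearMap_add (hF.cons _) (ih (hF.tailFun A))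

theorem isLinearMap_insertionTwo_left {F : List V → X} (hF : Multi K F) (A y : V) (l : ℕ) :
    IsLinearMap K fun x => insertionTwo K A x y l F := by
  induction l generalizing F with
  | zero => exact isLinearMap_zero
  | succ l ih =>
    exact isLinearMap_add (insertion K A y l ∘ₗ hF.tailLin).isLinear (ih (hF.tailFun A))

theorem isLinearMap_insertionTwo_right {F : List V → X} (hF : Multi K F) (A x : V) (l : ℕ) :
    IsLinearMap K fun y => insertionTwo K A x y l F := by
  induction l generalizing F with
  | zero => exact isLinearMap_zero
  | succ l ih =>
    exact isLinearMap_add (isLinearMap_insertion (hF.tailFun x) A l) (ih (hF.tailFun A))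

theorem replicate_smul {F : List V → X} (hF : Multi K F) (t : K) (A : V) (l : ℕ) :
    F (List.replicate l (t • A)) = t ^ l • F (List.replicate l A) := by
  induction l generalizing F with
  | zero => simp
  | succ l ih =>
    change tailFun (t • A) F (List.replicate l (t • A)) = t ^ (l + 1) • tailFun A F _
    rw [hF.tailFun_smul, Pi.smul_apply, ih (hF.tailFun A), smul_smul, ← pow_succ']

theorem insertion_smul {F : List V → X} (hF : Multi K F) (t : K) (A x : V) (l : ℕ) :
    insertion K (t • A) x (l + 1) F = t ^ l • insertion K A x (l + 1) F := by
  induction l generalizing F with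
  | zero => simp [insertion]
  | succ l ih =>
    rw [insertion_succ, insertion_succ _ _ (l + 1), hF.tailFun_smul, map_smul, ih (hF.tailFun A),
      smul_smul, ← pow_succ', smul_add]
    congr 1
    exact replicate_smul (hF.tailFun x) t A (l + 1)

/-! ### Directional derivatives -/

/-- `g (t) = a + b t + O (t²)`. -/
def HasExpansion (g : K → X) (a b : X) : Prop :=
  ∃ (N : ℕ) (c : ℕ → X), ∀ t : K, g t = a + t • b + ∑ k ∈ Finset.range N, t ^ (k + 2) • c k

theorem HasExpansion.const (a : X) : HasExpansion (fun _ : K => a) a 0 := ⟨0, 0, by simp⟩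

theorem HasExpansion.add {g g' : K → X} {a b a' b' : X} (h : HasExpansion g a b)
    (h' : HasExpansion g' a' b') : HasExpansion (fun t => g t + g' t) (a + a') (b + b') := by
  obtain ⟨N, c, hc⟩ := h
  obtain ⟨N', c', hc'⟩ := h'
  refine ⟨max N N', fun k => (if k < N then c k else 0) + if k < N' then c' k else 0, fun t => ?_⟩
  have h1 : ∀ (M : ℕ) (e : ℕ → X), M ≤ max N N' → ∑ k ∈ Finset.range M, t ^ (k + 2) • e k =
      ∑ k ∈ Finset.range (max N N'), t ^ (k + 2) • if k < M then e k else 0 := by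
    intro M e hM
    rw [← Finset.sum_subset (Finset.range_subset_range.mpr hM)]
    · refine Finset.sum_congr rfl fun k hk => ?_
      rw [if_pos (Finset.mem_range.mp hk)]
    · intro k _ hk
      rw [if_neg (fun h => hk (Finset.mem_range.mpr h)), smul_zero]
  dsimp only
  rw [hc, hc', h1 N c (le_max_left _ _), h1 N' c' (le_max_right _ _)]
  simp only [smul_add, Finset.sum_add_distrib]
  abel

theorem HasExpansion.smul {g : K → X} {a b : X} (h : HasExpansion g a b) :
    HasExpansion (fun t => t • g t) 0 a := by
  obtain ⟨N, c, hc⟩ := h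
  -- Multiplication by `t` shifts all coefficients; the former linear coefficient `b` becomes that
  -- of `t²`.
  refine ⟨N + 1, fun k => Nat.casesOn k b c, fun t => ?_⟩
  dsimp only
  rw [hc, Finset.sum_range_succ', smul_add, smul_add, Finset.smul_sum, zero_add, add_assoc,
    add_comm (t • t • b)]
  simp only [smul_smul]
  congr 2
  · refine Finset.sum_congr rfl fun k _ => ?_
    rw [← pow_succ']
  · rw [zero_add, pow_two]
    rfl

theorem HasExpansion.map {g : K → X} {a b : X} (h : HasExpansion g a b) (T : X →ₗ[K] W) :
    HasExpansion (fun t => T (g t)) (T a) (T b) := by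
  obtain ⟨N, c, hc⟩ := h
  refine ⟨N, fun k => T (c k), fun t => ?_⟩
  dsimp only
  rw [hc]
  simp

theorem hasExpansion_replicate {F : List V → X} (hF : Multi K F) (A v : V) (l : ℕ) :
    HasExpansion (fun t : K => F (List.replicate l (A + t • v))) (F (List.replicate l A))
      (insertion K A v l F) := by
  induction l generalizing F with
  | zero => exact HasExpansion.const (K := K) (F [])
  | succ l ih =>
    have h := (ih (hF.tailFun A)).add (ih (hF.tailFun v)).smul
    convert h using 1
    · funext t
      have h1 : tailFun (A + t • v) F (List.replicate l (A + t • v)) = _ :=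
        congrFun (hF.tailFun_add A (t • v)) (List.replicate l (A + t • v))
      rwa [hF.tailFun_smul] at h1
    · exact (add_zero _).symm
    · exact add_comm _ _

/-- The variation `v` can stand to the right or to the left of `x`, hence two terms. -/
theorem hasExpansion_insertion {F : List V → X} (hF : Multi K F) (A v x : V) (l : ℕ) :
    HasExpansion (fun t : K => insertion K (A + t • v) x l F) (insertion K A x l F)
      (insertionTwo K A x v l F + insertionTwo K A v x l F) := by
  induction l generalizing F with
  | zero =>
    change HasExpansion (fun _ : K => (0 : X)) 0 (0 + 0)
    rw [add_zero]
    exact HasExpansion.const 0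
  | succ l ih =>
    have h := (hasExpansion_replicate (hF.tailFun x) A v l).add
      ((ih (hF.tailFun A)).add (ih (hF.tailFun v)).smul)
    convert h using 1
    · funext t
      rw [insertion_succ, hF.tailFun_add, hF.tailFun_smul, map_add, map_smul]
      rfl
    · rw [insertion_succ, add_zero]
      rfl
    · rw [insertionTwo_succ, insertionTwo_succ]
      abel

/-! ### Insertions and products -/

theorem cup_replicate (θ : Matrix (Fin n) (Fin n) K)
    (F G : List (WeylSpace K n) → WeylSpace K n) (A : WeylSpace K n) (l : ℕ) :
    cup θ F G (List.replicate l A) = ∑ r ∈ Finset.HasAntidiagonal.antidiagonal l,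
      starMul θ (F (List.replicate r.1 A)) (G (List.replicate r.2 A)) := by
  induction l generalizing F with
  | zero => simp
  | succ l ih =>
    rw [List.replicate_succ, cup_cons, ih, Finset.Nat.sum_antidiagonal_succ]
    rfl

theorem tailFun_cup (θ : Matrix (Fin n) (Fin n) K)
    (F G : List (WeylSpace K n) → WeylSpace K n) (a : WeylSpace K n) :
    tailFun a (cup θ F G) = (fun L => starMul θ (F []) (tailFun a G L)) + cup θ (tailFun a F) G :=
  rfl

theorem insertion_cup (θ : Matrix (Fin n) (Fin n) K)
    (F G : List (WeylSpace K n) → WeylSpace K n) (A x : WeylSpace K n) (l : ℕ) :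
    insertion K A x l (cup θ F G) = ∑ r ∈ Finset.HasAntidiagonal.antidiagonal l,
      (starMul θ (insertion K A x r.1 F) (G (List.replicate r.2 A)) +
        starMul θ (F (List.replicate r.1 A)) (insertion K A x r.2 G)) := by
  induction l generalizing F with
  | zero => simp [insertion]
  | succ l ih =>
    have h0 : insertion K A x 0 F = 0 := rfl
    have h1 : ∀ r, F (List.replicate (r + 1) A) = tailFun A F (List.replicate r A) := fun _ => rfl
    have h2 : ∀ r, F (x :: List.replicate r A) = tailFun x F (List.replicate r A) := fun _ => rfl
    rw [insertion_succ, cup_cons, cup_replicate, tailFun_cup, map_add, ih,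
      ← postcomp_insertion, Finset.Nat.sum_antidiagonal_succ]
    simp only [h0, h1, h2, insertion_succ, map_add, map_zero, LinearMap.add_apply,
      LinearMap.zero_apply, Finset.sum_add_distrib, zero_add, List.replicate_zero]
    abel

theorem insertionTwo_cup (θ : Matrix (Fin n) (Fin n) K)
    (F G : List (WeylSpace K n) → WeylSpace K n) (A x y : WeylSpace K n) (l : ℕ) :
    insertionTwo K A x y l (cup θ F G) = ∑ r ∈ Finset.HasAntidiagonal.antidiagonal l,
      (starMul θ (insertionTwo K A x y r.1 F) (G (List.replicate r.2 A)) +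
        starMul θ (insertion K A x r.1 F) (insertion K A y r.2 G) +
        starMul θ (F (List.replicate r.1 A)) (insertionTwo K A x y r.2 G)) := by
  induction l generalizing F with
  | zero => simp [insertion, insertionTwo]
  | succ l ih =>
    have h0 : insertion K A x 0 F = 0 := rfl
    have h0' : insertionTwo K A x y 0 F = 0 := rfl
    have h1 : ∀ r, F (List.replicate (r + 1) A) = tailFun A F (List.replicate r A) := fun _ => rfl
    have h2 : ∀ r, F (x :: List.replicate r A) = tailFun x F (List.replicate r A) := fun _ => rfl
    rw [insertionTwo_succ, tailFun_cup, tailFun_cup, map_add, map_add, ih, insertion_cup,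
      ← postcomp_insertion, ← postcomp_insertionTwo, Finset.Nat.sum_antidiagonal_succ]
    simp only [h0, h0', h1, h2, insertion_succ, insertionTwo_succ, map_add, map_zero,
      LinearMap.add_apply, LinearMap.zero_apply, Finset.sum_add_distrib, zero_add,
      List.replicate_zero]
    abel

theorem insertion_contr (F : List (WeylSpace K n) → X)
    (θ : Matrix (Fin n) (Fin n) K) (A z x : WeylSpace K n) (l : ℕ) :
    insertion K A x (l + 1) (contr θ z F) = F (starMul θ z x :: List.replicate l A) +
      insertion K A x l (tailFun (starMul θ z A) F) := rfl

/-- No sign appears for one-forms because their products vanish. This commutativity of the source is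
what cancels its `m_2`-terms in the gauge equations. -/
theorem starMul_zero_comm (a b : WeylSpace K n) : starMul 0 a b = starMul 0 b a := by
  ext1
  · simp [starMul_apply, moyal_zero, mul_comm]
  · funext i
    simp only [starMul_apply, moyal_zero]
    ring

section Coderivation

variable {A : WeylSpace K n} (hA : A.1 = 0)

include hA

/-- There are no two-forms, so a one-form is closed and squares to zero. Consequently `delta` and
`mulCoder` vanish on words in `A` alone and only inserted letters contribute. -/
theorem diff_of_fst_eq_zero : diff A = 0 := by
  simp [diff_apply, hA, Prod.ext_iff, funext_iff, grad]

theorem scale_of_fst_eq_zero (t : K) : scale t A = A := by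
  ext1 <;> simp [scale_apply, hA]

theorem barParity_of_fst_eq_zero : barParity A = A := by
  rw [← scale_neg_one, scale_of_fst_eq_zero hA]

theorem starMul_self_of_fst_eq_zero (θ : Matrix (Fin n) (Fin n) K) : starMul θ A A = 0 := by
  simp [starMul_apply, hA, Prod.ext_iff, funext_iff]

theorem tailFun_delta_of_fst_eq_zero {F : List (WeylSpace K n) → X} (hF : Multi K F) :
    tailFun A (delta F) = delta (tailFun A F) := by
  funext L
  rw [tailFun_apply, delta_cons, diff_of_fst_eq_zero hA, barParity_of_fst_eq_zero hA,
    (hF.cons L).map_zero, zero_add]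

theorem tailFun_mulCoder_of_fst_eq_zero (θ : Matrix (Fin n) (Fin n) K)
    (F : List (WeylSpace K n) → X) :
    tailFun A (mulCoder θ F) = contr θ A F + mulCoder θ (tailFun A F) := by
  funext L
  rw [tailFun_apply, mulCoder_cons, barParity_of_fst_eq_zero hA]
  rfl

theorem delta_replicate {F : List (WeylSpace K n) → X} (hF : Multi K F) (l : ℕ) :
    delta F (List.replicate l A) = 0 := by
  induction l generalizing F with
  | zero => rfl
  | succ l ih =>
    have h := congrFun (tailFun_delta_of_fst_eq_zero hA hF) (List.replicate l A)
    exact h.trans (ih (hF.tailFun A))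

theorem contr_replicate {F : List (WeylSpace K n) → X} (hF : Multi K F)
    (θ : Matrix (Fin n) (Fin n) K) (l : ℕ) : contr θ A F (List.replicate l A) = 0 := by
  cases l with
  | zero => rfl
  | succ l =>
    rw [List.replicate_succ, contr_cons, starMul_self_of_fst_eq_zero hA]
    exact (hF.cons _).map_zero

theorem mulCoder_replicate {F : List (WeylSpace K n) → X} (hF : Multi K F)
    (θ : Matrix (Fin n) (Fin n) K) (l : ℕ) : mulCoder θ F (List.replicate l A) = 0 := by
  induction l generalizing F with
  | zero => rfl
  | succ l ih =>
    have h := congrFun (tailFun_mulCoder_of_fst_eq_zero hA θ F) (List.replicate l A)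
    rw [Pi.add_apply, contr_replicate hA hF, ih (hF.tailFun A), add_zero] at h
    exact h

theorem insertion_delta {F : List (WeylSpace K n) → X} (hF : Multi K F) (x : WeylSpace K n)
    (l : ℕ) : insertion K A x l (delta F) = insertion K A (diff x) l F := by
  induction l generalizing F with
  | zero => rfl
  | succ l ih =>
    rw [insertion_succ, insertion_succ, tailFun_delta_of_fst_eq_zero hA hF, ih (hF.tailFun A),
      delta_cons, delta_replicate hA (hF.tailFun _), add_zero]

theorem insertionTwo_delta {F : List (WeylSpace K n) → X} (hF : Multi K F)
    (x y : WeylSpace K n) (l : ℕ) : insertionTwo K A x y l (delta F) =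
      insertionTwo K A (diff x) y l F + insertionTwo K A (barParity x) (diff y) l F := by
  induction l generalizing F with
  | zero => simp [insertionTwo]
  | succ l ih =>
    rw [insertionTwo_succ, insertionTwo_succ, insertionTwo_succ,
      tailFun_delta_of_fst_eq_zero hA hF, ih (hF.tailFun A),
      show tailFun x (delta F) = tailFun (diff x) F + delta (tailFun (barParity x) F) from rfl,
      map_add, insertion_delta hA (hF.tailFun _)]
    abel

/-- Every word containing `A ⋆ x` arises twice, from the product of `x` with its left and with its
right neighbour. The signs are opposite because `x` has odd bar degree, and the products agree in
`A_0`. -/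
theorem insertion_mulCoder_zero {F : List (WeylSpace K n) → X} (hF : Multi K F)
    {x : WeylSpace K n} (hx : barParity x = -x) (l : ℕ) :
    insertion K A x l (mulCoder 0 F) = 0 := by
  induction l generalizing F with
  | zero => rfl
  | succ l ih =>
    rw [insertion_succ, tailFun_mulCoder_of_fst_eq_zero hA, map_add, ih (hF.tailFun A),
      mulCoder_cons, mulCoder_replicate hA (hF.tailFun _), add_zero, add_zero, hx]
    cases l with
    | zero => simp [insertion]
    | succ l =>
      rw [insertion_contr, starMul_self_of_fst_eq_zero hA, hF.tailFun_zero, map_zero,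
        List.replicate_succ, contr_cons, map_neg, LinearMap.neg_apply, (hF.cons _).map_neg, starMul_zero_comm A x]
      simp

theorem insertionTwo_contr {F : List (WeylSpace K n) → X} (hF : Multi K F)
    (θ : Matrix (Fin n) (Fin n) K) (x y : WeylSpace K n) (l : ℕ) :
    insertionTwo K A x y (l + 1) (contr θ A F) =
      insertion K A y l (tailFun (starMul θ A x) F) := by
  rw [insertionTwo_succ, tailFun_contr, tailFun_contr, starMul_self_of_fst_eq_zero hA,
    hF.tailFun_zero, map_zero, add_zero]

theorem insertionTwo_mulCoder_zero {F : List (WeylSpace K n) → X} (hF : Multi K F)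
    {x y : WeylSpace K n} (hx : barParity x = -x) (hy : barParity y = -y) (l : ℕ) :
    insertionTwo K A x y (l + 2) (mulCoder 0 F) =
      -F (starMul 0 x y :: List.replicate l A) +
        insertionTwo K A x y (l + 1) (mulCoder 0 (tailFun A F)) := by
  have h1 : contr 0 (-x) F = -contr 0 x F := by
    funext L
    exact (hF.contr_isLinear 0 L).map_neg x
  rw [insertionTwo_succ, tailFun_mulCoder_of_fst_eq_zero hA, map_add, insertionTwo_contr hA hF,
    show tailFun x (mulCoder 0 F) =
      contr 0 (barParity x) F + mulCoder 0 (tailFun (barParity x) F) from rfl,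
    map_add, insertion_mulCoder_zero hA (hF.tailFun _) hy, hx, h1, map_neg, insertion_contr,
    starMul_zero_comm A x]
  abel

/-- Products of `x` or `y` with `A` cancel as before, leaving `-F (…, x ⋆ y, …)` from adjacent
letters. This is symmetric and so disappears from the antisymmetrised consistency condition. -/
theorem insertionTwo_mulCoder_zero_comm {F : List (WeylSpace K n) → X} (hF : Multi K F)
    {x y : WeylSpace K n} (hx : barParity x = -x) (hy : barParity y = -y) (l : ℕ) :
    insertionTwo K A x y l (mulCoder 0 F) = insertionTwo K A y x l (mulCoder 0 F) := by
  induction l generalizing F with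
  | zero => rfl
  | succ l ih =>
    cases l with
    | zero => rfl
    | succ l =>
      rw [insertionTwo_mulCoder_zero hA hF hx hy, insertionTwo_mulCoder_zero hA hF hy hx,
        ih (hF.tailFun A), starMul_zero_comm x y]

end Coderivation

/-! ### Degrees -/

section Degrees

variable [CharZero K] {F : List (WeylSpace K n) → WeylSpace K n} (he : ScaleEquivariant F)
  {A x y : WeylSpace K n} (hA : A.1 = 0) (hx : x.2 = 0) (hy : y.2 = 0)

theorem scale_of_snd_eq_zero {x : WeylSpace K n} (hx : x.2 = 0) (t : K) : scale t x = t • x := by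
  ext1 <;> simp [scale_apply, hx]

include he hA

/-- Degree count: `scale 2` fixes the arguments, so the function component of the value equals twice
itself. -/
theorem fst_replicate (l : ℕ) : (F (List.replicate l A)).1 = 0 := by
  have h := congrFun (he 2 two_ne_zero) (List.replicate l A)
  rw [scaleArgs_apply, List.map_replicate, scale_of_fst_eq_zero hA] at h
  have h1 : (F (List.replicate l A)).1 = (2 : K) • (F (List.replicate l A)).1 :=
    congrArg Prod.fst h
  rw [two_smul] at h1
  exact left_eq_add.mp h1

include hx

theorem snd_insertion (hF : Multi K F) (l : ℕ) : (insertion K A x l F).2 = 0 := by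
  have h := insertion_map (K := K) (scale 2) A x l F
  rw [show (fun L => F (L.map (scale (2 : K)))) = fun L => scale 2 (F L) from he 2 two_ne_zero,
    ← postcomp_insertion, scale_of_fst_eq_zero hA, scale_of_snd_eq_zero hx,
    (isLinearMap_insertion hF A l).map_smul, two_smul] at h
  have h1 : (insertion K A x l F).2 = (insertion K A x l F).2 + (insertion K A x l F).2 :=
    congrArg Prod.snd h
  exact left_eq_add.mp h1

include hy

/-- With two functions among one-forms the value would have degree minus one. The scaling multiplies
it by `4`, which is neither of the weights `2` and `1` of functions and one-forms. -/
theorem insertionTwo_eq_zero (hF : Multi K F) (l : ℕ) : insertionTwo K A x y l F = 0 := by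
  have h := insertionTwo_map (K := K) (scale 2) A x y l F
  rw [show (fun L => F (L.map (scale (2 : K)))) = fun L => scale 2 (F L) from he 2 two_ne_zero,
    ← postcomp_insertionTwo, scale_of_fst_eq_zero hA, scale_of_snd_eq_zero hx,
    scale_of_snd_eq_zero hy, (isLinearMap_insertionTwo_left hF A _ l).map_smul,
    (isLinearMap_insertionTwo_right hF A _ l).map_smul, smul_smul] at h
  have h1 : (2 : K) • (insertionTwo K A x y l F).1 = (2 * 2 : K) • (insertionTwo K A x y l F).1 :=
    congrArg Prod.fst h
  have h2 : (insertionTwo K A x y l F).2 = (2 * 2 : K) • (insertionTwo K A x y l F).2 :=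
    congrArg Prod.snd h
  rw [← sub_eq_zero, ← sub_smul] at h1
  have h3 : ((1 : K) - 2 * 2) • (insertionTwo K A x y l F).2 = 0 := by
    rw [sub_smul, one_smul, ← h2, sub_self]
  exact Prod.ext ((smul_eq_zero.mp h1).resolve_left (by norm_num))
    ((smul_eq_zero.mp h3).resolve_left (by norm_num))

end Degrees

/-! ### The Seiberg-Witten equations -/

theorem sum_ofFn_update {l : ℕ} (F : List V → X) (A x : V) :
    ∑ s : Fin l, F (List.ofFn (Function.update (fun _ => A) s x)) = insertion K A x l F := by
  induction l generalizing F with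
  | zero => rfl
  | succ l ih =>
    rw [Fin.sum_univ_succ, insertion_succ, ← ih]
    congr 1
    · rw [List.ofFn_succ, ← List.ofFn_const]
      simp
    · refine Finset.sum_congr rfl fun s _ => ?_
      rw [List.ofFn_succ, Function.update_of_ne (Fin.succ_ne_zero s).symm]
      congr 2
      refine congrArg List.ofFn (funext fun j => ?_)
      simp [Function.update_apply]

section Equations

variable {F : List (WeylSpace K n) → WeylSpace K n} (hF : Multi K F)

theorem potentialOf_toCochain (l : ℕ) (𝒜 : Fin n → MvPolynomial (Fin n) K) :
    potentialOf (toCochain F hF) l 𝒜 = (F (List.replicate l (0, 𝒜))).2 := by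
  rw [potentialOf, toCochain_apply, List.ofFn_const]

theorem parameterOf_toCochain (l : ℕ) (lam : MvPolynomial (Fin n) K)
    (𝒜 : Fin n → MvPolynomial (Fin n) K) :
    parameterOf (toCochain F hF) l lam 𝒜 = (insertion K (0, 𝒜) (lam, 0) l F).1 := by
  rw [← sum_ofFn_update, Prod.fst_sum]
  rfl

theorem insertion_relation {θ θ' : Matrix (Fin n) (Fin n) K} (hd : ∀ L, defect θ θ' F L = 0) :
    delta F + mulCoder θ F = (fun L => diff (F L)) + cup θ' (scaleArgs (-1) F) F := by
  funext L
  have h := hd L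
  rw [defect, Pi.sub_apply, Pi.sub_apply, sub_sub, sub_eq_zero] at h
  exact h

/-- Insert `x` at all positions of `A ⋯ A` in the morphism equation: `delta` yields the insertion of
`d x`, the product terms of the source cancel, and the cup product, with the signs of its odd and
even factors, is the star commutator. -/
theorem gauge_equation [CharZero K] (hF : Multi K F) (he : ScaleEquivariant F) {θ : Matrix (Fin n) (Fin n) K}
    (hd : ∀ L, defect 0 θ F L = 0) (l : ℕ) {A x : WeylSpace K n} (hA : A.1 = 0) (hx : x.2 = 0) :
    insertion K A (diff x) l F = diff (insertion K A x l F) +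
      ∑ r ∈ Finset.HasAntidiagonal.antidiagonal l,
        (starMul θ (F (List.replicate r.1 A)) (insertion K A x r.2 F) -
          starMul θ (insertion K A x r.1 F) (F (List.replicate r.2 A))) := by
  have hbx : barParity x = -x := by
    rw [← scale_neg_one, scale_of_snd_eq_zero hx, neg_smul, one_smul]
  have h := congrArg (insertion K A x l) (insertion_relation hd)
  rw [map_add, map_add, insertion_delta hA hF, insertion_mulCoder_zero hA hF hbx, add_zero,
    ← postcomp_insertion, insertion_cup] at h
  rw [h]
  congr 1
  refine Finset.sum_congr rfl fun r _ => ?_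
  rw [he.barParity, ← postcomp_insertion]
  dsimp only
  rw [barParity_of_fst_eq_zero (fst_replicate he hA _),
    ← scale_neg_one, scale_of_snd_eq_zero (snd_insertion he hA hx hF _), neg_smul, one_smul,
    map_neg, LinearMap.neg_apply]
  abel

/-- Insert two gauge parameters in the morphism equation. Values with both parameters inside one `F`
vanish by degree, so `d F` drops out and the cup product keeps one parameter in each factor;
exchanging `x` and `y` and subtracting removes the product terms of the source. -/
theorem consistency_equation [CharZero K] (hF : Multi K F) (he : ScaleEquivariant F)
    {θ : Matrix (Fin n) (Fin n) K} (hd : ∀ L, defect 0 θ F L = 0) (l : ℕ)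
    {A x y : WeylSpace K n} (hA : A.1 = 0) (hx : x.2 = 0) (hy : y.2 = 0) :
    (insertionTwo K A x (diff y) l F + insertionTwo K A (diff y) x l F) -
      (insertionTwo K A y (diff x) l F + insertionTwo K A (diff x) y l F) =
      ∑ r ∈ Finset.HasAntidiagonal.antidiagonal l,
        (starMul θ (insertion K A x r.1 F) (insertion K A y r.2 F) -
          starMul θ (insertion K A y r.1 F) (insertion K A x r.2 F)) := by
  have hb : ∀ {z : WeylSpace K n}, z.2 = 0 → barParity z = -z := fun hz => by
    rw [← scale_neg_one, scale_of_snd_eq_zero hz, neg_smul, one_smul]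
  have key : ∀ {x y : WeylSpace K n}, x.2 = 0 → y.2 = 0 →
      insertionTwo K A (diff x) y l F - insertionTwo K A x (diff y) l F +
        insertionTwo K A x y l (mulCoder 0 F) =
      -∑ r ∈ Finset.HasAntidiagonal.antidiagonal l,
        starMul θ (insertion K A x r.1 F) (insertion K A y r.2 F) := by
    intro x y hx hy
    have h := congrArg (insertionTwo K A x y l) (insertion_relation hd)
    rw [map_add, map_add, insertionTwo_delta hA hF, ← postcomp_insertionTwo,
      insertionTwo_eq_zero he hA hx hy hF, map_zero, zero_add, insertionTwo_cup, hb hx,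
      (isLinearMap_insertionTwo_left hF A _ l).map_neg, ← sub_eq_add_neg] at h
    rw [h, ← Finset.sum_neg_distrib]
    refine Finset.sum_congr rfl fun r _ => ?_
    rw [he.barParity, ← postcomp_insertionTwo, ← postcomp_insertion,
      insertionTwo_eq_zero he hA hx hy hF, insertionTwo_eq_zero he hA hx hy hF,
      hb (snd_insertion he hA hx hF _)]
    simp
  have h1 := key hx hy
  have h2 := key hy hx
  rw [insertionTwo_mulCoder_zero_comm hA hF (hb hy) (hb hx)] at h2
  rw [Finset.sum_sub_distrib, neg_eq_iff_eq_neg.mp h1.symm, neg_eq_iff_eq_neg.mp h2.symm]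
  abel

theorem satisfiesSeibergWitten_toCochain [CharZero K] (h0 : F [] = 0) (he : ScaleEquivariant F)
    {θ : Matrix (Fin n) (Fin n) K} (hd : ∀ L, defect 0 θ F L = 0) :
    SatisfiesSeibergWitten θ (fun l 𝒜 => potentialOf (toCochain F hF) l 𝒜)
      (fun l lam 𝒜 => parameterOf (toCochain F hF) l lam 𝒜) := by
  have hsw : ∀ (l : ℕ) (g : ℕ × ℕ → MvPolynomial (Fin n) K),
      ∑ r ∈ Finset.HasAntidiagonal.antidiagonal l, g r.swap =
        ∑ r ∈ Finset.HasAntidiagonal.antidiagonal l, g r := fun l g =>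
    Finset.Nat.sum_antidiagonal_swap
  have hline : ∀ (t : K) (𝒜 : Fin n → MvPolynomial (Fin n) K) (lam : MvPolynomial (Fin n) K),
      ((0, 𝒜 + t • grad lam) : WeylSpace K n) = (0, 𝒜) + t • diff (lam, 0) := fun t 𝒜 lam => by
    simp [diff_apply]
  refine ⟨fun 𝒜 => ?_, fun lam 𝒜 => ?_, fun l t 𝒜 => ?_, fun l lam t 𝒜 => ?_, fun l 𝒜 => ?_,
    fun l lam 𝒜 => ?_, fun l lam₁ lam₂ 𝒜 => ?_⟩
  · simp only [potentialOf_toCochain, List.replicate_zero, h0, Prod.snd_zero]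
  · simp [parameterOf_toCochain, insertion]
  · simp only [potentialOf_toCochain]
    rw [show ((0, t • 𝒜) : WeylSpace K n) = t • (0, 𝒜) by simp, replicate_smul hF, Prod.smul_snd]
  · simp only [parameterOf_toCochain]
    rw [show ((0, t • 𝒜) : WeylSpace K n) = t • (0, 𝒜) by simp, insertion_smul hF, Prod.smul_fst]
  · simp only [parameterOf_toCochain]
    exact (LinearMap.fst K _ _ ∘ₗ (isLinearMap_insertion hF (0, 𝒜) l).mk' _ ∘ₗ inFun K n).isLinear
  · have h1 := (hasExpansion_replicate hF (0, 𝒜) (diff (lam, 0)) l).map (LinearMap.snd K _ _)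
    simp only [← hline] at h1
    have h2 := gauge_equation hF he hd l (A := (0, 𝒜)) (x := (lam, 0)) rfl rfl
    have h3 : (fun i => MvPolynomial.pderiv i (parameterOf (toCochain F hF) l lam 𝒜) +
        ∑ r ∈ Finset.HasAntidiagonal.antidiagonal l,
          (moyal θ (potentialOf (toCochain F hF) r.1 𝒜 i) (parameterOf (toCochain F hF) r.2 lam 𝒜) -
            moyal θ (parameterOf (toCochain F hF) r.2 lam 𝒜)
              (potentialOf (toCochain F hF) r.1 𝒜 i))) =
        (insertion K (0, 𝒜) (diff (lam, 0)) l F).2 := by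
      rw [h2]
      funext i
      simp only [potentialOf_toCochain, parameterOf_toCochain, Prod.snd_add, Pi.add_apply,
        Prod.snd_sum, Finset.sum_apply, Prod.snd_sub, Pi.sub_apply, starMul_apply, diff_apply, grad,
        Finset.sum_sub_distrib]
      rw [← hsw l fun r => moyal θ (insertion K (0, 𝒜) (lam, 0) r.2 F).1
        ((F (List.replicate r.1 (0, 𝒜))).2 i)]
      simp only [Prod.fst_swap, Prod.snd_swap, fst_replicate he (A := (0, 𝒜)) rfl,
        snd_insertion he (A := (0, 𝒜)) (x := (lam, 0)) rfl rfl hF, moyal_zero_right, Pi.zero_apply, zero_add, add_zero]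
    rw [h3]
    obtain ⟨N, c, hc⟩ := h1
    refine ⟨N, c, fun t => ?_⟩
    simp only [potentialOf_toCochain]
    exact hc t
  · have h1 := fun lam lam' => (hasExpansion_insertion hF (0, 𝒜) (diff (lam', 0)) (lam, 0)
      (l + 1)).map (LinearMap.fst K _ _)
    simp only [← hline] at h1
    have h2 := consistency_equation hF he hd (l + 1) (A := (0, 𝒜)) (x := (lam₁, 0))
      (y := (lam₂, 0)) rfl rfl rfl
    have hexp : ∀ lam lam', HasDirDeriv (K := K)
        (fun 𝒜 => parameterOf (toCochain F hF) (l + 1) lam 𝒜) 𝒜 (grad lam')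
        (insertionTwo K (0, 𝒜) (lam, 0) (diff (lam', 0)) (l + 1) F +
          insertionTwo K (0, 𝒜) (diff (lam', 0)) (lam, 0) (l + 1) F).1 := by
      intro lam lam'
      obtain ⟨N, c, hc⟩ := h1 lam lam'
      refine ⟨N, c, fun t => ?_⟩
      simp only [parameterOf_toCochain]
      exact hc t
    refine ⟨_, _, hexp lam₁ lam₂, hexp lam₂ lam₁, ?_⟩
    rw [← Prod.fst_sub, h2]
    have h3 : parameterOf (toCochain F hF) l (moyal 0 lam₁ lam₂ - moyal 0 lam₂ lam₁) 𝒜 = 0 := by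
      rw [moyal_zero, moyal_zero, mul_comm, sub_self, parameterOf_toCochain,
        show ((0, 0) : WeylSpace K n) = 0 from rfl, (isLinearMap_insertion hF _ l).map_zero]
      rfl
    rw [h3, sub_zero, Prod.fst_sum]
    simp only [Prod.fst_sub, starMul_apply, parameterOf_toCochain, Finset.sum_sub_distrib]
    congr 1
    exact (hsw (l + 1) fun r => moyal θ (insertion K (0, 𝒜) (lam₂, 0) r.1 F).1
      (insertion K (0, 𝒜) (lam₁, 0) r.2 F).1).symm

end Equations

end GaugeTheory

/-! ### Polynomial dependence on `θ` and the value at `θ = 0`. -/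

section PolynomialDependence

set_option linter.unusedSectionVars false

variable {K : Type*} [Field K] {n : ℕ} {X Y Z : Type*} [AddCommGroup X] [Module K X]
  [AddCommGroup Y] [Module K Y] [AddCommGroup Z] [Module K Z]

/-! ### Families depending polynomially on `θ` -/

/-- A monomial in the entries of `θ`. -/
def thetaMonomial (k : (Fin n × Fin n) →₀ ℕ) (θ : Matrix (Fin n) (Fin n) K) : K :=
  k.prod fun ij e => θ ij.1 ij.2 ^ e

theorem thetaMonomial_zero (θ : Matrix (Fin n) (Fin n) K) : thetaMonomial 0 θ = 1 :=
  Finsupp.prod_zero_index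

theorem thetaMonomial_add (k k' : (Fin n × Fin n) →₀ ℕ) (θ : Matrix (Fin n) (Fin n) K) :
    thetaMonomial (k + k') θ = thetaMonomial k θ * thetaMonomial k' θ :=
  Finsupp.prod_add_index' (fun _ => pow_zero _) fun _ _ _ => pow_add _ _ _

theorem thetaMonomial_single (i j : Fin n) (θ : Matrix (Fin n) (Fin n) K) :
    thetaMonomial (Finsupp.single (i, j) 1) θ = θ i j := by
  exact (Finsupp.prod_single_index (h := fun (ij : Fin n × Fin n) e => θ ij.1 ij.2 ^ e)
    (pow_zero _)).trans (pow_one _)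

theorem thetaMonomial_apply_zero {k : (Fin n × Fin n) →₀ ℕ} (h : k ≠ 0) :
    thetaMonomial k (0 : Matrix (Fin n) (Fin n) K) = 0 := by
  obtain ⟨ij, hij⟩ := Finsupp.support_nonempty_iff.mpr h
  exact Finset.prod_eq_zero hij (zero_pow (Finsupp.mem_support_iff.mp hij))

variable (K n X) in
/-- The families of elements of `X` which are polynomials in the entries of `θ`. -/
def polyFamily : Submodule K (Matrix (Fin n) (Fin n) K → X) :=
  Submodule.span K (Set.range fun kv : ((Fin n × Fin n) →₀ ℕ) × X =>
    fun θ => thetaMonomial kv.1 θ • kv.2)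

theorem thetaMonomial_smul_mem (k : (Fin n × Fin n) →₀ ℕ) (v : X) :
    (fun θ => thetaMonomial k θ • v) ∈ polyFamily K n X :=
  Submodule.subset_span ⟨(k, v), rfl⟩

theorem const_mem_polyFamily (v : X) : (fun _ => v) ∈ polyFamily K n X := by
  simpa only [thetaMonomial_zero, one_smul] using thetaMonomial_smul_mem (K := K) (n := n) 0 v

theorem entry_mem_polyFamily (i j : Fin n) : (fun θ => θ i j) ∈ polyFamily K n K := by
  simpa only [thetaMonomial_single, smul_eq_mul, mul_one] using
    thetaMonomial_smul_mem (K := K) (Finsupp.single (i, j) 1) (1 : K)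

theorem add_mem_polyFamily {Q R : Matrix (Fin n) (Fin n) K → X} (hQ : Q ∈ polyFamily K n X)
    (hR : R ∈ polyFamily K n X) : (fun θ => Q θ + R θ) ∈ polyFamily K n X :=
  (polyFamily K n X).add_mem hQ hR

theorem sub_mem_polyFamily {Q R : Matrix (Fin n) (Fin n) K → X} (hQ : Q ∈ polyFamily K n X)
    (hR : R ∈ polyFamily K n X) : (fun θ => Q θ - R θ) ∈ polyFamily K n X :=
  (polyFamily K n X).sub_mem hQ hR

theorem const_smul_mem_polyFamily (c : K) {Q : Matrix (Fin n) (Fin n) K → X}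
    (hQ : Q ∈ polyFamily K n X) : (fun θ => c • Q θ) ∈ polyFamily K n X :=
  (polyFamily K n X).smul_mem c hQ

@[elab_as_elim]
theorem polyFamily_induction {p : (Q : Matrix (Fin n) (Fin n) K → X) → Q ∈ polyFamily K n X → Prop}
    (mon : ∀ k v, p (fun θ => thetaMonomial k θ • v) (thetaMonomial_smul_mem k v))
    (zero : p (fun _ => 0) (zero_mem _))
    (add : ∀ Q R hQ hR, p Q hQ → p R hR → p (fun θ => Q θ + R θ) (add_mem_polyFamily hQ hR))
    (smul : ∀ (c : K) Q hQ, p Q hQ → p (fun θ => c • Q θ) (const_smul_mem_polyFamily c hQ))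
    {Q : Matrix (Fin n) (Fin n) K → X} (hQ : Q ∈ polyFamily K n X) : p Q hQ := by
  refine Submodule.span_induction ?_ zero (fun Q R hQ hR => add Q R hQ hR)
    (fun c Q hQ => smul c Q hQ) hQ
  rintro _ ⟨⟨k, v⟩, rfl⟩
  exact mon k v

/-- The bilinear map may itself depend on `θ`, since it will be the product of `A_θ`. -/
theorem bilin_mem_polyFamily {B : Matrix (Fin n) (Fin n) K → X →ₗ[K] Y →ₗ[K] Z}
    (hB : ∀ x y, (fun θ => B θ x y) ∈ polyFamily K n Z) {Q : Matrix (Fin n) (Fin n) K → X}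
    {R : Matrix (Fin n) (Fin n) K → Y} (hQ : Q ∈ polyFamily K n X) (hR : R ∈ polyFamily K n Y) :
    (fun θ => B θ (Q θ) (R θ)) ∈ polyFamily K n Z := by
  have hmul : ∀ (k : (Fin n × Fin n) →₀ ℕ) {S : Matrix (Fin n) (Fin n) K → Z},
      S ∈ polyFamily K n Z → (fun θ => thetaMonomial k θ • S θ) ∈ polyFamily K n Z := by
    intro k S hS
    induction hS using polyFamily_induction with
    | mon k' v =>
      simpa only [smul_smul, ← thetaMonomial_add] using thetaMonomial_smul_mem (K := K) (k + k') v
    | zero => simpa using const_mem_polyFamily (K := K) (n := n) (0 : Z)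
    | add S S' _ _ h h' => simpa only [smul_add] using add_mem_polyFamily h h'
    | smul c S _ h =>
      simpa only [smul_comm c] using const_smul_mem_polyFamily c h
  induction hQ using polyFamily_induction with
  | mon k v =>
    simp only [map_smul, LinearMap.smul_apply]
    refine hmul k ?_
    induction hR using polyFamily_induction with
    | mon k' w =>
      simp only [map_smul]
      exact hmul k' (hB v w)
    | zero => simpa using const_mem_polyFamily (K := K) (n := n) (0 : Z)
    | add R R' _ _ h h' => simpa only [map_add] using add_mem_polyFamily h h'
    | smul c R _ h => simpa only [map_smul] using const_smul_mem_polyFamily c h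
  | zero => simpa using const_mem_polyFamily (K := K) (n := n) (0 : Z)
  | add Q Q' _ _ h h' =>
    simpa only [map_add, LinearMap.add_apply] using add_mem_polyFamily h h'
  | smul c Q _ h =>
    simpa only [map_smul, LinearMap.smul_apply] using
      const_smul_mem_polyFamily c h

theorem map_mem_polyFamily (T : X →ₗ[K] Y) {Q : Matrix (Fin n) (Fin n) K → X}
    (hQ : Q ∈ polyFamily K n X) : (fun θ => T (Q θ)) ∈ polyFamily K n Y := by
  induction hQ using polyFamily_induction with
  | mon k v => simpa only [map_smul] using thetaMonomial_smul_mem (K := K) k (T v)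
  | zero => simpa using const_mem_polyFamily (K := K) (n := n) (0 : Y)
  | add Q Q' _ _ h h' => simpa only [map_add] using add_mem_polyFamily h h'
  | smul c Q _ h => simpa only [map_smul] using const_smul_mem_polyFamily c h

theorem smul_mem_polyFamily {c : Matrix (Fin n) (Fin n) K → K} {Q : Matrix (Fin n) (Fin n) K → X}
    (hc : c ∈ polyFamily K n K) (hQ : Q ∈ polyFamily K n X) :
    (fun θ => c θ • Q θ) ∈ polyFamily K n X :=
  bilin_mem_polyFamily (B := fun _ => LinearMap.lsmul K X)
    (fun x y => const_mem_polyFamily (x • y)) hc hQ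

theorem sum_mem_polyFamily {ι : Type*} {s : Finset ι} {Q : ι → Matrix (Fin n) (Fin n) K → X}
    (h : ∀ i ∈ s, Q i ∈ polyFamily K n X) : (fun θ => ∑ i ∈ s, Q i θ) ∈ polyFamily K n X := by
  have h1 := (polyFamily K n X).sum_mem h
  rwa [show ∑ i ∈ s, Q i = fun θ => ∑ i ∈ s, Q i θ from funext fun θ => Finset.sum_apply _ _ _]
    at h1

/-- All nontrivial monomials vanish at `θ = 0`, so the coefficient of the trivial one is `Q 0`. -/
theorem isBigOTheta_of_mem_polyFamily {Q : Matrix (Fin n) (Fin n) K → X}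
    (hQ : Q ∈ polyFamily K n X) (h0 : Q 0 = 0) : IsBigOTheta Q := by
  have h1 : ∃ c : ((Fin n × Fin n) →₀ ℕ) →₀ X,
      ∀ θ, Q θ = c.sum fun k v => thetaMonomial k θ • v := by
    clear h0
    induction hQ using polyFamily_induction with
    | mon k v => exact ⟨Finsupp.single k v, fun θ => by
        exact (Finsupp.sum_single_index (h := fun k v => thetaMonomial k θ • v)
          (smul_zero _)).symm⟩
    | zero => exact ⟨0, fun θ => Finsupp.sum_zero_index.symm⟩
    | add Q Q' _ _ h h' =>
      obtain ⟨c, hc⟩ := h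
      obtain ⟨c', hc'⟩ := h'
      refine ⟨c + c', fun θ => ?_⟩
      rw [Finsupp.sum_add_index' (fun _ => smul_zero _) (fun _ => smul_add _), ← hc, ← hc']
    | smul r Q _ h =>
      obtain ⟨c, hc⟩ := h
      refine ⟨r • c, fun θ => ?_⟩
      rw [Finsupp.sum_smul_index' (fun _ => smul_zero _)]
      simp only [smul_comm _ r, hc, Finsupp.smul_sum]
  obtain ⟨c, hc⟩ := h1
  refine ⟨c.support, c, ?_, fun θ _ => hc θ⟩
  rw [Finsupp.notMem_support_iff, ← h0, hc, Finsupp.sum, Finset.sum_eq_single 0]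
  · rw [thetaMonomial_zero, one_smul]
  · intro k _ hk
    rw [thetaMonomial_apply_zero hk, zero_smul]
  · intro h
    rw [Finsupp.notMem_support_iff.mp h, smul_zero]

/-! ### The recurrence depends polynomially on `θ` -/

theorem moyalMap_mem_polyFamily (u : MvPolynomial (Fin n) K ⊗[K] MvPolynomial (Fin n) K) :
    (fun θ => moyalMap θ u) ∈ polyFamily K n (MvPolynomial (Fin n) K) := by
  obtain ⟨N, hN⟩ := exists_bidiff_pow_eq_zero u
  have h1 : ∀ k, (fun θ : Matrix (Fin n) (Fin n) K => (bidiff θ ^ k) u) ∈ polyFamily K n _ := by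
    intro k
    induction k with
    | zero => exact const_mem_polyFamily u
    | succ k ih =>
      have h2 : ∀ θ : Matrix (Fin n) (Fin n) K, (bidiff θ ^ (k + 1)) u =
          ∑ i, ∑ j, (1 / 2 : K) • θ i j • TensorProduct.map (MvPolynomial.pderiv i).toLinearMap
            (MvPolynomial.pderiv j).toLinearMap ((bidiff θ ^ k) u) := fun θ => by
        rw [pow_succ', Module.End.mul_apply, bidiff]
        simp only [LinearMap.sum_apply, LinearMap.smul_apply, mul_smul]
      simp only [h2]
      exact sum_mem_polyFamily fun i _ => sum_mem_polyFamily fun j _ =>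
        const_smul_mem_polyFamily _
          (smul_mem_polyFamily (entry_mem_polyFamily i j) (map_mem_polyFamily _ ih))
  rw [show (fun θ => moyalMap θ u) = fun θ => ∑ k ∈ Finset.range N, moyalTerm θ k u from
    funext fun θ => moyalMap_eq_sum θ u N (hN θ)]
  exact sum_mem_polyFamily fun k _ =>
    const_smul_mem_polyFamily _ (map_mem_polyFamily (LinearMap.mul' K _) (h1 k))

theorem starMul_mem_polyFamily {Q R : Matrix (Fin n) (Fin n) K → WeylSpace K n}
    (hQ : Q ∈ polyFamily K n (WeylSpace K n)) (hR : R ∈ polyFamily K n (WeylSpace K n)) :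
    (fun θ => starMul θ (Q θ) (R θ)) ∈ polyFamily K n (WeylSpace K n) := by
  refine bilin_mem_polyFamily (fun a b => ?_) hQ hR
  rw [show (fun θ => starMul θ a b) = (fun θ => LinearMap.inl K _ _ (moyal θ a.1 b.1)) +
      fun θ => ∑ i, LinearMap.inr K (MvPolynomial (Fin n) K) _
        (LinearMap.single K (fun _ : Fin n => MvPolynomial (Fin n) K) i
          (moyal θ a.1 (b.2 i) + moyal θ (a.2 i) b.1)) from by
    funext θ
    rw [Pi.add_apply, ← map_sum, starMul_apply]
    simp only [LinearMap.coe_single, Finset.univ_sum_single]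
    simp]
  exact add_mem_polyFamily (map_mem_polyFamily _ (moyalMap_mem_polyFamily _))
    (sum_mem_polyFamily fun i _ => map_mem_polyFamily _ (map_mem_polyFamily _
      (add_mem_polyFamily (moyalMap_mem_polyFamily _) (moyalMap_mem_polyFamily _))))

/-- All values of the family `F` are polynomials in the entries of `θ`. -/
def PolyDependence {V : Type*} (F : Matrix (Fin n) (Fin n) K → List V → X) : Prop :=
  ∀ L, (fun θ => F θ L) ∈ polyFamily K n X

section Families

variable {F G : Matrix (Fin n) (Fin n) K → List (WeylSpace K n) → WeylSpace K n}

theorem PolyDependence.tailFun (hF : PolyDependence F) (a : WeylSpace K n) :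
    PolyDependence fun θ => tailFun a (F θ) := fun L => hF (a :: L)

theorem PolyDependence.mulCoder (hF : PolyDependence F) (θ₀ : Matrix (Fin n) (Fin n) K) :
    PolyDependence fun θ => mulCoder θ₀ (F θ) := by
  intro L
  induction L generalizing F with
  | nil => exact const_mem_polyFamily 0
  | cons a L ih =>
    refine add_mem_polyFamily ?_ (ih (hF.tailFun (barParity a)))
    cases L with
    | nil => exact const_mem_polyFamily 0
    | cons b L => exact hF (starMul θ₀ (barParity a) b :: L)

theorem PolyDependence.cup (hF : PolyDependence F) (hG : PolyDependence G) :
    PolyDependence fun θ => cup θ (F θ) (G θ) := by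
  intro L
  induction L generalizing F with
  | nil => exact starMul_mem_polyFamily (hF []) (hG [])
  | cons a L ih =>
    exact add_mem_polyFamily (starMul_mem_polyFamily (hF []) (hG (a :: L)))
      (ih (hF.tailFun a))

theorem PolyDependence.psi (hF : PolyDependence F) (θ₀ : Matrix (Fin n) (Fin n) K) :
    PolyDependence fun θ => psi θ₀ θ (F θ) := fun L =>
  sub_mem_polyFamily (hF.mulCoder θ₀ L)
    (PolyDependence.cup (F := fun θ => scaleArgs (-1) (F θ)) (fun L => hF (L.map (scale (-1)))) hF L)

theorem PolyDependence.htpy (hF : PolyDependence F) : PolyDependence fun θ => htpy (F θ) := by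
  intro L
  induction L generalizing F with
  | nil => exact const_mem_polyFamily 0
  | cons a L ih =>
    exact add_mem_polyFamily (hF (poincare a :: L.map poincareProj))
      (ih (hF.tailFun (barParity a)))

theorem PolyDependence.shift (hF : PolyDependence F) (c : K) :
    PolyDependence fun θ => shift c (F θ) := by
  intro L
  induction L generalizing F with
  | nil => exact hF []
  | cons a L ih =>
    simp only [shift_cons_eq_sum]
    exact sum_mem_polyFamily fun s _ => map_mem_polyFamily
      ((LinearMap.lsmul (MvPolynomial (Fin n) K) (WeylSpace K n) (coords c a s)).restrictScalars K)
      (ih (hF.tailFun (slotVec s)))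

theorem PolyDependence.opHtpy (hF : PolyDependence F) : PolyDependence fun θ => opHtpy (F θ) :=
  (hF.shift (-1)).htpy.shift 1

theorem PolyDependence.lengthPart (hF : PolyDependence F) (N : ℕ) :
    PolyDependence fun θ => lengthPart K N (F θ) := by
  intro L
  by_cases h : L.length = N
  · simpa only [lengthPart_of_eq _ h] using hF L
  · simpa only [lengthPart_of_ne _ h] using const_mem_polyFamily 0

theorem PolyDependence.stepFun (hF : PolyDependence F) (N : ℕ) :
    PolyDependence fun θ => stepFun N (F θ) :=
  PolyDependence.opHtpy fun L => map_mem_polyFamily (-LinearMap.id)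
    (map_mem_polyFamily ((funPart K n).restrictScalars K) (hF.lengthPart N L))

theorem PolyDependence.stepForm (hF : PolyDependence F) (N : ℕ) :
    PolyDependence fun θ => stepForm N (F θ) :=
  PolyDependence.opHtpy fun L => sub_mem_polyFamily
    (map_mem_polyFamily diff (hF.stepFun N L))
    (map_mem_polyFamily ((formPart K n).restrictScalars K) (hF.lengthPart N L))

end Families

theorem polyDependence_approx (θ₀ : Matrix (Fin n) (Fin n) K) (k : ℕ) :
    PolyDependence fun θ => approx θ₀ θ k := by
  induction k with
  | zero => exact fun L => const_mem_polyFamily _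
  | succ k ih =>
    exact fun L => add_mem_polyFamily (ih L) (add_mem_polyFamily
      ((ih.psi θ₀).stepFun (k + 2) L) ((ih.psi θ₀).stepForm (k + 2) L))

theorem polyDependence_solution (θ₀ : Matrix (Fin n) (Fin n) K) :
    PolyDependence fun θ => solution θ₀ θ := fun L => polyDependence_approx θ₀ L.length L

/-- Between equal algebras the identity is strictly multiplicative, so the recurrence adds nothing
to it; `solution_self` then supplies the value at `θ = 0` needed for the initial condition. -/
theorem psi_singleFun (θ : Matrix (Fin n) (Fin n) K) : psi θ θ singleFun = 0 := by
  have h0 : ∀ x y : WeylSpace K n, tailFun y (tailFun x singleFun) = 0 := fun _ _ => rfl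
  have h1 : ∀ (x : WeylSpace K n) (L), mulCoder θ (tailFun x singleFun) L = 0 := by
    intro x L
    match L with
    | [] => rfl
    | [b] => rw [mulCoder_cons, h0, map_zero]; exact add_zero _
    | b :: c :: L => rw [mulCoder_cons, h0, map_zero]; exact add_zero _
  funext L
  cases L with
  | nil => simp [psi]
  | cons a L =>
    rw [psi, Pi.sub_apply, cup_singleFun_left, mulCoder_cons, h1, add_zero]
    match L with
    | [] => simp
    | [b] => simp
    | b :: c :: L => simp

theorem approx_self (θ : Matrix (Fin n) (Fin n) K) (k : ℕ) : approx θ θ k = singleFun := by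
  induction k with
  | zero => rfl
  | succ k ih =>
    have h1 : stepFun (k + 2) (0 : List (WeylSpace K n) → WeylSpace K n) = 0 := funext fun L =>
      opHtpy_eq_zero fun M _ => by simp
    have h2 : stepForm (k + 2) (0 : List (WeylSpace K n) → WeylSpace K n) = 0 := funext fun L =>
      opHtpy_eq_zero fun M _ => by simp [h1]
    rw [approx, ih, psi_singleFun, h1, h2, add_zero, add_zero]

theorem solution_self (θ : Matrix (Fin n) (Fin n) K) : solution θ θ = singleFun :=
  funext fun L => congrFun (approx_self θ L.length) L

/-! ### The first order in `θ` -/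

theorem singleFun_replicate {V : Type*} [AddCommGroup V] (A : V) (l : ℕ) :
    singleFun (List.replicate l A) = if l = 1 then A else 0 := by
  match l with
  | 0 => rfl
  | 1 => rfl
  | l + 2 => simp [List.replicate_succ]

theorem insertion_singleFun {V : Type*} [AddCommGroup V] [Module K V] (A x : V) (l : ℕ) :
    insertion K A x l singleFun = if l = 1 then x else 0 := by
  have h1 : ∀ l, insertion K A x l (tailFun A singleFun) = 0 := by
    rintro (_ | l)
    · rfl
    · rw [insertion_succ, show tailFun A (tailFun A singleFun) = (0 : List V → V) from rfl, map_zero]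
      exact add_zero _
  match l with
  | 0 => rfl
  | 1 => simp [insertion]
  | l + 2 => rw [insertion_succ, h1]; simp [List.replicate_succ]

theorem PolyDependence.insertion {V : Type*} {F : Matrix (Fin n) (Fin n) K → List V → X}
    (hF : PolyDependence F) (A x : V) (l : ℕ) :
    (fun θ => insertion K A x l (F θ)) ∈ polyFamily K n X := by
  induction l generalizing F with
  | zero => exact const_mem_polyFamily 0
  | succ l ih =>
    exact add_mem_polyFamily (hF (x :: List.replicate l A))
      (ih fun L => hF (A :: L))

theorem isBigOTheta_potential [CharZero K] (l : ℕ) (𝒜 : Fin n → MvPolynomial (Fin n) K) :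
    IsBigOTheta fun θ => potentialOf (toCochain (solution 0 θ) (multi_solution 0 θ)) l 𝒜 -
      if l = 1 then 𝒜 else 0 := by
  simp only [potentialOf_toCochain]
  refine isBigOTheta_of_mem_polyFamily (sub_mem_polyFamily
    (map_mem_polyFamily (LinearMap.snd K _ _) (polyDependence_solution 0 _))
    (const_mem_polyFamily _)) ?_
  rw [solution_self, singleFun_replicate]
  split_ifs <;> simp

theorem isBigOTheta_parameter [CharZero K] (l : ℕ) (lam : MvPolynomial (Fin n) K)
    (𝒜 : Fin n → MvPolynomial (Fin n) K) :
    IsBigOTheta fun θ => parameterOf (toCochain (solution 0 θ) (multi_solution 0 θ)) l lam 𝒜 -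
      if l = 1 then lam else 0 := by
  simp only [parameterOf_toCochain]
  refine isBigOTheta_of_mem_polyFamily (sub_mem_polyFamily
    (map_mem_polyFamily (LinearMap.fst K _ _) ((polyDependence_solution 0).insertion _ _ l))
    (const_mem_polyFamily _)) ?_
  rw [solution_self, insertion_singleFun]
  split_ifs <;> simp

end PolynomialDependence

end SeibergWitten

end

theorem mainTheorem2 (K : Type*) [Field K] [CharZero K] (n : ℕ) :
    ∃ f : Matrix (Fin n) (Fin n) K → Matrix (Fin n) (Fin n) K →
        SeibergWitten.Cochain K (SeibergWitten.WeylSpace K n) (SeibergWitten.WeylSpace K n),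
      (∀ θ θ' : Matrix (Fin n) (Fin n) K, θ.transpose = -θ → θ'.transpose = -θ' →
        SeibergWitten.IsAInfinityAlgebra (SeibergWitten.grading K n)
          (SeibergWitten.structureMaps θ) ∧
        SeibergWitten.IsAInfinityAlgebra (SeibergWitten.grading K n)
          (SeibergWitten.structureMaps θ') ∧
        SeibergWitten.SatisfiesRecurrence θ θ' (f θ θ') ∧
        (∀ g : SeibergWitten.Cochain K (SeibergWitten.WeylSpace K n) (SeibergWitten.WeylSpace K n),
          SeibergWitten.SatisfiesRecurrence θ θ' g → g = f θ θ') ∧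
        (∀ a : SeibergWitten.WeylSpace K n, f θ θ' 1 (fun _ => a) = a) ∧
        (∀ l, 2 ≤ l → SeibergWitten.IsNormal (f θ θ' l)) ∧
        SeibergWitten.IsAInfinityMorphism
          (SeibergWitten.grading K n) (SeibergWitten.structureMaps θ)
          (SeibergWitten.grading K n) (SeibergWitten.structureMaps θ') (f θ θ') ∧
        SeibergWitten.IsAInfinityQuasiIso
          (SeibergWitten.grading K n) (SeibergWitten.structureMaps θ)
          (SeibergWitten.grading K n) (SeibergWitten.structureMaps θ') (f θ θ') ∧
        SeibergWitten.IsAInfinityIso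
          (SeibergWitten.grading K n) (SeibergWitten.structureMaps θ)
          (SeibergWitten.grading K n) (SeibergWitten.structureMaps θ') (f θ θ')) ∧
      SeibergWitten.IsSeibergWittenMap
        (fun θ l 𝒜 => SeibergWitten.potentialOf (f 0 θ) l 𝒜)
        (fun θ l lam 𝒜 => SeibergWitten.parameterOf (f 0 θ) l lam 𝒜) := by
  open SeibergWitten in
  refine ⟨fun θ θ' => toCochain (solution θ θ') (multi_solution θ θ'), fun θ θ' _ _ => ?_,
    fun θ _ => ?_, isBigOTheta_potential, isBigOTheta_parameter⟩
  · have hf := multi_solution θ θ'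
    have hd := defect_solution θ θ'
    have he : ScaleEquivariant (solution θ θ') := scaleEquivariant_solution θ θ'
    have h1 : ∀ a, solution θ θ' [a] = a := solution_single θ θ'
    exact ⟨isAInfinityAlgebra θ, isAInfinityAlgebra θ', satisfiesRecurrence_solution θ θ',
      fun g hg => hg.unique (satisfiesRecurrence_solution θ θ'), h1,
      fun l hl => isNormal_toCochain hf (solution_normal θ θ') hl,
      isAInfinityMorphism_toCochain hf rfl he hd, isAInfinityQuasiIso_toCochain hf rfl h1 he hd,
      isAInfinityIso_toCochain hf rfl h1 he hd⟩
  · exact satisfiesSeibergWitten_toCochain (multi_solution 0 θ) rfl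
      (scaleEquivariant_solution 0 θ) (defect_solution 0 θ)
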